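/- Let $L>0$, let $S\subseteq\mathbb R$ be an interval containing $0$, and let $q(x,t)$ ($x\in\mathbb R$, $t\in S$) be a classical solution, $L$-periodic in $x$, of the defocusing nonlinear Schrödinger equation $iq_t+q_{xx}-2|q|^2q=0$ ($q$, $q_x$, $q_{xx}$, $q_t$ exist and are jointly continuous). Put $\sigma_3=\mathrm{diag}(1,-1)$, $Q=\begin{pmatrix}0&q\\ q^*&0\end{pmatrix}$, $U=\begin{pmatrix}1&1\\-i&i\end{pmatrix}$. *Spectral notions at a fixed time $t$.* Let $Y(x,t,z)$ solve $Y_x=(-iz\sigma_3+Q)Y$, $Y|_{x=0}=I$, and let $\tilde Y=UYU^{-1}$, $\Delta=\tfrac12\mathrm{tr}\,Y(L,t,z)$. The spectrum $\Sigma$ is the set of $z\in\mathbb C$ for which $v_x=(-iz\sigma_3+Q)v$ has a nonzero bounded solution on $\mathbb R$; it is real and does not depend on $t$. For $z\notin\Sigma$ let $\rho(z)$ be the root of $\rho^2-2\Delta(z)\rho+1=0$ with $|\rho|<1$, and let $\psi^\pm(x,t,z)$ be the solution of $\psi_x=U(-iz\sigma_3+Q)U^{-1}\psi$ with $\psi^\pm(x+L)=\rho^{\pm1}\psi^\pm(x)$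 and $\psi^\pm_1(0)=1$. A Dirichlet eigenvalue at time $t$ is a $\mu$ for which $v_x=(-i\mu\sigma_3+Q)v$ has a nonzero solution with $v_1+v_2=0$ at $x=0$ and at $x=L$; its sign is $\sigma=-\mathrm{sgn}\log|\tilde Y_{22}(L,t,\mu)|\in\{-1,0,1\}$. The gaps are the bounded components $(a,b)$, $a<b$, of $\mathbb R\setminus\Sigma$. The movable Dirichlet eigenvalues $\gamma_k(t)$, with signs $\sigma_k(t)$, are the Dirichlet eigenvalues at time $t$ that lie in the closed gaps. Let $R$ be the maximal gap length ($0$ if there is no gap) and let $\mathcal G$ be the union, over all gaps, of the closed discs of radius $R$ centred at the midpoints of the gaps. *Time factors.* Let $\alpha^\pm(t,z)$ be the first component of $U\bigl(-2iz^2\sigma_3+2zQ-i\sigma_3(Q^2-Q_x)\bigr)U^{-1}\psi^\pm$ at $x=0$, that is, $$\alpha^\pm=z(q^*+q)+\tfrac i2(q_x-q_x^*)+\bigl(2z^2+iz(q^*-q)+|q|^2+\tfrac12(q_x+q_x^*)\bigr)\psi_2^\pm(0,t,z),$$ with $q,q_x$ taken at $(0,t)$, and let $$e^\pm(t,z)=\exp\Bigl(\int_0^t\alpha^\pm(\tau,z)\,d\tau\Bigr)$$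 for all nonreal $z$, and for those real $z\notin\Sigma$ that are not Dirichlet eigenvalues at any time between $0$ and $t$. **Proposition.** Fix $t\in S$. 1. $e^\pm(t,\cdot)$ extend to meromorphic functions on $\mathbb C\setminus\Sigma$ (still denoted $e^\pm$). 2. On $\mathbb C\setminus\Sigma$, $e^+$ has simple poles at the $\gamma_k(0)$ with $\sigma_k(0)=1$, simple zeros at the $\gamma_k(t)$ with $\sigma_k(t)=1$, and no other zeros or poles, where a pole and a zero at the same point cancel. The same holds for $e^-$ with $\sigma_k=-1$ in place of $\sigma_k=1$. In other words, at each point of $\mathbb C\setminus\Sigma$ the order of $e^\pm$ is the number ($0$ or $1$) of $\gamma_k(t)$ with $\sigma_k(t)=\pm1$ at that point minus the number of $\gamma_k(0)$ with $\sigma_k(0)=\pm1$ there. 3. $e^\pm$ have square root singularities at the $\gamma_k(0)$ with $\sigma_k(0)=0$ and square root zeros at the $\gamma_k(t)$ with $\sigma_k(t)=0$, where again the two cancel if the points coincide. Precisely: if $E$ is an endpoint of a gap, then off $\Sigma$ and near $E$ one has $e^\pm(t,z)=s^{n}h^\pm(s)$, where $s=\sqrt{z-E}$ if $E$ is the left endpoint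 and $s=\sqrt{E-z}$ if it is the right one (principal branches), $h^\pm$ is holomorphic near $0$ with $h^\pm(0)\neq0$, and $n\in\{-1,0,1\}$ is the number of $\gamma_k(t)$ with $\sigma_k(t)=0$ equal to $E$ minus the number of $\gamma_k(0)$ with $\sigma_k(0)=0$ equal to $E$. 4. At every $z\in\Sigma$, except for the endpoints of gaps at which $n=-1$ in 3, the boundary value $e^\pm_+(t,z)$ from the upper half plane and the boundary value $e^\mp_-(t,z)$ from the lower half plane exist, are finite, and satisfy $e^\pm_+(t,z)=e^\mp_-(t,z)$. 5. As $z\to\infty$ outside $\mathcal G$, $$e^\pm(t,z)=\begin{cases}e^{\pm2iz^2t}(1+O(1/z)),&z\in\overline{\mathbb C^+},\\ e^{\mp2iz^2t}(1+O(1/z)),&z\in\overline{\mathbb C^-},\end{cases}$$ where for real $z$ the boundary value from the respective half plane is meant. 6. There are positive constants $c$ and $M$ (which may depend on $q$ and $t$) with $|e^\pm(t,z)|\le Me^{c|z|^2}$ for all $z\in\mathbb C\setminus(\mathbb R\cup\mathcal G)$. -/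

import Mathlib

open Filter Topology Set

noncomputable section

namespace DefocusingNLS

/-! ### The Zakharov-Shabat system at a fixed time -/

/-- The third Pauli matrix. -/
def pauli3 : Matrix (Fin 2) (Fin 2) ℂ := !![1, 0; 0, -1]

/-- The off-diagonal Hermitian matrix `Q` with upper right entry `w`. -/
def potMatrix (w : ℂ) : Matrix (Fin 2) (Fin 2) ℂ := !![0, w; star w, 0]

/-- The matrix `U` of the similarity transformation to the modified problem. -/
def simMatrix : Matrix (Fin 2) (Fin 2) ℂ := !![1, 1; -Complex.I, Complex.I]

/-- The coefficient matrix `-i z σ₃ + Q(x)` of the Zakharov-Shabat system with potential `p`. -/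
def zsMatrix (p : ℝ → ℂ) (z : ℂ) (x : ℝ) : Matrix (Fin 2) (Fin 2) ℂ :=
  (-(Complex.I * z)) • pauli3 + potMatrix (p x)

/-- `v` solves `v' = (-i z σ₃ + Q) v` on the whole line. -/
def IsZSSolution (p : ℝ → ℂ) (z : ℂ) (v : ℝ → Fin 2 → ℂ) : Prop :=
  ∀ x : ℝ, HasDerivAt v ((zsMatrix p z x).mulVec (v x)) x

/-- `v` solves the modified system `v' = U (-i z σ₃ + Q) U⁻¹ v` on the whole line. -/
def IsModZSSolution (p : ℝ → ℂ) (z : ℂ) (v : ℝ → Fin 2 → ℂ) : Prop :=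
  ∀ x : ℝ, HasDerivAt v ((simMatrix * zsMatrix p z x * simMatrix⁻¹).mulVec (v x)) x

/-- The Lax spectrum: the `z` for which there is a bounded nonzero solution on the line. -/
def laxSpectrum (p : ℝ → ℂ) : Set ℂ :=
  {z | ∃ v : ℝ → Fin 2 → ℂ, IsZSSolution p z v ∧ v ≠ 0 ∧ ∃ C : ℝ, ∀ x, ‖v x‖ ≤ C}

/-- The Dirichlet spectrum with base point `0`, for the boundary conditions
`v₁ + v₂ = 0` at `x = 0` and at `x = L`. (For a continuous potential, weak solutions on `[0, L]`
are classical and extend uniquely to the line.) -/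
def dirichletSpectrum (L : ℝ) (p : ℝ → ℂ) : Set ℂ :=
  {μ | ∃ v : ℝ → Fin 2 → ℂ, IsZSSolution p μ v ∧ v ≠ 0 ∧
    v 0 0 + v 0 1 = 0 ∧ v L 0 + v L 1 = 0}

/-- `Y` is a matrix solution of the Zakharov-Shabat system with `Y(0) = I`. -/
def IsPrincipalSolution (p : ℝ → ℂ) (z : ℂ) (Y : ℝ → Matrix (Fin 2) (Fin 2) ℂ) : Prop :=
  Y 0 = 1 ∧ ∀ j : Fin 2, IsZSSolution p z (fun x i => Y x i j)

/-- The principal matrix solution `Y(x, z)`. -/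
def principalSolution (p : ℝ → ℂ) (z : ℂ) : ℝ → Matrix (Fin 2) (Fin 2) ℂ :=
  Classical.epsilon (IsPrincipalSolution p z)

/-- A linear differential equation with continuous coefficients has global solutions. -/
theorem exists_linear_ode {E : Type*} [NormedAddCommGroup E] [NormedSpace ℝ E] [CompleteSpace E]
    (A : ℝ → E →L[ℝ] E) (hA : Continuous A) (v0 : E) :
    ∃ v : ℝ → E, v 0 = v0 ∧ ∀ x, HasDerivAt v (A x (v x)) x := by
  let u : ℕ → ℝ → E := fun n => Nat.rec (fun _ => v0) (fun _ w x => ∫ s in (0 : ℝ)..x, A s (w s)) n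
  have hu0 : ∀ x, u 0 x = v0 := fun _ => rfl
  have huS : ∀ n x, u (n + 1) x = ∫ s in (0 : ℝ)..x, A s (u n s) := fun _ _ => rfl
  have hc : ∀ n, Continuous (u n) := by
    intro n
    induction n with
    | zero => exact continuous_const
    | succ n ih =>
      have h1 : Continuous fun s => A s (u n s) := hA.clm_apply ih
      have : u (n + 1) = fun x => ∫ s in (0 : ℝ)..x, A s (u n s) := rfl
      rw [this]
      exact intervalIntegral.continuous_primitive (fun a b => h1.intervalIntegrable a b) 0
  have hcA : ∀ n, Continuous fun s => A s (u n s) := fun n => hA.clm_apply (hc n)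
  have hd : ∀ n x, HasDerivAt (u (n + 1)) (A x (u n x)) x := fun n x =>
    intervalIntegral.integral_hasDerivAt_right ((hcA n).intervalIntegrable 0 x)
      ((hcA n).stronglyMeasurableAtFilter _ _) (hcA n).continuousAt
  have hb : ∀ r : ℝ, 0 ≤ r → ∃ K : ℝ, 0 ≤ K ∧ (∀ x ∈ Icc (-r) r, ‖A x‖ ≤ K) ∧
      ∀ n, ∀ x ∈ Icc (-r) r, ‖u n x‖ ≤ (K * |x|) ^ n / n.factorial * ‖v0‖ := by
    intro r hr
    obtain ⟨K, hK⟩ := (isCompact_Icc (a := -r) (b := r)).exists_bound_of_continuousOn hA.continuousOn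
    have hK0 : 0 ≤ K := (norm_nonneg _).trans (hK 0 ⟨by linarith, hr⟩)
    refine ⟨K, hK0, hK, fun n => ?_⟩
    induction n with
    | zero => intro x _; simp [hu0]
    | succ n ih =>
      intro x hx
      rw [huS]
      have key : ∀ s ∈ Icc (-r) r, ‖A s (u n s)‖ ≤ K * ((K * |s|) ^ n / n.factorial * ‖v0‖) :=
        fun s hs => ((A s).le_opNorm _).trans (by gcongr <;> [exact hK s hs; exact ih s hs])
      rcases le_total 0 x with h | h
      · have h2 : ‖∫ s in (0 : ℝ)..x, A s (u n s)‖ ≤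
            ∫ s in (0 : ℝ)..x, K ^ (n + 1) / n.factorial * ‖v0‖ * s ^ n := by
          refine intervalIntegral.norm_integral_le_of_norm_le h ?_ ?_
          · refine Eventually.of_forall fun s hs => ?_
            refine (key s ⟨by linarith [hs.1], hs.2.trans hx.2⟩).trans (le_of_eq ?_)
            rw [abs_of_pos hs.1]; ring
          · exact (by fun_prop : Continuous _).intervalIntegrable _ _
        refine h2.trans (le_of_eq ?_)
        rw [intervalIntegral.integral_const_mul, integral_pow, abs_of_nonneg h, Nat.factorial_succ]
        push_cast
        field_simp
        ring
      · have h2 : ‖∫ s in x..(0 : ℝ), A s (u n s)‖ ≤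
            ∫ s in x..(0 : ℝ), K ^ (n + 1) / n.factorial * ‖v0‖ * (-s) ^ n := by
          refine intervalIntegral.norm_integral_le_of_norm_le h ?_ ?_
          · refine Eventually.of_forall fun s hs => ?_
            refine (key s ⟨by linarith [hs.1, hx.1], by linarith [hs.2]⟩).trans (le_of_eq ?_)
            rw [abs_of_nonpos hs.2]; ring
          · exact (by fun_prop : Continuous _).intervalIntegrable _ _
        rw [intervalIntegral.integral_symm, norm_neg]
        refine h2.trans (le_of_eq ?_)
        rw [intervalIntegral.integral_const_mul,
          intervalIntegral.integral_comp_neg (fun s => s ^ n), integral_pow, abs_of_nonpos h,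
          Nat.factorial_succ]
        push_cast
        simp only [neg_zero]
        field_simp
        ring
  refine ⟨fun x => ∑' n, u n x, ?_, fun x => ?_⟩
  · have : ∀ n, n ≠ 0 → u n 0 = 0 := by
      intro n hn
      obtain ⟨m, rfl⟩ := Nat.exists_eq_succ_of_ne_zero hn
      simp [huS]
    simp only
    rw [tsum_eq_single 0 this]
    exact hu0 0
  · set r := |x| + 1
    have hr : 0 ≤ r := by positivity
    obtain ⟨K, hK0, hK, hbd⟩ := hb r hr
    have hx : x ∈ Ioo (-r) r := by
      constructor
      · linarith [neg_abs_le x]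
      · linarith [le_abs_self x]
    have hbd' : ∀ n, ∀ y ∈ Icc (-r) r, ‖u n y‖ ≤ (K * r) ^ n / n.factorial * ‖v0‖ := by
      intro n y hy
      refine (hbd n y hy).trans ?_
      have : |y| ≤ r := abs_le.2 hy
      gcongr
    have hs : Summable fun n : ℕ => (K * r) ^ n / n.factorial * ‖v0‖ :=
      (Real.summable_pow_div_factorial _).mul_right _
    have hsu : ∀ y ∈ Icc (-r) r, Summable fun n => u n y := fun y hy =>
      hs.of_norm_bounded (fun n => hbd' n y hy)
    have hmain : HasDerivAt (fun y => ∑' n, u (n + 1) y) (∑' n, A x (u n x)) x := by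
      refine hasDerivAt_tsum_of_isPreconnected (u := fun n : ℕ => K * ((K * r) ^ n / n.factorial * ‖v0‖))
        (t := Ioo (-r) r) (y₀ := x) (hs.mul_left K) isOpen_Ioo isPreconnected_Ioo
        (fun n y _ => hd n y) ?_ hx ?_ hx
      · intro n y hy
        have hy' := Ioo_subset_Icc_self hy
        exact ((A y).le_opNorm _).trans (by gcongr <;> [exact hK y hy'; exact hbd' n y hy'])
      · exact (summable_nat_add_iff 1).2 (hsu x (Ioo_subset_Icc_self hx))
    rw [← (A x).map_tsum (hsu x (Ioo_subset_Icc_self hx))] at hmain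
    refine (hmain.const_add v0).congr_of_eventuallyEq ?_
    filter_upwards [isOpen_Ioo.mem_nhds hx] with y hy
    rw [(hsu y (Ioo_subset_Icc_self hy)).tsum_eq_zero_add, hu0]

/-- The principal matrix solution exists, so that its choice above is not arbitrary. -/
theorem principalSolution_spec (p : ℝ → ℂ) (hp : Continuous p) (z : ℂ) :
    IsPrincipalSolution p z (principalSolution p z) := by
  have hM : Continuous (zsMatrix p z) := by
    refine continuous_matrix fun i j => ?_
    fin_cases i <;> fin_cases j <;> simp [zsMatrix, pauli3, potMatrix] <;> fun_prop
  let T : Matrix (Fin 2) (Fin 2) ℂ →ₗ[ℂ] ((Fin 2 → ℂ) →L[ℂ] (Fin 2 → ℂ)) :=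
    LinearMap.toContinuousLinearMap.toLinearMap ∘ₗ Matrix.toLin'.toLinearMap
  have hT : Continuous T := T.continuous_of_finiteDimensional
  let A : ℝ → ((Fin 2 → ℂ) →L[ℝ] (Fin 2 → ℂ)) := fun x =>
    ContinuousLinearMap.restrictScalarsL ℂ (Fin 2 → ℂ) (Fin 2 → ℂ) ℝ ℝ (T (zsMatrix p z x))
  have hA : Continuous A := (ContinuousLinearMap.continuous _).comp (hT.comp hM)
  have h : ∀ j : Fin 2, ∃ v : ℝ → Fin 2 → ℂ, v 0 = Pi.single j 1 ∧ IsZSSolution p z v := by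
    intro j
    obtain ⟨v, hv0, hv⟩ := exists_linear_ode A hA (Pi.single j 1)
    exact ⟨v, hv0, fun x => hv x⟩
  choose v hv0 hv using h
  refine Classical.epsilon_spec (p := IsPrincipalSolution p z) ⟨fun x i j => v j x i, ?_, hv⟩
  ext i j
  change v j 0 i = (1 : Matrix (Fin 2) (Fin 2) ℂ) i j
  rw [hv0 j, Matrix.one_apply, Pi.single_apply]

/-- The modified monodromy matrix `Ỹ(L, z) = U Y(L, z) U⁻¹`. -/
def modMonodromy (L : ℝ) (p : ℝ → ℂ) (z : ℂ) : Matrix (Fin 2) (Fin 2) ℂ :=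
  simMatrix * principalSolution p z L * simMatrix⁻¹

/-- The Floquet discriminant `Δ(z) = tr Y(L, z) / 2`. -/
def discriminant (L : ℝ) (p : ℝ → ℂ) (z : ℂ) : ℂ :=
  (principalSolution p z L).trace / 2

/-- The Floquet multiplier `ρ(z)`, for `z` off the Lax spectrum: the root of
`ρ² - 2 Δ(z) ρ + 1 = 0` with `|ρ| < 1`. -/
def floquetMultiplier (L : ℝ) (p : ℝ → ℂ) (z : ℂ) : ℂ :=
  Classical.epsilon fun r : ℂ => r ^ 2 - 2 * discriminant L p z * r + 1 = 0 ∧ ‖r‖ < 1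

/-- `v` is the normalized Bloch-Floquet solution `ψ^ε(·, z)` of the modified system, `ε = ±1`:
`ψ(x + L) = ρ(z)^ε ψ(x)` and `ψ₁(0) = 1`. -/
def IsBlochFloquet (L : ℝ) (p : ℝ → ℂ) (ε : ℤˣ) (z : ℂ) (v : ℝ → Fin 2 → ℂ) : Prop :=
  IsModZSSolution p z v ∧
    (∀ x, v (x + L) = (floquetMultiplier L p z) ^ (ε : ℤ) • v x) ∧ v 0 0 = 1

/-- The normalized Bloch-Floquet solution `ψ^ε(x, z)`, `ε = ±1`. -/
def blochFloquet (L : ℝ) (p : ℝ → ℂ) (ε : ℤˣ) (z : ℂ) : ℝ → Fin 2 → ℂ :=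
  Classical.epsilon (IsBlochFloquet L p ε z)

/-- The sign `σ = -sgn log |Ỹ₂₂(L, μ)|` attached to a Dirichlet eigenvalue `μ`. -/
def dirichletSign (L : ℝ) (p : ℝ → ℂ) (μ : ℂ) : ℤ :=
  -(SignType.sign (Real.log ‖modMonodromy L p μ 1 1‖) : ℤ)

/-! ### Spectral gaps

Here `B` stands for the Lax spectrum. -/

/-- `(a, b)` is a non-degenerate spectral gap: a bounded component of the complement of the
spectrum in the real line. -/
def IsGap (B : Set ℂ) (a b : ℝ) : Prop :=
  a < b ∧ (a : ℂ) ∈ B ∧ (b : ℂ) ∈ B ∧ ∀ x ∈ Ioo a b, (x : ℂ) ∉ B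

/-- The maximal length `R` of the gaps (zero if there are none). -/
def maxGapLength (B : Set ℂ) : ℝ :=
  sSup {r : ℝ | ∃ a b : ℝ, IsGap B a b ∧ r = b - a}

/-- The union of the closed discs of radius `R` about the midpoints of the gaps. -/
def gapDiscs (B : Set ℂ) : Set ℂ :=
  {z | ∃ a b : ℝ, IsGap B a b ∧ ‖z - (((a + b) / 2 : ℝ) : ℂ)‖ ≤ maxGapLength B}

/-- The movable Dirichlet eigenvalues (those in the closed non-degenerate gaps) with sign `s`. -/
def movableDirichlet (L : ℝ) (p : ℝ → ℂ) (s : ℤ) : Set ℂ :=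
  {μ | μ ∈ dirichletSpectrum L p ∧ dirichletSign L p μ = s ∧
    ∃ a b : ℝ, IsGap (laxSpectrum p) a b ∧ ∃ x ∈ Icc a b, μ = (x : ℂ)}

/-! ### Time dependence -/

/-- `q(x, t)` is a classical solution, `L`-periodic in `x`, of the defocusing nonlinear
Schrödinger equation `i q_t + q_xx - 2 |q|² q = 0` for `x` real and `t` in the time interval `S`:
it is of class `C²` in `x` and `C¹` in `t`, with `q`, `q_x`, `q_xx` (hence `q_t`) jointly
continuous. -/
structure IsPeriodicNLSSolution (L : ℝ) (S : Set ℝ) (q : ℝ → ℝ → ℂ) : Prop where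
  periodic : ∀ t ∈ S, ∀ x, q (x + L) t = q x t
  contDiff : ∀ t ∈ S, ContDiff ℝ 2 (fun x => q x t)
  continuous : ContinuousOn (fun y : ℝ × ℝ => q y.1 y.2) (univ ×ˢ S)
  continuous_dx : ContinuousOn (fun y : ℝ × ℝ => deriv (fun x => q x y.2) y.1) (univ ×ˢ S)
  continuous_dxx :
    ContinuousOn (fun y : ℝ × ℝ => deriv (deriv (fun x => q x y.2)) y.1) (univ ×ˢ S)
  equation : ∀ x, ∀ t ∈ S, ∃ qt : ℂ, HasDerivWithinAt (fun τ => q x τ) qt S t ∧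
    Complex.I * qt + deriv (deriv (fun y => q y t)) x - 2 * (‖q x t‖ : ℂ) ^ 2 * q x t = 0

/-- The potential at time `t`. -/
def slice (q : ℝ → ℝ → ℂ) (t : ℝ) : ℝ → ℂ := fun x => q x t

/-- The Lax spectrum of the initial potential (it does not change in time). -/
def spec (q : ℝ → ℝ → ℂ) : Set ℂ := laxSpectrum (slice q 0)

/-- The matrix `-2 i z² σ₃ + 2 z Q - i σ₃ (Q² - Q_x)` of the time evolution in the Lax pair. -/
def timeMatrix (q : ℝ → ℝ → ℂ) (z : ℂ) (x t : ℝ) : Matrix (Fin 2) (Fin 2) ℂ :=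
  (-(2 * Complex.I * z ^ 2)) • pauli3 + (2 * z) • potMatrix (q x t) -
    Complex.I • (pauli3 * (potMatrix (q x t) * potMatrix (q x t) -
      potMatrix (deriv (fun y => q y t) x)))

/-- The rate `α^ε(t, z)`: the first component at `x = 0` of the modified time evolution matrix
applied to `ψ^ε(·, t, z)`. -/
def alpha (L : ℝ) (q : ℝ → ℝ → ℂ) (ε : ℤˣ) (t : ℝ) (z : ℂ) : ℂ :=
  (simMatrix * timeMatrix q z 0 t * simMatrix⁻¹).mulVec
    (blochFloquet L (slice q t) ε z 0) 0

/-- The time factor `exp ∫₀ᵗ α^ε(τ, z) dτ`. -/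
def timeFactor (L : ℝ) (q : ℝ → ℝ → ℂ) (ε : ℤˣ) (t : ℝ) (z : ℂ) : ℂ :=
  Complex.exp (∫ τ in (0 : ℝ)..t, alpha L q ε τ z)

/-- The integer `1` if `z` is a movable Dirichlet eigenvalue with sign `s` of the potential at
time `t`, and `0` otherwise. -/
def movableInd (L : ℝ) (q : ℝ → ℝ → ℂ) (t : ℝ) (s : ℤ) (z : ℂ) : ℤ :=
  (movableDirichlet L (slice q t) s).indicator 1 z

/-- `ℓ` is the boundary value of `f` at `z` from the upper half plane. -/
def HasUpperValue (f : ℂ → ℂ) (z ℓ : ℂ) : Prop :=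
  Tendsto f (𝓝[{w | 0 < w.im}] z) (𝓝 ℓ)

/-- `ℓ` is the boundary value of `f` at `z` from the lower half plane. -/
def HasLowerValue (f : ℂ → ℂ) (z ℓ : ℂ) : Prop :=
  Tendsto f (𝓝[{w | w.im < 0}] z) (𝓝 ℓ)

/-- Near `E` and off `B`, `f = s ^ n * h(s)` with `s = √(d (z - E))` (principal branch), where
`h` is holomorphic near `0` and `h(0) ≠ 0`. For `n = -1` this is a square root singularity, for
`n = 1` a square root zero. -/
def HasSqrtOrder (f : ℂ → ℂ) (B : Set ℂ) (E d : ℂ) (n : ℤ) : Prop :=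
  ∃ h : ℂ → ℂ, AnalyticAt ℂ h 0 ∧ h 0 ≠ 0 ∧
    ∀ᶠ z in 𝓝[Bᶜ] E,
      f z = ((d * (z - E)) ^ (1 / 2 : ℂ)) ^ n * h ((d * (z - E)) ^ (1 / 2 : ℂ))

end DefocusingNLS

end

open DefocusingNLS

/-! The time factor is a first component of a transported eigenvector, so the exponential of an
integral becomes an algebraic expression in functions that are analytic in `z`.

Let `M(τ, z)` be the modified monodromy matrix and `V(τ, z)` the modified time evolution matrix at
`x = 0`. The zero curvature equation gives `dM/dτ = V M - M V`. If `T` solves `T' = V T`, `T(0) =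
1`, then `M(τ) T(τ) = T(τ) M(0)`; in particular the discriminant, the spectrum and the multiplier
`ρ` do not move. The vector `c = (1, (ρ^ε - M₀₀) / M₀₁)` at time `0` is an eigenvector of `M(0)`,
hence `T(τ) c` is an eigenvector of `M(τ)` and therefore a multiple of `ψ^ε(0, τ, z)`. Its first
component `u` satisfies `u' = α u`, `u(0) = 1`, which yields `e^ε = T₀₀ + T₀₁ (ρ^ε - M₀₀) / M₀₁`
(`timeFactor_eq`). Here `T` and `M` are entire in `z` and `ρ` is analytic off the spectrum, so the
right side is the meromorphic extension.

Zeros and poles. The Dirichlet eigenvalues are the zeros of `M₀₁`, and they are simple. After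
removal of a common power of the local parameter, `(M₀₁, ρ^ε - M₀₀)` is a nonvanishing analytic
eigenvector, both at time `0` and at time `t`. The invertible `T` maps one to a nonvanishing
multiple of the other, so the order of `e^ε` is the order of the first component at time `t` minus
that at time `0` (`BlochFrame.exists_order`). At an endpoint `E` of a gap the same argument runs in
the parameter `s` with `z = E ± s²`: there `ρ` is analytic in `s` with nonzero derivative, and `s ↦
-s` exchanges `ρ` and `1/ρ` (`exists_endpoint_multiplier`). At interior points of the spectrum `ρ`
from above continues analytically to `1/ρ` from below (`exists_interior_multiplier`), and possible
poles there are removable; this gives the boundary values.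

Asymptotics. Let `χ = v₁ / v₂` for a Floquet solution. The form `|v₁|² - |v₂|²` is monotone in `x`
off the real line, so `|χ| ≤ 1` in the half plane `ε Im z > 0`. The function `χ` is a periodic
solution of a Riccati equation, and away from the lattice `(π/L) ℤ` the periodic Green's function is
bounded, whence `χ = q / (2iz) + O(1/z²)`. Inserted into the time evolution of `v₂`, this cancels
the terms of order one and leaves the rate `2iz² + O(1/z)` (`exists_preFactor_asymptotics`). The
other half plane follows by complex conjugation. Near a lattice point, distant gaps are so close to
the point that it is covered by a gap disc; if there is no gap, the two half plane functions glue to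
an analytic function and the maximum principle carries the estimate inward from an annulus
(`exists_local_asymptotics`). The growth bound combines the asymptotics with local boundedness on a
large disc. -/

noncomputable section

namespace DefocusingNLS

section

/-! ### Linear systems in a normed algebra -/

section Algebra

variable {𝔸 : Type*} [NormedRing 𝔸] [NormedAlgebra ℝ 𝔸]

/-- `Y` is the fundamental solution, normalized at `0`, of the linear system `Y' = A Y`, and `Z` is
its inverse. -/
structure IsFundPair (A Y Z : ℝ → 𝔸) : Prop where
  zero : Y 0 = 1
  deriv : ∀ x, HasDerivAt Y (A x * Y x) x
  deriv_inv : ∀ x, HasDerivAt Z (-(Z x * A x)) x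
  mul_inv : ∀ x, Y x * Z x = 1

namespace IsFundPair

variable {A Y Z A' Y' Z' : ℝ → 𝔸}

theorem zero_inv (h : IsFundPair A Y Z) : Z 0 = 1 := by
  simpa [h.zero] using h.mul_inv 0

theorem continuous (h : IsFundPair A Y Z) : Continuous Y :=
  continuous_iff_continuousAt.2 fun x => (h.deriv x).continuousAt

theorem continuous_inv (h : IsFundPair A Y Z) : Continuous Z :=
  continuous_iff_continuousAt.2 fun x => (h.deriv_inv x).continuousAt

/-- Reflection in `x` transfers results proved on `[0, l]` to negative arguments. -/
theorem neg (h : IsFundPair A Y Z) :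
    IsFundPair (fun x => -A (-x)) (fun x => Y (-x)) (fun x => Z (-x)) := by
  refine ⟨by simp [h.zero], fun x => ?_, fun x => ?_, fun x => h.mul_inv _⟩
  · have := HasDerivAt.scomp x (h.deriv (-x)) (hasDerivAt_neg x)
    exact this.congr_deriv (by simp)
  · have := HasDerivAt.scomp x (h.deriv_inv (-x)) (hasDerivAt_neg x)
    exact this.congr_deriv (by simp)

/-- Gronwall's inequality; the factor `‖1‖` appears because the norm of the unit is not assumed to
be one. -/
theorem norm_le (h : IsFundPair A Y Z) {l K : ℝ}
    (hK : ∀ x ∈ Icc 0 l, ‖A x‖ ≤ K) : ∀ x ∈ Icc 0 l, ‖Y x‖ ≤ ‖(1 : 𝔸)‖ * Real.exp (K * x) := by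
  intro x hx
  have := norm_le_gronwallBound_of_norm_deriv_right_le (f := Y) (f' := fun x => A x * Y x)
    (δ := ‖(1 : 𝔸)‖) (K := K) (ε := 0) (a := 0) (b := l) h.continuous.continuousOn
    (fun x _ => (h.deriv x).hasDerivWithinAt) (by rw [h.zero])
    (fun x hx => by
      rw [add_zero]
      exact (norm_mul_le _ _).trans
        (mul_le_mul_of_nonneg_right (hK x (Ico_subset_Icc_self hx)) (norm_nonneg _))) x hx
  simpa [gronwallBound_ε0] using this

theorem norm_inv_le (h : IsFundPair A Y Z) {l K : ℝ}
    (hK : ∀ x ∈ Icc 0 l, ‖A x‖ ≤ K) : ∀ x ∈ Icc 0 l, ‖Z x‖ ≤ ‖(1 : 𝔸)‖ * Real.exp (K * x) := by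
  intro x hx
  have := norm_le_gronwallBound_of_norm_deriv_right_le (f := Z) (f' := fun x => -(Z x * A x))
    (δ := ‖(1 : 𝔸)‖) (K := K) (ε := 0) (a := 0) (b := l) h.continuous_inv.continuousOn
    (fun x _ => (h.deriv_inv x).hasDerivWithinAt) (by rw [h.zero_inv])
    (fun x hx => by
      rw [add_zero, norm_neg, mul_comm K]
      exact (norm_mul_le _ _).trans
        (mul_le_mul_of_nonneg_left (hK x (Ico_subset_Icc_self hx)) (norm_nonneg _))) x hx
  simpa [gronwallBound_ε0] using this

variable [CompleteSpace 𝔸]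

/-- Duhamel's formula for the difference of two fundamental solutions. -/
theorem duhamel (h : IsFundPair A Y Z) (h' : IsFundPair A' Y' Z')
    (hc : Continuous A) (hc' : Continuous A') (x : ℝ) :
    Y' x - Y x = Y x * ∫ s in (0 : ℝ)..x, Z s * (A' s - A s) * Y' s := by
  have hd : ∀ s, HasDerivAt (fun s => Z s * Y' s) (Z s * (A' s - A s) * Y' s) s := fun s =>
    ((h.deriv_inv s).mul (h'.deriv s)).congr_deriv (by noncomm_ring)
  have hcont : Continuous fun s => Z s * (A' s - A s) * Y' s :=
    (h.continuous_inv.mul (hc'.sub hc)).mul h'.continuous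
  rw [intervalIntegral.integral_eq_sub_of_hasDerivAt (fun s _ => hd s)
    (hcont.intervalIntegrable _ _), h.zero_inv, h'.zero, mul_sub, ← mul_assoc, h.mul_inv]
  simp

/-- In Duhamel's formula the difference of the coefficients stands between `Z` and `Y'`, with `Y` in
front. Gronwall bounds each of these three factors by the same exponential, whence the cube. -/
theorem norm_sub_le (h : IsFundPair A Y Z) (h' : IsFundPair A' Y' Z')
    (hc : Continuous A) (hc' : Continuous A') {l K δ : ℝ}
    (hK : ∀ x ∈ Icc 0 l, ‖A x‖ ≤ K) (hK' : ∀ x ∈ Icc 0 l, ‖A' x‖ ≤ K)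
    (hδ : ∀ x ∈ Icc 0 l, ‖A' x - A x‖ ≤ δ) :
    ∀ x ∈ Icc 0 l, ‖Y' x - Y x‖ ≤ l * (‖(1 : 𝔸)‖ * Real.exp (K * l)) ^ 3 * δ := by
  intro x hx
  have hl : 0 ≤ l := hx.1.trans hx.2
  have hK0 : 0 ≤ K := (norm_nonneg _).trans (hK x hx)
  have hδ0 : 0 ≤ δ := (norm_nonneg _).trans (hδ x hx)
  set E := ‖(1 : 𝔸)‖ * Real.exp (K * l) with hE
  have hE0 : 0 ≤ E := by positivity
  have hexp : ∀ s ∈ Icc 0 l, ‖(1 : 𝔸)‖ * Real.exp (K * s) ≤ E := fun s hs =>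
    mul_le_mul_of_nonneg_left (Real.exp_le_exp.2 (mul_le_mul_of_nonneg_left hs.2 hK0))
      (norm_nonneg _)
  have hY : ∀ s ∈ Icc 0 l, ‖Y s‖ ≤ E := fun s hs => (h.norm_le hK s hs).trans (hexp s hs)
  have hZ : ∀ s ∈ Icc 0 l, ‖Z s‖ ≤ E := fun s hs => (h.norm_inv_le hK s hs).trans (hexp s hs)
  have hY' : ∀ s ∈ Icc 0 l, ‖Y' s‖ ≤ E := fun s hs => (h'.norm_le hK' s hs).trans (hexp s hs)
  rw [h.duhamel h' hc hc']
  have hI : ‖∫ s in (0 : ℝ)..x, Z s * (A' s - A s) * Y' s‖ ≤ (E * δ * E) * |x - 0| := by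
    refine intervalIntegral.norm_integral_le_of_norm_le_const fun s hs => ?_
    rw [uIoc_of_le hx.1] at hs
    have hs' : s ∈ Icc 0 l := ⟨hs.1.le, hs.2.trans hx.2⟩
    refine (norm_mul_le _ _).trans ?_
    refine mul_le_mul ((norm_mul_le _ _).trans ?_) (hY' s hs') (norm_nonneg _) (by positivity)
    exact mul_le_mul (hZ s hs') (hδ s hs') (norm_nonneg _) (by positivity)
  refine (norm_mul_le _ _).trans ?_
  refine (mul_le_mul (hY x hx) hI (norm_nonneg _) (by positivity)).trans ?_
  rw [sub_zero, abs_of_nonneg hx.1]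
  have : E * (E * δ * E * x) = x * E ^ 3 * δ := by ring
  rw [this]
  gcongr
  exact hx.2

/-- Differentiation of a fundamental solution with respect to a parameter, along a filter. -/
theorem tendsto_quotient {𝕜 : Type*} [RCLike 𝕜] [NormedAlgebra 𝕜 𝔸] [SMulCommClass ℝ 𝕜 𝔸]
    {ι : Type*} {F : Filter ι} [F.IsCountablyGenerated]
    {B W W' : ι → ℝ → 𝔸} (h : IsFundPair A Y Z) (hB : ∀ᶠ i in F, IsFundPair (B i) (W i) (W' i))
    (hc : Continuous A) (hcB : ∀ᶠ i in F, Continuous (B i))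
    {l C : ℝ} (hl : 0 ≤ l) {d : ι → 𝕜} (hd : Tendsto d F (𝓝 0)) (hd0 : ∀ᶠ i in F, d i ≠ 0)
    (hbd : ∀ᶠ i in F, ∀ x ∈ Icc 0 l, ‖B i x - A x‖ ≤ C * ‖d i‖) {D : ℝ → 𝔸}
    (hlim : ∀ x ∈ Icc 0 l, Tendsto (fun i => (d i)⁻¹ • (B i x - A x)) F (𝓝 (D x))) :
    Tendsto (fun i => (d i)⁻¹ • (W i l - Y l)) F
      (𝓝 (Y l * ∫ s in (0 : ℝ)..l, Z s * D s * Y s)) := by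
  obtain ⟨K, hK⟩ := (isCompact_Icc (a := 0) (b := l)).exists_bound_of_continuousOn hc.continuousOn
  have hK1 : ∀ x ∈ Icc 0 l, ‖A x‖ ≤ K + |C| := fun x hx =>
    (hK x hx).trans (le_add_of_nonneg_right (abs_nonneg _))
  have hd1 : ∀ᶠ i in F, ‖d i‖ ≤ 1 := by
    filter_upwards [(tendsto_zero_iff_norm_tendsto_zero.1 hd).eventually
      (gt_mem_nhds (show (0 : ℝ) < 1 by norm_num))] with i hi using hi.le
  have hK2 : ∀ᶠ i in F, ∀ x ∈ Icc 0 l, ‖B i x‖ ≤ K + |C| := by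
    filter_upwards [hd1, hbd] with i hi hi2 x hx
    calc ‖B i x‖ = ‖A x + (B i x - A x)‖ := by rw [add_sub_cancel]
      _ ≤ ‖A x‖ + ‖B i x - A x‖ := norm_add_le _ _
      _ ≤ K + |C| * 1 := by
        gcongr
        · exact hK x hx
        · exact (hi2 x hx).trans (mul_le_mul (le_abs_self _) hi (norm_nonneg _) (abs_nonneg _))
      _ = _ := by rw [mul_one]
  set E := ‖(1 : 𝔸)‖ * Real.exp ((K + |C|) * l) with hE
  have hE0 : 0 ≤ E := by positivity
  have hexp : ∀ s ∈ Icc 0 l, ‖(1 : 𝔸)‖ * Real.exp ((K + |C|) * s) ≤ E := fun s hs => by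
    have h0 : 0 ≤ K + |C| := (norm_nonneg _).trans (hK1 s hs)
    exact mul_le_mul_of_nonneg_left (Real.exp_le_exp.2 (mul_le_mul_of_nonneg_left hs.2 h0))
      (norm_nonneg _)
  have hsub : ∀ᶠ i in F, ∀ x ∈ Icc 0 l, ‖W i x - Y x‖ ≤ l * E ^ 3 * (C * ‖d i‖) := by
    filter_upwards [hK2, hbd, hB, hcB] with i h1 h2 h3 h4
    exact h.norm_sub_le h3 hc h4 hK1 h1 h2
  have hW : ∀ x ∈ Icc 0 l, Tendsto (fun i => W i x) F (𝓝 (Y x)) := by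
    intro x hx
    rw [tendsto_iff_norm_sub_tendsto_zero]
    have : Tendsto (fun i => l * E ^ 3 * (C * ‖d i‖)) F (𝓝 0) := by
      simpa using ((tendsto_zero_iff_norm_tendsto_zero.1 hd).const_mul C).const_mul (l * E ^ 3)
    exact squeeze_zero' (Eventually.of_forall fun _ => norm_nonneg _)
      (by filter_upwards [hsub] with i hi using hi x hx) this
  -- The difference quotient of Duhamel's formula converges by dominated convergence: `hbd` bounds
  -- the quotients of the coefficients by `|C|`, and the fundamental solutions are bounded by `E`
  -- uniformly in `i`.
  have hI : Tendsto (fun i => ∫ s in (0 : ℝ)..l, Z s * ((d i)⁻¹ • (B i s - A s)) * W i s) F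
      (𝓝 (∫ s in (0 : ℝ)..l, Z s * D s * Y s)) := by
    refine intervalIntegral.tendsto_integral_filter_of_dominated_convergence
      (fun _ => E * |C| * E) ?_ ?_ (by simp) ?_
    · filter_upwards [hB, hcB] with i hi hi2
      refine Continuous.aestronglyMeasurable ?_
      exact (h.continuous_inv.mul ((hi2.sub hc).const_smul _)).mul hi.continuous
    · filter_upwards [hB, hK2, hbd, hd0] with i hi hi2 hi3 hi4
      refine Eventually.of_forall fun s hs => ?_
      rw [uIoc_of_le hl] at hs
      have hs' : s ∈ Icc 0 l := ⟨hs.1.le, hs.2⟩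
      refine (norm_mul_le _ _).trans ?_
      refine mul_le_mul ((norm_mul_le _ _).trans ?_)
        ((hi.norm_le hi2 s hs').trans (hexp s hs')) (norm_nonneg _) (by positivity)
      refine mul_le_mul ((h.norm_inv_le hK1 s hs').trans (hexp s hs')) ?_ (norm_nonneg _) hE0
      have hp : 0 < ‖d i‖ := norm_pos_iff.2 hi4
      rw [norm_smul, norm_inv, inv_mul_le_iff₀ hp, mul_comm]
      exact (hi3 s hs').trans (mul_le_mul_of_nonneg_right (le_abs_self _) hp.le)
    · refine Eventually.of_forall fun s hs => ?_
      rw [uIoc_of_le hl] at hs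
      have hs' : s ∈ Icc 0 l := ⟨hs.1.le, hs.2⟩
      exact (tendsto_const_nhds.mul (hlim s hs')).mul (hW s hs')
  refine (tendsto_const_nhds.mul hI).congr' ?_
  filter_upwards [hB, hcB] with i hi hi2
  rw [h.duhamel hi hc hi2, ← mul_smul_comm, ← intervalIntegral.integral_smul]
  simp_rw [mul_smul_comm, smul_mul_assoc]

end IsFundPair

end Algebra

open scoped Matrix.Norms.Operator

/-! ### Traceless linear systems of size two -/

/-- Complex `2 × 2` matrices. -/
abbrev M2 := Matrix (Fin 2) (Fin 2) ℂ

theorem hasDerivAt_matrix {f : ℝ → M2} {f' : M2} {x : ℝ} :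
    HasDerivAt f f' x ↔ ∀ i j, HasDerivAt (fun y => f y i j) (f' i j) x :=
  ⟨fun h i j => hasDerivAt_pi.1 (hasDerivAt_pi.1 h i) j,
    fun h => hasDerivAt_pi.2 fun i => hasDerivAt_pi.2 fun j => h i j⟩

/-- For `2 × 2` matrices the adjugate is linear and reverses products, and the adjugate of a
traceless `A` is `-A`. So the adjugate of `Y` solves the equation of the inverse matrix, before
anything is known about the determinant. -/
theorem hasDerivAt_adjugate {A Y : ℝ → M2} (h : ∀ x, HasDerivAt Y (A x * Y x) x)
    (hA : ∀ x, (A x).trace = 0) (x : ℝ) :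
    HasDerivAt (fun x => (Y x).adjugate) (-((Y x).adjugate * A x)) x := by
  have h1 : A x 1 1 = - A x 0 0 := by
    have := hA x
    rw [Matrix.trace_fin_two] at this
    linear_combination this
  have hd := hasDerivAt_matrix.1 (h x)
  have h00 := hd 0 0
  have h01 := hd 0 1
  have h10 := hd 1 0
  have h11 := hd 1 1
  simp only [Matrix.mul_apply, Fin.sum_univ_two] at h00 h01 h10 h11
  refine hasDerivAt_matrix.2 fun i j => ?_
  simp only [Matrix.neg_apply, Matrix.mul_apply, Fin.sum_univ_two, Matrix.adjugate_fin_two]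
  fin_cases i <;> fin_cases j
  · exact h11.congr_deriv (by simp [h1]; ring)
  · exact h01.neg.congr_deriv (by simp [h1]; ring)
  · exact h10.neg.congr_deriv (by simp [h1]; ring)
  · exact h00.congr_deriv (by simp [h1]; ring)

theorem eq_of_hasDerivAt_zero {E : Type*} [NormedAddCommGroup E] [NormedSpace ℝ E] {f : ℝ → E}
    (h : ∀ x, HasDerivAt f 0 x) (x y : ℝ) : f x = f y :=
  is_const_of_deriv_eq_zero (fun x => (h x).differentiableAt) (fun x => (h x).deriv) x y

/-- A Wronskian identity. With `W = Y` it gives invertibility and determinant one, with general `W`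
uniqueness of solutions. -/
theorem adjugate_mul_const {A Y W : ℝ → M2} (h : ∀ x, HasDerivAt Y (A x * Y x) x)
    (hW : ∀ x, HasDerivAt W (A x * W x) x)
    (hA : ∀ x, (A x).trace = 0) (x : ℝ) : (Y x).adjugate * W x = (Y 0).adjugate * W 0 :=
  eq_of_hasDerivAt_zero (f := fun x => (Y x).adjugate * W x) (fun x =>
    ((hasDerivAt_adjugate h hA x).mul (hW x)).congr_deriv (by noncomm_ring)) x 0

/-- `Y` is the fundamental matrix, normalized at `0`, of the system with coefficients `A`. -/
structure IsFund (A Y : ℝ → M2) : Prop where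
  traceless : ∀ x, (A x).trace = 0
  zero : Y 0 = 1
  deriv : ∀ x, HasDerivAt Y (A x * Y x) x

namespace IsFund

variable {A Y W : ℝ → M2}

theorem adjugate_mul (h : IsFund A Y) (x : ℝ) : (Y x).adjugate * Y x = 1 := by
  rw [adjugate_mul_const h.deriv h.deriv h.traceless, h.zero]; simp

theorem mul_adjugate (h : IsFund A Y) (x : ℝ) : Y x * (Y x).adjugate = 1 :=
  mul_eq_one_comm.1 (h.adjugate_mul x)

theorem pair (h : IsFund A Y) : IsFundPair A Y (fun x => (Y x).adjugate) :=
  ⟨h.zero, h.deriv, hasDerivAt_adjugate h.deriv h.traceless, h.mul_adjugate⟩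

theorem continuous (h : IsFund A Y) : Continuous Y := h.pair.continuous

theorem det (h : IsFund A Y) (x : ℝ) : (Y x).det = 1 := by
  have := h.adjugate_mul x
  rw [Matrix.adjugate_mul] at this
  simpa using congrFun (congrFun this 0) 0

theorem eq_mul (h : IsFund A Y) (hW : ∀ x, HasDerivAt W (A x * W x) x) (x : ℝ) :
    W x = Y x * W 0 := by
  have h1 := adjugate_mul_const h.deriv hW h.traceless x
  rw [h.zero, Matrix.adjugate_one, one_mul] at h1
  rw [← h1, ← mul_assoc, h.mul_adjugate, one_mul]

theorem unique (h : IsFund A Y) (hW : IsFund A W) : W = Y := by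
  funext x
  rw [h.eq_mul hW.deriv, hW.zero, mul_one]

theorem hasDerivAt_mulVec_iff {v : ℝ → Fin 2 → ℂ} {B : M2} {x : ℝ} :
    HasDerivAt v (B.mulVec (v x)) x ↔
      HasDerivAt (fun y => (Matrix.of fun i _ => v y i : M2))
        (B * (Matrix.of fun i _ => v x i : M2)) x := by
  rw [hasDerivAt_matrix, hasDerivAt_pi]
  simp [Matrix.mulVec, dotProduct, Matrix.mul_apply]

theorem eq_mulVec (h : IsFund A Y) {v : ℝ → Fin 2 → ℂ}
    (hv : ∀ x, HasDerivAt v ((A x).mulVec (v x)) x) (x : ℝ) : v x = (Y x).mulVec (v 0) := by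
  have := h.eq_mul (fun x => hasDerivAt_mulVec_iff.1 (hv x)) x
  ext i
  have := congrFun (congrFun this i) 0
  simpa [Matrix.mulVec, dotProduct, Matrix.mul_apply] using this

theorem hasDerivAt_mulVec (h : IsFund A Y) (c : Fin 2 → ℂ) (x : ℝ) :
    HasDerivAt (fun x => (Y x).mulVec c) ((A x).mulVec ((Y x).mulVec c)) x := by
  rw [Matrix.mulVec_mulVec, hasDerivAt_pi]
  intro i
  have := hasDerivAt_matrix.1 (h.deriv x)
  simp only [Matrix.mulVec, dotProduct, Fin.sum_univ_two]
  exact ((this i 0).mul_const _).add ((this i 1).mul_const _)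

theorem neg (h : IsFund A Y) : IsFund (fun x => -A (-x)) (fun x => Y (-x)) :=
  ⟨fun x => by simp [h.traceless], h.pair.neg.zero, h.pair.neg.deriv⟩

theorem exists_of_continuous (hA : Continuous A) (htr : ∀ x, (A x).trace = 0) : ∃ Y, IsFund A Y := by
  obtain ⟨Y, h0, h⟩ := exists_linear_ode (fun x => ContinuousLinearMap.mul ℝ M2 (A x))
    ((ContinuousLinearMap.mul ℝ M2).continuous.comp hA) 1
  exact ⟨Y, htr, h0, h⟩

end IsFund

end

section

open scoped Matrix.Norms.Operator

/-! ### The Zakharov-Shabat system and its modified form -/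

theorem zsMatrix_eq (p : ℝ → ℂ) (z : ℂ) (x : ℝ) :
    zsMatrix p z x = !![-(Complex.I * z), p x; star (p x), Complex.I * z] := by
  ext i j
  fin_cases i <;> fin_cases j <;> simp [zsMatrix, pauli3, potMatrix]

theorem simMatrix_inv :
    simMatrix⁻¹ = !![1 / 2, Complex.I / 2; 1 / 2, -(Complex.I / 2)] := by
  refine Matrix.inv_eq_right_inv ?_
  ext i j
  fin_cases i <;> fin_cases j <;> simp [simMatrix, Matrix.mul_apply] <;> (ring_nf; try simp)

theorem simMatrix_mul_inv : simMatrix * simMatrix⁻¹ = 1 := by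
  rw [simMatrix_inv]
  ext i j
  fin_cases i <;> fin_cases j <;> simp [simMatrix, Matrix.mul_apply] <;> (ring_nf; try simp)

theorem simMatrix_inv_mul : simMatrix⁻¹ * simMatrix = 1 := mul_eq_one_comm.1 simMatrix_mul_inv

/-- The coefficient matrix of the modified Zakharov-Shabat system. -/
def modMatrix (p : ℝ → ℂ) (z : ℂ) (x : ℝ) : M2 := simMatrix * zsMatrix p z x * simMatrix⁻¹

/-- This is the reason for conjugating with `U`: for real `z` the modified system has real
coefficients. Its monodromy matrix is then real, and complex conjugation of `z` conjugates it
entrywise. -/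
theorem modMatrix_eq (p : ℝ → ℂ) (z : ℂ) (x : ℝ) :
    modMatrix p z x = !![((p x).re : ℂ), (p x).im + z; (p x).im - z, -((p x).re : ℂ)] := by
  rw [modMatrix, simMatrix_inv, zsMatrix_eq, simMatrix]
  have h1 : star (p x) = (p x).re - (p x).im * Complex.I := by
    apply Complex.ext <;> simp
  have h2 : p x = (p x).re + (p x).im * Complex.I := by
    apply Complex.ext <;> simp
  have hI := Complex.I_sq
  ext i j
  rw [h1]
  nth_rewrite 1 [h2]
  generalize ((p x).re : ℂ) = a
  generalize ((p x).im : ℂ) = b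
  fin_cases i <;> fin_cases j <;> simp [Matrix.mul_apply, Fin.sum_univ_two]
  · linear_combination 0 * hI
  · linear_combination (-(z + b)) * hI
  · linear_combination (-(b - z)) * hI
  · linear_combination (a) * hI

variable {p : ℝ → ℂ} {z : ℂ} {L : ℝ}

theorem continuous_zsMatrix (hp : Continuous p) : Continuous (zsMatrix p z) := by
  refine continuous_matrix fun i j => ?_
  simp_rw [zsMatrix_eq]
  fin_cases i <;> fin_cases j <;> simp <;> fun_prop

theorem zsFund (hp : Continuous p) (z : ℂ) : IsFund (zsMatrix p z) (principalSolution p z) := by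
  obtain ⟨h0, h⟩ := principalSolution_spec p hp z
  refine ⟨fun x => by simp [zsMatrix_eq, Matrix.trace_fin_two], h0, fun x => ?_⟩
  refine hasDerivAt_matrix.2 fun i j => ?_
  have := hasDerivAt_pi.1 (h j x) i
  simpa [Matrix.mul_apply, Matrix.mulVec, dotProduct] using this

/-- The principal matrix solution of the modified system. -/
def modSol (p : ℝ → ℂ) (z : ℂ) (x : ℝ) : M2 := simMatrix * principalSolution p z x * simMatrix⁻¹

theorem modMonodromy_eq : modMonodromy L p z = modSol p z L := rfl

theorem simMatrix_conj_mul (A B : M2) :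
    simMatrix * A * simMatrix⁻¹ * (simMatrix * B * simMatrix⁻¹) =
      simMatrix * (A * B) * simMatrix⁻¹ := by
  calc _ = simMatrix * A * (simMatrix⁻¹ * simMatrix) * B * simMatrix⁻¹ := by noncomm_ring
    _ = _ := by rw [simMatrix_inv_mul]; noncomm_ring

theorem hasDerivAt_simMatrix_conj {f : ℝ → M2} {f' : M2} {x : ℝ} (h : HasDerivAt f f' x) :
    HasDerivAt (fun x => simMatrix * f x * simMatrix⁻¹) (simMatrix * f' * simMatrix⁻¹) x :=
  (h.const_mul simMatrix).mul_const simMatrix⁻¹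

theorem modFund (hp : Continuous p) (z : ℂ) : IsFund (modMatrix p z) (modSol p z) := by
  refine ⟨fun x => by simp [modMatrix_eq, Matrix.trace_fin_two], ?_, fun x => ?_⟩
  · rw [modSol, (zsFund hp z).zero, mul_one, simMatrix_mul_inv]
  · rw [modMatrix, modSol, simMatrix_conj_mul]
    exact hasDerivAt_simMatrix_conj ((zsFund hp z).deriv x)

theorem trace_simMatrix_conj (A : M2) : (simMatrix * A * simMatrix⁻¹).trace = A.trace := by
  rw [Matrix.trace_mul_comm, ← mul_assoc, simMatrix_inv_mul, one_mul]

theorem discriminant_eq :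
    discriminant L p z = (modMonodromy L p z 0 0 + modMonodromy L p z 1 1) / 2 := by
  rw [← Matrix.trace_fin_two, modMonodromy, trace_simMatrix_conj, discriminant]

theorem det_modMonodromy (hp : Continuous p) : modMonodromy L p z 0 0 * modMonodromy L p z 1 1 -
    modMonodromy L p z 0 1 * modMonodromy L p z 1 0 = 1 := by
  rw [← Matrix.det_fin_two]
  exact (modFund hp z).det L

theorem IsZSSolution.mod {v : ℝ → Fin 2 → ℂ} (h : IsZSSolution p z v) :
    IsModZSSolution p z (fun x => simMatrix.mulVec (v x)) := by
  intro x
  have h1 := hasDerivAt_pi.1 (h x)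
  have h2 : simMatrix * zsMatrix p z x * simMatrix⁻¹ * simMatrix = simMatrix * zsMatrix p z x := by
    rw [mul_assoc, simMatrix_inv_mul, mul_one]
  rw [Matrix.mulVec_mulVec, h2, ← Matrix.mulVec_mulVec, hasDerivAt_pi]
  intro i
  simp only [Matrix.mulVec, dotProduct, Fin.sum_univ_two] at h1 ⊢
  exact ((h1 0).const_mul _).add ((h1 1).const_mul _)

theorem IsZSSolution.ne_zero (hp : Continuous p) {v : ℝ → Fin 2 → ℂ} (h : IsZSSolution p z v)
    (hv : v ≠ 0) (x : ℝ) : v x ≠ 0 := by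
  intro hx
  have h1 := (zsFund hp z).eq_mulVec h
  have h2 : v 0 = 0 := by
    have h3 := congrArg ((principalSolution p z x).adjugate.mulVec) (h1 x)
    rw [Matrix.mulVec_mulVec, (zsFund hp z).adjugate_mul, hx] at h3
    simpa using h3.symm
  exact hv (funext fun y => by rw [h1 y, h2]; simp)

theorem IsZSSolution.shift (hper : ∀ x, p (x + L) = p x) {v : ℝ → Fin 2 → ℂ}
    (h : IsZSSolution p z v) : IsZSSolution p z (fun x => v (x + L)) := by
  intro x
  have := HasDerivAt.comp_add_const x L (h (x + L))
  have h2 : zsMatrix p z (x + L) = zsMatrix p z x := by simp [zsMatrix_eq, hper]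
  rwa [h2] at this

theorem IsZSSolution.eq_of_zero (hp : Continuous p) {v w : ℝ → Fin 2 → ℂ}
    (h : IsZSSolution p z v) (h' : IsZSSolution p z w) (h0 : v 0 = w 0) : v = w := by
  funext x
  rw [(zsFund hp z).eq_mulVec h, (zsFund hp z).eq_mulVec h', h0]

/-- A solution whose initial value is an eigenvector of the monodromy matrix is a Floquet
solution. -/
theorem IsZSSolution.floquet (hp : Continuous p) (hper : ∀ x, p (x + L) = p x)
    {v : ℝ → Fin 2 → ℂ} (h : IsZSSolution p z v) {μ : ℂ} (h0 : v L = μ • v 0) (x : ℝ) :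
    v (x + L) = μ • v x := by
  have h2 : IsZSSolution p z (fun x => μ • v x) := fun x => by
    rw [Matrix.mulVec_smul]; exact (h x).const_smul μ
  have := IsZSSolution.eq_of_zero hp (h.shift hper) h2 (by simpa using h0)
  exact congrFun this x

theorem modSol_add (hp : Continuous p) (hper : ∀ x, p (x + L) = p x) (x : ℝ) :
    modSol p z (x + L) = modSol p z x * modMonodromy L p z := by
  have := (modFund hp z).eq_mul (W := fun x => modSol p z (x + L)) (fun x => by
    have h1 := HasDerivAt.comp_add_const x L ((modFund hp z).deriv (x + L))
    have h2 : modMatrix p z (x + L) = modMatrix p z x := by simp [modMatrix_eq, hper]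
    rwa [h2] at h1) x
  simpa [modMonodromy_eq] using this

/-- The conjugated solution solves the system with parameter `z̄`, because the potential enters the
modified coefficients only through real numbers; uniqueness does the rest. -/
theorem modSol_conj (hp : Continuous p) (x : ℝ) (i j : Fin 2) :
    modSol p (starRingEnd ℂ z) x i j = starRingEnd ℂ (modSol p z x i j) := by
  have h : IsFund (modMatrix p (starRingEnd ℂ z))
      (fun x => Matrix.of fun i j => starRingEnd ℂ (modSol p z x i j)) := by
    refine ⟨(modFund hp _).traceless, ?_, fun x => hasDerivAt_matrix.2 fun i j => ?_⟩
    · ext i j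
      rw [Matrix.of_apply, (modFund hp z).zero]
      fin_cases i <;> fin_cases j <;> simp
    · have h1 := (hasDerivAt_matrix.1 ((modFund hp z).deriv x) i j).star
      refine h1.congr_deriv ?_
      simp only [Matrix.mul_apply, Fin.sum_univ_two, modMatrix_eq, Matrix.of_apply]
      fin_cases i <;> simp
  have := congrFun ((modFund hp _).unique h) x
  rw [← this]
  rfl

theorem modMonodromy_conj (hp : Continuous p) (i j : Fin 2) :
    modMonodromy L p (starRingEnd ℂ z) i j = starRingEnd ℂ (modMonodromy L p z i j) :=
  modSol_conj hp L i j

theorem discriminant_conj (hp : Continuous p) :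
    discriminant L p (starRingEnd ℂ z) = starRingEnd ℂ (discriminant L p z) := by
  simp [discriminant_eq, modMonodromy_conj hp, Complex.conj_ofNat]

/-- The indefinite form `|v₁|² - |v₂|²` along a solution. -/
theorem IsZSSolution.hasDerivAt_form {v : ℝ → Fin 2 → ℂ} (h : IsZSSolution p z v) (x : ℝ) :
    HasDerivAt (fun x => ‖v x 0‖ ^ 2 - ‖v x 1‖ ^ 2)
      (2 * z.im * (‖v x 0‖ ^ 2 + ‖v x 1‖ ^ 2)) x := by
  have h1 := hasDerivAt_pi.1 (h x)
  refine ((h1 0).norm_sq.sub (h1 1).norm_sq).congr_deriv ?_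
  simp only [Complex.inner, zsMatrix_eq, Matrix.mulVec, dotProduct, Fin.sum_univ_two]
  simp [Complex.sq_norm, Complex.normSq_apply]
  ring

theorem norm_sq_add_pos {c : Fin 2 → ℂ} (hc : c ≠ 0) : 0 < ‖c 0‖ ^ 2 + ‖c 1‖ ^ 2 := by
  by_contra! h
  apply hc
  have h0 : ‖c 0‖ = 0 := by nlinarith [sq_nonneg ‖c 0‖, sq_nonneg ‖c 1‖]
  have h1 : ‖c 1‖ = 0 := by nlinarith [sq_nonneg ‖c 0‖, sq_nonneg ‖c 1‖]
  ext i
  fin_cases i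
  · simpa using h0
  · simpa using h1

theorem IsZSSolution.form_lt (hp : Continuous p) {v : ℝ → Fin 2 → ℂ} (h : IsZSSolution p z v)
    (hv : v ≠ 0) (hL : 0 < L) (hz : 0 < z.im) :
    ‖v 0 0‖ ^ 2 - ‖v 0 1‖ ^ 2 < ‖v L 0‖ ^ 2 - ‖v L 1‖ ^ 2 := by
  refine strictMono_of_deriv_pos (f := fun x => ‖v x 0‖ ^ 2 - ‖v x 1‖ ^ 2) (fun x => ?_) hL
  rw [(h.hasDerivAt_form x).deriv]
  have := norm_sq_add_pos (h.ne_zero hp hv x)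
  positivity

theorem IsZSSolution.lt_form (hp : Continuous p) {v : ℝ → Fin 2 → ℂ} (h : IsZSSolution p z v)
    (hv : v ≠ 0) (hL : 0 < L) (hz : z.im < 0) :
    ‖v L 0‖ ^ 2 - ‖v L 1‖ ^ 2 < ‖v 0 0‖ ^ 2 - ‖v 0 1‖ ^ 2 := by
  refine strictAnti_of_deriv_neg (f := fun x => ‖v x 0‖ ^ 2 - ‖v x 1‖ ^ 2) (fun x => ?_) hL
  rw [(h.hasDerivAt_form x).deriv]
  have := norm_sq_add_pos (h.ne_zero hp hv x)
  nlinarith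

theorem IsZSSolution.form_eq {v : ℝ → Fin 2 → ℂ} (h : IsZSSolution p z v) (hz : z.im = 0) :
    ‖v L 0‖ ^ 2 - ‖v L 1‖ ^ 2 = ‖v 0 0‖ ^ 2 - ‖v 0 1‖ ^ 2 :=
  eq_of_hasDerivAt_zero (f := fun x => ‖v x 0‖ ^ 2 - ‖v x 1‖ ^ 2)
    (fun x => (h.hasDerivAt_form x).congr_deriv (by simp [hz])) L 0

/-- For `z` in the closed upper half plane, a decaying Floquet solution satisfies `|v₁| ≤ |v₂|`,
strictly for nonreal `z`. -/
theorem IsZSSolution.norm_le (hp : Continuous p) {v : ℝ → Fin 2 → ℂ}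
    (h : IsZSSolution p z v) (hv : v ≠ 0) (hL : 0 < L) {μ : ℂ} (h0 : v L = μ • v 0)
    (hz : 0 ≤ z.im ∧ ‖μ‖ < 1 ∨ z.im ≤ 0 ∧ 1 < ‖μ‖) :
    ‖v 0 0‖ ≤ ‖v 0 1‖ ∧ (z.im ≠ 0 → ‖v 0 0‖ < ‖v 0 1‖) ∧ (z.im = 0 → ‖v 0 0‖ = ‖v 0 1‖) := by
  -- Over one period the form is multiplied by `|μ|²`, while the sign of `Im z` says whether it
  -- increases, decreases or stays constant. Comparing the two determines the sign of the form.
  have e : ‖v L 0‖ ^ 2 - ‖v L 1‖ ^ 2 = ‖μ‖ ^ 2 * (‖v 0 0‖ ^ 2 - ‖v 0 1‖ ^ 2) := by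
    rw [h0]; simp; ring
  have hlt : z.im ≠ 0 → ‖v 0 0‖ < ‖v 0 1‖ := by
    intro hz0
    refine lt_of_pow_lt_pow_left₀ 2 (norm_nonneg _) ?_
    rcases hz with ⟨h1, h2⟩ | ⟨h1, h2⟩
    · have := h.form_lt hp hv hL (lt_of_le_of_ne h1 hz0.symm)
      rw [e] at this
      have h3 : ‖μ‖ ^ 2 < 1 := by nlinarith [norm_nonneg μ]
      nlinarith
    · have := h.lt_form hp hv hL (lt_of_le_of_ne h1 hz0)
      rw [e] at this
      have h3 : 1 < ‖μ‖ ^ 2 := by nlinarith [norm_nonneg μ]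
      nlinarith
  have heq : z.im = 0 → ‖v 0 0‖ = ‖v 0 1‖ := by
    intro hz0
    have := h.form_eq (L := L) hz0
    rw [e] at this
    have h3 : ‖μ‖ ^ 2 - 1 ≠ 0 := by
      rcases hz with ⟨_, h2⟩ | ⟨_, h2⟩
      · have : ‖μ‖ ^ 2 < 1 := by nlinarith [norm_nonneg μ]
        linarith
      · have : 1 < ‖μ‖ ^ 2 := by nlinarith [norm_nonneg μ]
        linarith
    have h4 : ‖v 0 0‖ ^ 2 - ‖v 0 1‖ ^ 2 = 0 := by
      have : (‖μ‖ ^ 2 - 1) * (‖v 0 0‖ ^ 2 - ‖v 0 1‖ ^ 2) = 0 := by linarith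
      exact (mul_eq_zero.1 this).resolve_left h3
    exact (pow_left_inj₀ (norm_nonneg _) (norm_nonneg _) (two_ne_zero)).1 (sub_eq_zero.1 h4)
  refine ⟨?_, hlt, heq⟩
  by_cases hz0 : z.im = 0
  · exact (heq hz0).le
  · exact (hlt hz0).le

/-! ### The Lax spectrum and the Dirichlet spectrum -/

/-- Such a function grows geometrically in one direction: `f x` is compared with `f (x - nL)` if
`|μ| < 1` and with `f (x + nL)` if `|μ| > 1`. -/
theorem eq_zero_of_bounded_of_multiplier {E : Type*} [NormedAddCommGroup E] [NormedSpace ℂ E]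
    {f : ℝ → E} {μ : ℂ} (hf : ∀ x, f (x + L) = μ • f x) (hμ : ‖μ‖ ≠ 1) {C : ℝ}
    (hC : ∀ x, ‖f x‖ ≤ C) (x : ℝ) : f x = 0 := by
  have hn : ∀ (n : ℕ) (x : ℝ), f (x + n * L) = μ ^ n • f x := by
    intro n
    induction n with
    | zero => simp
    | succ n ih =>
      intro x
      have : x + (n + 1 : ℕ) * L = (x + n * L) + L := by push_cast; ring
      rw [this, hf, ih, smul_smul, pow_succ']
  rw [← norm_le_zero_iff]
  rcases lt_or_gt_of_ne hμ with h | h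
  · have ht : Tendsto (fun n : ℕ => ‖μ‖ ^ n * C) atTop (𝓝 0) := by
      simpa using (tendsto_pow_atTop_nhds_zero_of_lt_one (norm_nonneg μ) h).mul_const C
    refine ge_of_tendsto ht (Eventually.of_forall fun n => ?_)
    have := hn n (x - n * L)
    rw [sub_add_cancel] at this
    rw [this, norm_smul, norm_pow]
    gcongr
    exact hC _
  · have h0 : ‖μ‖ ≠ 0 := by positivity
    have ht : Tendsto (fun n : ℕ => (‖μ‖⁻¹) ^ n * C) atTop (𝓝 0) := by
      simpa using (tendsto_pow_atTop_nhds_zero_of_lt_one (inv_nonneg.2 (norm_nonneg μ))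
        (inv_lt_one_of_one_lt₀ h)).mul_const C
    refine ge_of_tendsto ht (Eventually.of_forall fun n => ?_)
    have h2 : ‖f x‖ = (‖μ‖⁻¹) ^ n * ‖f (x + n * L)‖ := by
      rw [hn n x, norm_smul, norm_pow, ← mul_assoc, ← mul_pow, inv_mul_cancel₀ h0, one_pow, one_mul]
    rw [h2]
    gcongr
    exact hC _

theorem exists_eigenvector {M : M2} (hM : M.det = 1) {μ : ℂ}
    (hμ : μ ^ 2 - M.trace * μ + 1 = 0) : ∃ c : Fin 2 → ℂ, c ≠ 0 ∧ M.mulVec c = μ • c := by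
  have : (M - μ • (1 : M2)).det = 0 := by
    rw [Matrix.det_fin_two] at hM ⊢
    rw [Matrix.trace_fin_two] at hμ
    simp
    linear_combination hμ + hM
  obtain ⟨c, hc, h⟩ := Matrix.exists_mulVec_eq_zero_iff.2 this
  refine ⟨c, hc, ?_⟩
  rw [Matrix.sub_mulVec, Matrix.smul_mulVec, Matrix.one_mulVec] at h
  exact sub_eq_zero.1 h

theorem cayleyHamilton_two {M : M2} (hM : M.det = 1) (c : Fin 2 → ℂ) :
    M.mulVec (M.mulVec c) - M.trace • M.mulVec c + c = 0 := by
  rw [Matrix.det_fin_two] at hM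
  ext i
  fin_cases i <;>
    simp [Matrix.trace_fin_two]
  · linear_combination -(c 0) * hM
  · linear_combination -(c 1) * hM

theorem isZSSolution_principal (hp : Continuous p) (c : Fin 2 → ℂ) :
    IsZSSolution p z (fun x => (principalSolution p z x).mulVec c) :=
  (zsFund hp z).hasDerivAt_mulVec c

theorem principal_ne_zero (hp : Continuous p) {c : Fin 2 → ℂ} (hc : c ≠ 0) :
    (fun x => (principalSolution p z x).mulVec c) ≠ 0 := by
  intro h
  have := congrFun h 0
  rw [(zsFund hp z).zero, Matrix.one_mulVec] at this
  exact hc this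

theorem discriminant_two : (principalSolution p z L).trace = 2 * discriminant L p z := by
  rw [discriminant]; ring

/-- Floquet theory without diagonalization. By Cayley-Hamilton every solution is annihilated by `(τ
- r)(τ - r⁻¹)`, where `τ` is the shift by `L`. If `|r| ≠ 1`, neither factor annihilates a nonzero
bounded function, so bounded solutions vanish. Conversely, an eigenvector with a unimodular
multiplier starts a solution whose norm is periodic. -/
theorem mem_laxSpectrum_iff (hp : Continuous p) (hper : ∀ x, p (x + L) = p x) (hL : 0 < L) :
    z ∈ laxSpectrum p ↔ ∃ μ : ℂ, ‖μ‖ = 1 ∧ μ ^ 2 - 2 * discriminant L p z * μ + 1 = 0 := by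
  have hdet := (zsFund hp z).det L
  constructor
  · rintro ⟨v, hv, hv0, C, hC⟩
    by_contra! hno
    obtain ⟨r, hr⟩ : ∃ r : ℂ, r ^ 2 - 2 * discriminant L p z * r + 1 = 0 := by
      obtain ⟨w, hw⟩ := IsAlgClosed.exists_pow_nat_eq (discriminant L p z ^ 2 - 1) two_pos
      exact ⟨discriminant L p z + w, by linear_combination hw⟩
    have hr0 : r ≠ 0 := by rintro rfl; simp at hr
    have hr1 : ‖r‖ ≠ 1 := fun h => hno r h hr
    have htr : 2 * discriminant L p z = r + r⁻¹ := by
      field_simp; linear_combination -hr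
    have hvL : ∀ x, v (x + L + L) - (r + r⁻¹) • v (x + L) + v x = 0 := by
      have h1 : IsZSSolution p z fun x => v (x + L + L) - (r + r⁻¹) • v (x + L) + v x := by
        intro x
        rw [Matrix.mulVec_add, Matrix.mulVec_sub, Matrix.mulVec_smul]
        exact (((hv.shift hper).shift hper x).sub (((hv.shift hper) x).const_smul (r + r⁻¹))).add (hv x)
      have h2 : IsZSSolution p z fun _ => 0 := fun x => by
        simpa using hasDerivAt_const x (0 : Fin 2 → ℂ)
      refine fun x => congrFun (h1.eq_of_zero hp h2 ?_) x
      have e1 : v L = (principalSolution p z L).mulVec (v 0) := (zsFund hp z).eq_mulVec hv L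
      have e2 : v (L + L) = (principalSolution p z L).mulVec (v L) := by
        simpa using (zsFund hp z).eq_mulVec (hv.shift hper) L
      have := cayleyHamilton_two hdet (v 0)
      rw [discriminant_two, htr, ← e1, ← e2] at this
      simpa using this
    have hu : ∀ x, v (x + L) - r⁻¹ • v x = 0 := by
      refine eq_zero_of_bounded_of_multiplier (L := L) (μ := r) (C := C + ‖r⁻¹‖ * C)
        (fun x => ?_) hr1 (fun x => ?_)
      · rw [← sub_eq_zero, ← hvL x, smul_sub, smul_smul, mul_inv_cancel₀ hr0, one_smul, add_smul]
        abel
      · refine (norm_sub_le _ _).trans (add_le_add (hC _) ?_)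
        rw [norm_smul]
        exact mul_le_mul_of_nonneg_left (hC x) (norm_nonneg _)
    refine hv0 (funext (eq_zero_of_bounded_of_multiplier (L := L) (μ := r⁻¹)
      (fun x => sub_eq_zero.1 (hu x)) ?_ hC))
    rw [norm_inv]
    simpa using hr1
  · rintro ⟨μ, hμ1, hμ⟩
    rw [← discriminant_two] at hμ
    obtain ⟨c, hc, hMc⟩ := exists_eigenvector hdet hμ
    set v : ℝ → Fin 2 → ℂ := fun x => (principalSolution p z x).mulVec c
    have hv : IsZSSolution p z v := isZSSolution_principal hp c
    have hvc : Continuous fun x => ‖v x‖ :=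
      (continuous_iff_continuousAt.2 fun x => (hv x).continuousAt).norm
    have hv0 : v 0 = c := by simp only [v, (zsFund hp z).zero, Matrix.one_mulVec]
    have hfl := hv.floquet hp hper (μ := μ) (by rw [hv0]; exact hMc)
    have hpd : Function.Periodic (fun x => ‖v x‖) L := fun x => by
      simp only [hfl, norm_smul, hμ1, one_mul]
    obtain ⟨C, hC⟩ := (isCompact_Icc (a := 0) (b := 0 + L)).exists_bound_of_continuousOn
      hvc.continuousOn
    refine ⟨v, hv, principal_ne_zero hp hc, C, fun x => ?_⟩
    obtain ⟨y, hy, hxy⟩ := hpd.exists_mem_Ico hL x 0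
    have := hC y (Ico_subset_Icc_self hy)
    rw [norm_norm] at this
    rwa [hxy]

/-- A unimodular multiplier returns `|v₁|² - |v₂|²` to its value after one period, which the strict
monotonicity of the form excludes for nonreal `z`. This is self-adjointness in disguise. -/
theorem im_eq_zero_of_mem_laxSpectrum (hp : Continuous p) (hper : ∀ x, p (x + L) = p x)
    (hL : 0 < L) (hz : z ∈ laxSpectrum p) : z.im = 0 := by
  obtain ⟨μ, hμ1, hμ⟩ := (mem_laxSpectrum_iff hp hper hL).1 hz
  rw [← discriminant_two] at hμ
  obtain ⟨c, hc, hMc⟩ := exists_eigenvector ((zsFund hp z).det L) hμ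
  have hv := isZSSolution_principal (z := z) hp c
  have hv0 := principal_ne_zero (z := z) hp hc
  have e : ∀ i, ‖(principalSolution p z L).mulVec c i‖ =
      ‖(principalSolution p z 0).mulVec c i‖ := fun i => by
    rw [hMc, (zsFund hp z).zero]; simp [hμ1]
  rcases lt_trichotomy z.im 0 with h | h | h
  · exact absurd (hv.lt_form hp hv0 hL h) (by simp only [e, lt_irrefl, not_false_iff])
  · exact h
  · exact absurd (hv.form_lt hp hv0 hL h) (by simp only [e, lt_irrefl, not_false_iff])

/-- The two multipliers are inverse to each other, so `Δ = (μ + μ⁻¹) / 2`, which is `Re μ` when `μ`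
is unimodular. -/
theorem mem_laxSpectrum_iff_discriminant (hp : Continuous p) (hper : ∀ x, p (x + L) = p x)
    (hL : 0 < L) : z ∈ laxSpectrum p ↔ ∃ c ∈ Icc (-1 : ℝ) 1, discriminant L p z = c := by
  rw [mem_laxSpectrum_iff hp hper hL]
  constructor
  · rintro ⟨μ, h1, h⟩
    have hμ0 : μ ≠ 0 := by rintro rfl; simp at h1
    have h2 : discriminant L p z = (μ + μ⁻¹) / 2 := by field_simp; linear_combination -h
    have h3 : μ⁻¹ = starRingEnd ℂ μ := by
      rw [Complex.inv_def, Complex.normSq_eq_norm_sq, h1]; simp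
    refine ⟨μ.re, ?_, ?_⟩
    · rw [mem_Icc, ← abs_le, ← h1]; exact Complex.abs_re_le_norm μ
    · rw [h2, h3, Complex.add_conj]; simp
  · rintro ⟨c, ⟨hc1, hc2⟩, h⟩
    have hc : 0 ≤ 1 - c ^ 2 := by nlinarith
    refine ⟨⟨c, √(1 - c ^ 2)⟩, ?_, ?_⟩
    · rw [← sq_eq_sq₀ (norm_nonneg _) zero_le_one, Complex.sq_norm, Complex.normSq_mk,
        Real.mul_self_sqrt hc]
      ring
    · rw [h]
      have := Real.mul_self_sqrt hc
      generalize √(1 - c ^ 2) = s at this ⊢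
      apply Complex.ext <;> simp [sq] <;> linarith

/-- The two roots have product one, and off the spectrum neither lies on the unit circle, so one of
them lies inside. -/
theorem floquetMultiplier_spec (hp : Continuous p) (hper : ∀ x, p (x + L) = p x) (hL : 0 < L)
    (hz : z ∉ laxSpectrum p) :
    floquetMultiplier L p z ^ 2 - 2 * discriminant L p z * floquetMultiplier L p z + 1 = 0 ∧
      ‖floquetMultiplier L p z‖ < 1 := by
  refine Classical.epsilon_spec
    (p := fun r : ℂ => r ^ 2 - 2 * discriminant L p z * r + 1 = 0 ∧ ‖r‖ < 1) ?_
  rw [mem_laxSpectrum_iff hp hper hL] at hz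
  push Not at hz
  obtain ⟨w, hw⟩ := IsAlgClosed.exists_pow_nat_eq (discriminant L p z ^ 2 - 1) two_pos
  set r := discriminant L p z + w
  set r' := discriminant L p z - w
  have h1 : r ^ 2 - 2 * discriminant L p z * r + 1 = 0 := by linear_combination hw
  have h2 : r' ^ 2 - 2 * discriminant L p z * r' + 1 = 0 := by linear_combination hw
  have h3 : ‖r‖ * ‖r'‖ = 1 := by
    rw [← norm_mul]
    have : r * r' = 1 := by linear_combination -hw
    rw [this]; simp
  by_contra! hcon
  have h4 : 1 < ‖r‖ := lt_of_le_of_ne (hcon r h1) (fun h => hz r h.symm h1)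
  have h5 : 1 ≤ ‖r'‖ := hcon r' h2
  nlinarith

theorem floquetMultiplier_unique (hp : Continuous p) (hper : ∀ x, p (x + L) = p x) (hL : 0 < L)
    (hz : z ∉ laxSpectrum p) {r : ℂ} (hr : r ^ 2 - 2 * discriminant L p z * r + 1 = 0)
    (hr1 : ‖r‖ < 1) : r = floquetMultiplier L p z := by
  obtain ⟨h1, h2⟩ := floquetMultiplier_spec hp hper hL hz
  set ρ := floquetMultiplier L p z
  have h3 : (r - ρ) * (r * ρ - 1) = 0 := by linear_combination ρ * hr - r * h1
  rcases mul_eq_zero.1 h3 with h | h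
  · exact sub_eq_zero.1 h
  · have : ‖r * ρ‖ = 1 := by rw [sub_eq_zero.1 h]; simp
    rw [norm_mul] at this
    nlinarith [norm_nonneg r, norm_nonneg ρ]

theorem simMatrix_mulVec_zero (v : Fin 2 → ℂ) : simMatrix.mulVec v 0 = v 0 + v 1 := by
  simp [simMatrix, Matrix.mulVec, dotProduct, Fin.sum_univ_two]

/-- The first component of `U v` is `v₁ + v₂`. The boundary conditions therefore say that the
modified monodromy matrix maps the second basis vector to a multiple of itself. -/
theorem mem_dirichletSpectrum_iff (hp : Continuous p) :
    z ∈ dirichletSpectrum L p ↔ modMonodromy L p z 0 1 = 0 := by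
  have key : ∀ v, IsZSSolution p z v → simMatrix.mulVec (v L) =
      (modMonodromy L p z).mulVec (simMatrix.mulVec (v 0)) := fun v hv =>
    (modFund hp z).eq_mulVec hv.mod L
  constructor
  · rintro ⟨v, hv, hv0, h0, h1⟩
    have h2 := congrFun (key v hv) 0
    rw [simMatrix_mulVec_zero, h1, Matrix.mulVec, dotProduct, Fin.sum_univ_two,
      simMatrix_mulVec_zero, h0, mul_zero, zero_add] at h2
    rcases mul_eq_zero.1 h2.symm with h | h
    · exact h
    · refine absurd ?_ (hv.ne_zero hp hv0 0)
      simp [simMatrix, Matrix.mulVec, dotProduct, Fin.sum_univ_two] at h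
      have h3 : v 0 0 = v 0 1 := by
        have : Complex.I * (v 0 1 - v 0 0) = 0 := by linear_combination h
        exact (sub_eq_zero.1 ((mul_eq_zero.1 this).resolve_left Complex.I_ne_zero)).symm
      have h4 : v 0 0 = 0 := by rw [← h3] at h0; linear_combination h0 / 2
      ext i
      fin_cases i
      · exact h4
      · exact h3 ▸ h4
  · intro h
    have hc : (![1, -1] : Fin 2 → ℂ) ≠ 0 := fun h => by simpa using congrFun h 0
    have hv := isZSSolution_principal (z := z) hp ![1, -1]
    have hv0 : (principalSolution p z 0).mulVec ![1, -1] = ![1, -1] := by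
      rw [(zsFund hp z).zero, Matrix.one_mulVec]
    refine ⟨_, hv, principal_ne_zero hp hc, by rw [hv0]; simp, ?_⟩
    have h2 := congrFun (key _ hv) 0
    rw [← simMatrix_mulVec_zero, h2, hv0, Matrix.mulVec, dotProduct, Fin.sum_univ_two, h,
      simMatrix_mulVec_zero]
    simp

/-- The boundary conditions make the form `|v₁|² - |v₂|²` vanish at both ends of the period. -/
theorem im_eq_zero_of_mem_dirichletSpectrum (hp : Continuous p) (hL : 0 < L)
    (hz : z ∈ dirichletSpectrum L p) : z.im = 0 := by
  obtain ⟨v, hv, hv0, h0, h1⟩ := hz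
  have e0 : ‖v 0 0‖ = ‖v 0 1‖ := by rw [eq_neg_of_add_eq_zero_left h0, norm_neg]
  have e1 : ‖v L 0‖ = ‖v L 1‖ := by rw [eq_neg_of_add_eq_zero_left h1, norm_neg]
  rcases lt_trichotomy z.im 0 with h | h | h
  · exact absurd (hv.lt_form hp hv0 hL h) (by simp [e0, e1])
  · exact h
  · exact absurd (hv.form_lt hp hv0 hL h) (by simp [e0, e1])

end

section

open scoped Matrix.Norms.Operator

/-! ### Analyticity in the spectral parameter -/

variable {p : ℝ → ℂ} {z : ℂ} {L : ℝ}

/-- The fundamental matrix of a system that depends quadratically on a parameter is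
differentiable in the parameter. -/
theorem IsFund.hasDerivAt_param {A Y : ℂ → ℝ → M2} {A₀ A₁ A₂ : ℝ → M2}
    (hY : ∀ z, IsFund (A z) (Y z)) (hA : ∀ z x, A z x = A₀ x + z • A₁ x + z ^ 2 • A₂ x)
    (h₀ : Continuous A₀) (h₁ : Continuous A₁) (h₂ : Continuous A₂) {l : ℝ} (hl : 0 ≤ l) (z : ℂ) :
    HasDerivAt (fun z => Y z l) (Y z l *
      ∫ s in (0 : ℝ)..l, (Y z s).adjugate * (A₁ s + (2 * z) • A₂ s) * Y z s) z := by
  have hc : ∀ z, Continuous (A z) := fun z => by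
    have : A z = fun x => A₀ x + z • A₁ x + z ^ 2 • A₂ x := funext (hA z)
    rw [this]
    exact (h₀.add (h₁.const_smul z)).add (h₂.const_smul (z ^ 2))
  have hsub : ∀ w x, A w x - A z x = (w - z) • (A₁ x + (w + z) • A₂ x) := fun w x => by
    rw [hA, hA]; module
  obtain ⟨C₁, hC₁⟩ := (isCompact_Icc (a := 0) (b := l)).exists_bound_of_continuousOn
    h₁.continuousOn
  obtain ⟨C₂, hC₂⟩ := (isCompact_Icc (a := 0) (b := l)).exists_bound_of_continuousOn
    h₂.continuousOn
  refine hasDerivAt_iff_tendsto_slope.2 ?_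
  refine (IsFundPair.tendsto_quotient (hY z).pair (F := 𝓝[≠] z) (B := A) (W := Y)
    (Eventually.of_forall fun w => (hY w).pair) (hc z) (Eventually.of_forall hc) hl
    (d := fun w => w - z) (C := C₁ + (‖z‖ + 1 + ‖z‖) * C₂)
    (D := fun x => A₁ x + (2 * z) • A₂ x) ?_ ?_ ?_ ?_)
  · refine tendsto_nhdsWithin_of_tendsto_nhds ?_
    have : Tendsto (fun w => w - z) (𝓝 z) (𝓝 (z - z)) :=
      (continuous_id.sub continuous_const).tendsto z
    rwa [sub_self] at this
  · filter_upwards [self_mem_nhdsWithin] with w hw using sub_ne_zero.2 hw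
  · have : ∀ᶠ w in 𝓝 z, ‖w‖ < ‖z‖ + 1 :=
      continuous_norm.continuousAt.eventually (gt_mem_nhds (lt_add_one ‖z‖))
    filter_upwards [nhdsWithin_le_nhds this] with w hw x hx
    rw [hsub, norm_smul, mul_comm]
    refine mul_le_mul_of_nonneg_right ((norm_add_le _ _).trans (add_le_add (hC₁ x hx) ?_))
      (norm_nonneg _)
    rw [norm_smul]
    refine mul_le_mul ((norm_add_le _ _).trans (by linarith)) (hC₂ x hx) (norm_nonneg _)
      (by positivity)
  · intro x _
    have h1 : Tendsto (fun w => A₁ x + (w + z) • A₂ x) (𝓝[≠] z) (𝓝 (A₁ x + (2 * z) • A₂ x)) := by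
      refine tendsto_nhdsWithin_of_tendsto_nhds ?_
      have : Continuous fun w => A₁ x + (w + z) • A₂ x :=
        continuous_const.add ((continuous_id.add continuous_const).smul continuous_const)
      rw [two_mul]
      exact this.tendsto z
    refine h1.congr' ?_
    filter_upwards [self_mem_nhdsWithin] with w hw
    rw [hsub, smul_smul, inv_mul_cancel₀ (sub_ne_zero.2 hw), one_smul]

theorem IsFund.differentiable_param {A Y : ℂ → ℝ → M2} {A₀ A₁ A₂ : ℝ → M2}
    (hY : ∀ z, IsFund (A z) (Y z)) (hA : ∀ z x, A z x = A₀ x + z • A₁ x + z ^ 2 • A₂ x)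
    (h₀ : Continuous A₀) (h₁ : Continuous A₁) (h₂ : Continuous A₂) (l : ℝ) :
    Differentiable ℂ (fun z => Y z l) := by
  rcases le_total 0 l with hl | hl
  · exact fun z => (IsFund.hasDerivAt_param hY hA h₀ h₁ h₂ hl z).differentiableAt
  · intro z
    have := IsFund.hasDerivAt_param (fun z => (hY z).neg) (A₀ := fun x => -A₀ (-x))
      (A₁ := fun x => -A₁ (-x)) (A₂ := fun x => -A₂ (-x)) (fun z x => by rw [hA]; module)
      (h₀.comp continuous_neg).neg (h₁.comp continuous_neg).neg (h₂.comp continuous_neg).neg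
      (neg_nonneg.2 hl) z
    have h := this.differentiableAt
    simp only [neg_neg] at h
    exact h

theorem hasDerivAt_entry {f : ℂ → M2} {f' : M2} {z : ℂ} (h : HasDerivAt f f' z) (i j : Fin 2) :
    HasDerivAt (fun z => f z i j) (f' i j) z :=
  hasDerivAt_pi.1 (hasDerivAt_pi.1 h i) j

theorem differentiable_entry {f : ℂ → M2} (h : Differentiable ℂ f) (i j : Fin 2) :
    Differentiable ℂ (fun z => f z i j) :=
  fun z => (hasDerivAt_entry (h z).hasDerivAt i j).differentiableAt

/-- The derivative of the modified coefficient matrix in the spectral parameter. -/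
def rotMatrix : M2 := !![0, 1; -1, 0]

theorem modMatrix_eq_add (p : ℝ → ℂ) (z : ℂ) (x : ℝ) :
    modMatrix p z x = modMatrix p 0 x + z • rotMatrix + z ^ 2 • (0 : M2) := by
  rw [modMatrix_eq, modMatrix_eq, rotMatrix]
  ext i j
  fin_cases i <;> fin_cases j <;> simp
  ring

theorem continuous_modMatrix (hp : Continuous p) (z : ℂ) : Continuous (modMatrix p z) := by
  refine continuous_matrix fun i j => ?_
  simp_rw [modMatrix_eq]
  fin_cases i <;> fin_cases j <;> simp <;> fun_prop

theorem hasDerivAt_modMonodromy (hp : Continuous p) (hL : 0 ≤ L) (z : ℂ) :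
    HasDerivAt (fun z => modMonodromy L p z) (modMonodromy L p z * ∫ s in (0 : ℝ)..L,
      (modSol p z s).adjugate * rotMatrix * modSol p z s) z := by
  have := IsFund.hasDerivAt_param (fun z => modFund hp z) (modMatrix_eq_add p)
    (continuous_modMatrix hp 0) continuous_const continuous_const hL z
  simp only [smul_zero, add_zero] at this
  exact this

theorem differentiable_modMonodromy (hp : Continuous p) (hL : 0 ≤ L) (i j : Fin 2) :
    Differentiable ℂ (fun z => modMonodromy L p z i j) :=
  differentiable_entry (fun z => (hasDerivAt_modMonodromy hp hL z).differentiableAt) i j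

theorem differentiable_discriminant (hp : Continuous p) (hL : 0 ≤ L) :
    Differentiable ℂ (discriminant L p) := by
  have : discriminant L p =
      fun z => (modMonodromy L p z 0 0 + modMonodromy L p z 1 1) / 2 :=
    funext fun z => discriminant_eq
  rw [this]
  exact ((differentiable_modMonodromy hp hL 0 0).add (differentiable_modMonodromy hp hL 1 1)).div_const 2

theorem isClosed_laxSpectrum (hp : Continuous p) (hper : ∀ x, p (x + L) = p x) (hL : 0 < L) :
    IsClosed (laxSpectrum p) := by
  have : laxSpectrum p = discriminant L p ⁻¹' ((fun c : ℝ => (c : ℂ)) '' Icc (-1 : ℝ) 1) := by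
    ext z
    rw [mem_laxSpectrum_iff_discriminant hp hper hL]
    simp only [mem_preimage, mem_image]
    exact ⟨fun ⟨c, h, h'⟩ => ⟨c, h, h'.symm⟩, fun ⟨c, h, h'⟩ => ⟨c, h, h'.symm⟩⟩
  rw [this]
  exact ((isCompact_Icc.image Complex.continuous_ofReal).isClosed).preimage
    (differentiable_discriminant hp hL.le).continuous

theorem intervalIntegral_entry {f : ℝ → M2} (hf : Continuous f) (a b : ℝ) (i j : Fin 2) :
    (∫ s in a..b, f s) i j = ∫ s in a..b, f s i j := by
  let T : M2 →L[ℝ] ℂ := LinearMap.toContinuousLinearMap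
    ((LinearMap.proj j : (Fin 2 → ℂ) →ₗ[ℝ] ℂ).comp (LinearMap.proj i : M2 →ₗ[ℝ] (Fin 2 → ℂ)))
  exact (T.intervalIntegral_comp_comm (hf.intervalIntegrable a b)).symm

theorem modMonodromy_real (hp : Continuous p) (hz : z.im = 0) (i j : Fin 2) :
    (modMonodromy L p z i j).im = 0 := by
  have := modMonodromy_conj (L := L) (z := z) hp i j
  rw [Complex.conj_eq_iff_im.2 hz] at this
  exact Complex.conj_eq_iff_im.1 this.symm

theorem discriminant_real (hp : Continuous p) (hz : z.im = 0) : (discriminant L p z).im = 0 := by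
  have := discriminant_conj (L := L) (z := z) hp
  rw [Complex.conj_eq_iff_im.2 hz] at this
  exact Complex.conj_eq_iff_im.1 this.symm

/-- Dirichlet eigenvalues are simple zeros of the upper right entry of the monodromy matrix. -/
theorem deriv_modMonodromy_ne_zero (hp : Continuous p) (hL : 0 < L) (hz : z.im = 0)
    (h : modMonodromy L p z 0 1 = 0) : deriv (fun z => modMonodromy L p z 0 1) z ≠ 0 := by
  have hd := hasDerivAt_entry (hasDerivAt_modMonodromy hp hL.le z) 0 1
  have hm : modMonodromy L p z 0 0 ≠ 0 := by
    intro h0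
    have := det_modMonodromy (L := L) (z := z) hp
    rw [h, h0] at this
    simp at this
  have hW := (modFund hp z).continuous
  have hcont : Continuous fun s => (modSol p z s).adjugate * rotMatrix * modSol p z s :=
    ((modFund hp z).pair.continuous_inv.mul continuous_const).mul hW
  rw [hd.deriv, Matrix.mul_apply, Fin.sum_univ_two, h, zero_mul, add_zero,
    intervalIntegral_entry hcont]
  refine mul_ne_zero hm ?_
  have hreal : ∀ s i j, (modSol p z s i j) = ((modSol p z s i j).re : ℂ) := fun s i j => by
    have := modSol_conj (z := z) hp s i j
    rw [Complex.conj_eq_iff_im.2 hz] at this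
    exact (Complex.conj_eq_iff_re.1 this.symm).symm
  -- For real `z` the solution is real, and this entry is the squared length of its second column.
  -- So the integral in the derivative of `M₀₁` is positive, and `M₀₀` in front of it is nonzero
  -- because the determinant is one.
  have e : ∀ s, ((modSol p z s).adjugate * rotMatrix * modSol p z s) 0 1 =
      (((modSol p z s 1 1).re ^ 2 + (modSol p z s 0 1).re ^ 2 : ℝ) : ℂ) := by
    intro s
    rw [Matrix.adjugate_fin_two, rotMatrix]
    simp only [Matrix.mul_apply, Fin.sum_univ_two]
    push_cast
    rw [← hreal, ← hreal]
    simp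
    ring
  simp_rw [e]
  rw [intervalIntegral.integral_ofReal, Complex.ofReal_ne_zero]
  have hent : ∀ i j, Continuous fun s => (modSol p z s i j).re := fun i j =>
    Complex.continuous_re.comp (hW.matrix_elem i j)
  refine (intervalIntegral.intervalIntegral_pos_of_pos
    (f := fun s => (modSol p z s 1 1).re ^ 2 + (modSol p z s 0 1).re ^ 2)
    ((((hent 1 1).pow 2).add ((hent 0 1).pow 2)).intervalIntegrable _ _) (fun s => ?_) hL).ne'
  have hdet := (modFund hp z).det s
  rw [Matrix.det_fin_two, hreal s 1 1, hreal s 0 1] at hdet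
  by_contra! hcon
  have h1 : (modSol p z s 1 1).re = 0 := by
    nlinarith [sq_nonneg (modSol p z s 1 1).re, sq_nonneg (modSol p z s 0 1).re]
  have h2 : (modSol p z s 0 1).re = 0 := by
    nlinarith [sq_nonneg (modSol p z s 1 1).re, sq_nonneg (modSol p z s 0 1).re]
  rw [h1, h2] at hdet
  simp at hdet

end

section

open scoped Matrix.Norms.Operator

/-! ### The Lax pair -/

variable {q : ℝ → ℝ → ℂ} {z : ℂ} {L : ℝ} {S : Set ℝ} {t τ x : ℝ}

namespace IsPeriodicNLSSolution

theorem mono {S' : Set ℝ} (hq : IsPeriodicNLSSolution L S q) (h : S' ⊆ S) :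
    IsPeriodicNLSSolution L S' q where
  periodic t ht := hq.periodic t (h ht)
  contDiff t ht := hq.contDiff t (h ht)
  continuous := hq.continuous.mono (prod_mono_right h)
  continuous_dx := hq.continuous_dx.mono (prod_mono_right h)
  continuous_dxx := hq.continuous_dxx.mono (prod_mono_right h)
  equation x t ht := by
    obtain ⟨qt, h1, h2⟩ := hq.equation x t (h ht)
    exact ⟨qt, h1.mono h, h2⟩

theorem continuous_slice (hq : IsPeriodicNLSSolution L S q) (ht : t ∈ S) :
    Continuous (slice q t) :=
  (hq.contDiff t ht).continuous

theorem slice_add (hq : IsPeriodicNLSSolution L S q) (ht : t ∈ S) (x : ℝ) :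
    slice q t (x + L) = slice q t x :=
  hq.periodic t ht x

theorem hasDerivAt (hq : IsPeriodicNLSSolution L S q) (ht : t ∈ S) (x : ℝ) :
    HasDerivAt (fun x => q x t) (deriv (fun x => q x t) x) x :=
  ((hq.contDiff t ht).differentiable (by norm_num) x).hasDerivAt

theorem contDiff_deriv (hq : IsPeriodicNLSSolution L S q) (ht : t ∈ S) :
    ContDiff ℝ 1 (deriv (fun x => q x t)) := by
  have : ContDiff ℝ (1 + 1) (fun x => q x t) := hq.contDiff t ht
  exact (contDiff_succ_iff_deriv.1 this).2.2

theorem hasDerivAt_deriv (hq : IsPeriodicNLSSolution L S q) (ht : t ∈ S) (x : ℝ) :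
    HasDerivAt (deriv (fun x => q x t)) (deriv (deriv (fun x => q x t)) x) x :=
  ((hq.contDiff_deriv ht).differentiable (by norm_num) x).hasDerivAt

theorem deriv_add (hq : IsPeriodicNLSSolution L S q) (ht : t ∈ S) (x : ℝ) :
    deriv (fun x => q x t) (x + L) = deriv (fun x => q x t) x := by
  rw [← deriv_comp_add_const]
  congr 1
  exact funext (hq.periodic t ht)

end IsPeriodicNLSSolution

/-- The time derivative of a solution of the equation, in terms of its derivatives in space. -/
def nlsRate (q : ℝ → ℝ → ℂ) (x t : ℝ) : ℂ :=
  Complex.I * deriv (deriv (fun y => q y t)) x - 2 * Complex.I * (q x t * star (q x t)) * q x t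

theorem mul_star_eq_norm_sq (w : ℂ) : w * star w = (‖w‖ : ℂ) ^ 2 := Complex.mul_conj' w

theorem IsPeriodicNLSSolution.hasDerivWithinAt (hq : IsPeriodicNLSSolution L S q) (ht : t ∈ S)
    (x : ℝ) : HasDerivWithinAt (fun τ => q x τ) (nlsRate q x t) S t := by
  obtain ⟨qt, h1, h2⟩ := hq.equation x t ht
  have : nlsRate q x t = qt := by
    rw [nlsRate, mul_star_eq_norm_sq]
    linear_combination Complex.I * h2 - qt * Complex.I_sq
  rwa [this]

theorem IsPeriodicNLSSolution.continuousOn_rate (hq : IsPeriodicNLSSolution L S q) :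
    ContinuousOn (fun y : ℝ × ℝ => nlsRate q y.1 y.2) (univ ×ˢ S) := by
  unfold nlsRate
  have h1 := hq.continuous
  exact (continuousOn_const.mul hq.continuous_dxx).sub
    ((continuousOn_const.mul (h1.mul h1.star)).mul h1)

theorem timeMatrix_eq (q : ℝ → ℝ → ℂ) (z : ℂ) (x t : ℝ) :
    timeMatrix q z x t =
      !![-(2 * Complex.I * z ^ 2) - Complex.I * (q x t * star (q x t)),
        2 * z * q x t + Complex.I * deriv (fun y => q y t) x;
        2 * z * star (q x t) - Complex.I * star (deriv (fun y => q y t) x),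
        2 * Complex.I * z ^ 2 + Complex.I * (q x t * star (q x t))] := by
  rw [timeMatrix, pauli3, potMatrix, potMatrix]
  ext i j
  fin_cases i <;> fin_cases j <;> simp
  ring

/-- The time evolution matrix of the modified system. -/
def modTime (q : ℝ → ℝ → ℂ) (z : ℂ) (x t : ℝ) : M2 := simMatrix * timeMatrix q z x t * simMatrix⁻¹

theorem modTime_eq (q : ℝ → ℝ → ℂ) (z : ℂ) (x t : ℝ) :
    modTime q z x t =
      !![2 * z * (q x t).re - (deriv (fun y => q y t) x).im,
        2 * z ^ 2 + 2 * z * (q x t).im + (‖q x t‖ : ℂ) ^ 2 + (deriv (fun y => q y t) x).re;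
        -(2 * z ^ 2) + 2 * z * (q x t).im - (‖q x t‖ : ℂ) ^ 2 + (deriv (fun y => q y t) x).re,
        -(2 * z * (q x t).re - (deriv (fun y => q y t) x).im)] := by
  rw [modTime, simMatrix_inv, timeMatrix_eq, simMatrix, mul_star_eq_norm_sq]
  have h1 : ∀ w : ℂ, star w = w.re - w.im * Complex.I := fun w => by
    apply Complex.ext <;> simp
  have h2 : ∀ w : ℂ, w = w.re + w.im * Complex.I := fun w => by
    apply Complex.ext <;> simp
  generalize (‖q x t‖ : ℂ) = n
  generalize q x t = w
  generalize deriv (fun y => q y t) x = w'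
  have hI := Complex.I_sq
  ext i j
  rw [h1 w, h1 w']
  nth_rewrite 1 [h2 w]
  nth_rewrite 1 [h2 w']
  generalize (w.re : ℂ) = a
  generalize (w.im : ℂ) = b
  generalize (w'.re : ℂ) = a'
  generalize (w'.im : ℂ) = b'
  fin_cases i <;> fin_cases j <;> simp [Matrix.mul_apply, Fin.sum_univ_two]
  · linear_combination b' * hI
  · linear_combination (-(2 * z ^ 2 + n ^ 2 + 2 * z * b + a')) * hI
  · linear_combination ((2 * z ^ 2 + n ^ 2 - 2 * z * b - a')) * hI
  · linear_combination (2 * z * a + b' * (Complex.I ^ 2 - 1)) * hI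

theorem potMatrix_sub (v w : ℂ) : potMatrix (v - w) = potMatrix v - potMatrix w := by
  ext i j
  fin_cases i <;> fin_cases j <;> simp [potMatrix]

theorem potMatrix_smul (c : ℝ) (w : ℂ) : potMatrix (c • w) = c • potMatrix w := by
  ext i j
  fin_cases i <;> fin_cases j <;> simp [potMatrix]

theorem norm_potMatrix (w : ℂ) : ‖potMatrix w‖ = ‖w‖ := by
  rw [Matrix.linfty_opNorm_def]
  simp [potMatrix, show (Finset.univ : Finset (Fin 2)) = {0, 1} from rfl]

theorem continuous_potMatrix : Continuous potMatrix := by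
  refine continuous_matrix fun i j => ?_
  unfold potMatrix
  fin_cases i <;> fin_cases j <;> simp <;> fun_prop

theorem zsMatrix_sub (p p' : ℝ → ℂ) (z : ℂ) (x : ℝ) :
    zsMatrix p z x - zsMatrix p' z x = potMatrix (p x - p' x) := by
  rw [potMatrix_sub, zsMatrix, zsMatrix]; abel

/-- The derivative of the time evolution matrix in `x`, by the zero curvature equation. -/
theorem IsPeriodicNLSSolution.hasDerivAt_timeMatrix (hq : IsPeriodicNLSSolution L S q)
    (ht : t ∈ S) (z : ℂ) (x : ℝ) :
    HasDerivAt (fun x => timeMatrix q z x t)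
      (potMatrix (nlsRate q x t) + zsMatrix (slice q t) z x * timeMatrix q z x t -
        timeMatrix q z x t * zsMatrix (slice q t) z x) x := by
  have h0 := hq.hasDerivAt ht x
  have h1 := hq.hasDerivAt_deriv ht x
  refine hasDerivAt_matrix.2 fun i j => ?_
  simp only [timeMatrix_eq, zsMatrix_eq, potMatrix, nlsRate, slice]
  have hI := Complex.I_sq
  have hm := (h0.mul h0.star).const_mul Complex.I
  fin_cases i <;> fin_cases j
  · refine (hm.const_sub (-(2 * Complex.I * z ^ 2))).congr_deriv ?_
    simp
    ring
  · refine ((h0.const_mul (2 * z)).add (h1.const_mul Complex.I)).congr_deriv ?_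
    simp
    linear_combination (2 * z * deriv (fun y => q y t) x) * hI
  · refine ((h0.star.const_mul (2 * z)).sub (h1.star.const_mul Complex.I)).congr_deriv ?_
    simp
    linear_combination (2 * z * (starRingEnd ℂ) (deriv (fun y => q y t) x)) * hI
  · refine (hm.const_add (2 * Complex.I * z ^ 2)).congr_deriv ?_
    simp
    ring

theorem IsPeriodicNLSSolution.continuous_rate (hq : IsPeriodicNLSSolution L S q) (ht : t ∈ S) :
    Continuous fun x => nlsRate q x t := by
  have h1 : ContinuousOn (fun x : ℝ => nlsRate q x t) univ :=
    hq.continuousOn_rate.comp (f := fun x : ℝ => (x, t)) (by fun_prop)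
      fun x _ => ⟨mem_univ _, ht⟩
  exact continuousOn_univ.1 h1

/-- The evolution of the monodromy matrix in time. -/
theorem IsPeriodicNLSSolution.hasDerivWithinAt_principal (hq : IsPeriodicNLSSolution L S q)
    (hS : S.OrdConnected) (hSc : IsCompact S) (hL : 0 ≤ L) (ht : t ∈ S) (z : ℂ) :
    HasDerivWithinAt (fun τ => principalSolution (slice q τ) z L)
      (timeMatrix q z 0 t * principalSolution (slice q t) z L -
        principalSolution (slice q t) z L * timeMatrix q z 0 t) S t := by
  set Y : ℝ → ℝ → M2 := fun τ => principalSolution (slice q τ) z with hY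
  have hF : ∀ τ ∈ S, IsFund (zsMatrix (slice q τ) z) (Y τ) := fun τ hτ =>
    zsFund (hq.continuous_slice hτ) z
  have hA : ∀ τ ∈ S, Continuous (zsMatrix (slice q τ) z) := fun τ hτ =>
    continuous_zsMatrix (hq.continuous_slice hτ)
  obtain ⟨C, hC⟩ := ((isCompact_Icc (a := 0) (b := L)).prod hSc).exists_bound_of_continuousOn
    (hq.continuousOn_rate.mono (prod_mono_left (subset_univ _)))
  have key : Tendsto (fun τ : ℝ => (τ - t)⁻¹ • (Y τ L - Y t L)) (𝓝[S \ {t}] t)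
      (𝓝 (Y t L * ∫ s in (0 : ℝ)..L,
        (Y t s).adjugate * potMatrix (nlsRate q s t) * Y t s)) := by
    have hmem : ∀ᶠ τ in 𝓝[S \ {t}] t, τ ∈ S \ {t} := self_mem_nhdsWithin
    refine IsFundPair.tendsto_quotient (hF t ht).pair
      (B := fun τ => zsMatrix (slice q τ) z) (W := Y) (W' := fun τ x => (Y τ x).adjugate)
      (hmem.mono fun τ hτ => (hF τ hτ.1).pair) (hA t ht) (hmem.mono fun τ hτ => hA τ hτ.1) hL
      (d := fun τ => τ - t) (C := C) (D := fun x => potMatrix (nlsRate q x t)) ?_ ?_ ?_ ?_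
    · refine tendsto_nhdsWithin_of_tendsto_nhds ?_
      have : Tendsto (fun w => w - t) (𝓝 t) (𝓝 (t - t)) :=
        (continuous_id.sub continuous_const).tendsto t
      rwa [sub_self] at this
    · exact hmem.mono fun τ hτ => sub_ne_zero.2 hτ.2
    · refine hmem.mono fun τ hτ x hx => ?_
      rw [zsMatrix_sub, norm_potMatrix]
      -- The mean value inequality in time supplies the Lipschitz bound required for dominated
      -- convergence.
      exact hS.convex.norm_image_sub_le_of_norm_hasDerivWithin_le
        (fun s hs => hq.hasDerivWithinAt hs x) (fun s hs => hC (x, s) ⟨hx, hs⟩) ht hτ.1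
    · intro x _
      have h1 := hasDerivWithinAt_iff_tendsto_slope.1 (hq.hasDerivWithinAt ht x)
      refine (continuous_potMatrix.tendsto _ |>.comp h1).congr fun τ => ?_
      rw [zsMatrix_sub, ← potMatrix_smul]
      rfl
  -- By the zero curvature equation the integrand is the `x`-derivative of `Y⁻¹ V Y`, where `V` is
  -- the time evolution matrix. Only the boundary terms remain, and periodicity of `q` and `q_x`
  -- identifies `V` at `x = L` with `V` at `x = 0`.
  have hint : ∫ s in (0 : ℝ)..L, (Y t s).adjugate * potMatrix (nlsRate q s t) * Y t s =
      (Y t L).adjugate * timeMatrix q z 0 t * Y t L - timeMatrix q z 0 t := by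
    have hd : ∀ s, HasDerivAt (fun s => (Y t s).adjugate * timeMatrix q z s t * Y t s)
        ((Y t s).adjugate * potMatrix (nlsRate q s t) * Y t s) s := fun s =>
      (((hF t ht).pair.deriv_inv s).mul (hq.hasDerivAt_timeMatrix ht z s)
        |>.mul ((hF t ht).deriv s)).congr_deriv (by simp only [Pi.mul_apply]; noncomm_ring)
    have hcont : Continuous fun s => (Y t s).adjugate * potMatrix (nlsRate q s t) * Y t s :=
      ((hF t ht).pair.continuous_inv.mul (continuous_potMatrix.comp (hq.continuous_rate ht))).mul
        (hF t ht).continuous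
    rw [intervalIntegral.integral_eq_sub_of_hasDerivAt (fun s _ => hd s)
      (hcont.intervalIntegrable _ _), (hF t ht).zero]
    have : timeMatrix q z L t = timeMatrix q z 0 t := by
      have h1 := hq.periodic t ht 0
      have h2 := hq.deriv_add ht 0
      rw [zero_add] at h1 h2
      rw [timeMatrix_eq, timeMatrix_eq, h1, h2]
    simp [this]
  refine hasDerivWithinAt_iff_tendsto_slope.2 ?_
  rw [hint, mul_sub, ← mul_assoc, ← mul_assoc, (hF t ht).mul_adjugate, one_mul] at key
  exact key

theorem IsPeriodicNLSSolution.hasDerivWithinAt_modMonodromy (hq : IsPeriodicNLSSolution L S q)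
    (hS : S.OrdConnected) (hSc : IsCompact S) (hL : 0 ≤ L) (ht : t ∈ S) (z : ℂ) :
    HasDerivWithinAt (fun τ => modMonodromy L (slice q τ) z)
      (modTime q z 0 t * modMonodromy L (slice q t) z -
        modMonodromy L (slice q t) z * modTime q z 0 t) S t := by
  have := ((hq.hasDerivWithinAt_principal hS hSc hL ht z).const_mul simMatrix).mul_const simMatrix⁻¹
  refine this.congr_deriv ?_
  rw [modTime, modMonodromy, simMatrix_conj_mul, simMatrix_conj_mul]
  noncomm_ring

/-! ### The transport in time -/

/-- The point of the interval between `0` and `t` that is closest to `τ`. -/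
def clampTime (t τ : ℝ) : ℝ := projIcc (min 0 t) (max 0 t) min_le_max τ

theorem clampTime_mem (t τ : ℝ) : clampTime t τ ∈ uIcc 0 t := (projIcc _ _ _ τ).2

theorem clampTime_of_mem (h : τ ∈ uIcc 0 t) : clampTime t τ = τ := by
  rw [clampTime, projIcc_of_mem _ h]

theorem continuous_clampTime (t : ℝ) : Continuous (clampTime t) :=
  continuous_subtype_val.comp continuous_projIcc

/-- The coefficient matrix of the time evolution at `x = 0`. -/
def timeCoeff (q : ℝ → ℝ → ℂ) (t : ℝ) (z : ℂ) (τ : ℝ) : M2 := modTime q z 0 (clampTime t τ)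

/-- The fundamental matrix of the time evolution at `x = 0`. -/
def transport (q : ℝ → ℝ → ℂ) (t : ℝ) (z : ℂ) : ℝ → M2 :=
  Classical.epsilon (IsFund (timeCoeff q t z))

theorem timeCoeff_eq_add (q : ℝ → ℝ → ℂ) (t : ℝ) (z : ℂ) (τ : ℝ) :
    timeCoeff q t z τ = timeCoeff q t 0 τ +
      z • ((2 : ℂ) • (!![((q 0 (clampTime t τ)).re : ℂ), (q 0 (clampTime t τ)).im;
        (q 0 (clampTime t τ)).im, -((q 0 (clampTime t τ)).re : ℂ)] : M2)) +
      z ^ 2 • (!![0, 2; -2, 0] : M2) := by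
  rw [timeCoeff, timeCoeff, modTime_eq, modTime_eq]
  ext i j
  fin_cases i <;> fin_cases j <;> simp <;> ring

/-- The data are continuous only for times between `0` and `t`. Freezing them beyond the ends
extends them continuously to the whole line, where global existence for linear systems applies;
inside the interval nothing changes. -/
theorem IsPeriodicNLSSolution.continuous_clamp (hq : IsPeriodicNLSSolution L (uIcc 0 t) q) :
    Continuous fun τ => q 0 (clampTime t τ) := by
  refine continuousOn_univ.1 (hq.continuous.comp (f := fun τ => ((0 : ℝ), clampTime t τ)) ?_
    fun τ _ => ⟨mem_univ _, clampTime_mem t τ⟩)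
  exact (continuous_const.prodMk (continuous_clampTime t)).continuousOn

theorem IsPeriodicNLSSolution.continuous_clamp_deriv (hq : IsPeriodicNLSSolution L (uIcc 0 t) q) :
    Continuous fun τ => deriv (fun x => q x (clampTime t τ)) 0 := by
  refine continuousOn_univ.1 (hq.continuous_dx.comp (f := fun τ => ((0 : ℝ), clampTime t τ)) ?_
    fun τ _ => ⟨mem_univ _, clampTime_mem t τ⟩)
  exact (continuous_const.prodMk (continuous_clampTime t)).continuousOn

theorem IsPeriodicNLSSolution.continuous_timeCoeff (hq : IsPeriodicNLSSolution L (uIcc 0 t) q)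
    (z : ℂ) : Continuous (timeCoeff q t z) := by
  have h1 := hq.continuous_clamp
  have h2 := hq.continuous_clamp_deriv
  refine continuous_matrix fun i j => ?_
  obtain ⟨g, hg⟩ : ∃ g : ℝ → ℂ, ∀ τ, deriv (fun x => q x (clampTime t τ)) 0 = g τ :=
    ⟨_, fun _ => rfl⟩
  obtain ⟨f, hf⟩ : ∃ f : ℝ → ℂ, ∀ τ, q 0 (clampTime t τ) = f τ := ⟨_, fun _ => rfl⟩
  simp_rw [timeCoeff, modTime_eq, hg, hf]
  simp_rw [hg] at h2
  simp_rw [hf] at h1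
  fin_cases i <;> fin_cases j <;> simp <;> fun_prop

theorem IsPeriodicNLSSolution.isFund_transport (hq : IsPeriodicNLSSolution L (uIcc 0 t) q)
    (z : ℂ) : IsFund (timeCoeff q t z) (transport q t z) := by
  refine Classical.epsilon_spec (p := IsFund (timeCoeff q t z))
    (IsFund.exists_of_continuous (hq.continuous_timeCoeff z) fun τ => ?_)
  simp [timeCoeff, modTime_eq, Matrix.trace_fin_two]

theorem IsPeriodicNLSSolution.differentiable_transport (hq : IsPeriodicNLSSolution L (uIcc 0 t) q)
    (τ : ℝ) (i j : Fin 2) : Differentiable ℂ (fun z => transport q t z τ i j) := by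
  have h1 := hq.continuous_clamp
  refine differentiable_entry (IsFund.differentiable_param (fun z => hq.isFund_transport z)
    (timeCoeff_eq_add q t) (hq.continuous_timeCoeff 0) ?_ continuous_const τ) i j
  have h2 : Continuous fun τ => (!![((q 0 (clampTime t τ)).re : ℂ), (q 0 (clampTime t τ)).im;
      (q 0 (clampTime t τ)).im, -((q 0 (clampTime t τ)).re : ℂ)] : M2) := ?_
  · exact h2.const_smul (2 : ℂ)
  obtain ⟨f, hf⟩ : ∃ f : ℝ → ℂ, ∀ τ, q 0 (clampTime t τ) = f τ := ⟨_, fun _ => rfl⟩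
  simp_rw [hf] at h1 ⊢
  refine continuous_matrix fun i j => ?_
  fin_cases i <;> fin_cases j <;> simp <;> fun_prop

theorem IsPeriodicNLSSolution.transport_conj (hq : IsPeriodicNLSSolution L (uIcc 0 t) q)
    (z : ℂ) (τ : ℝ) (i j : Fin 2) :
    transport q t (starRingEnd ℂ z) τ i j = starRingEnd ℂ (transport q t z τ i j) := by
  have h : IsFund (timeCoeff q t (starRingEnd ℂ z))
      (fun x => Matrix.of fun i j => starRingEnd ℂ (transport q t z x i j)) := by
    refine ⟨(hq.isFund_transport _).traceless, ?_, fun x => hasDerivAt_matrix.2 fun i j => ?_⟩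
    · ext i j
      rw [Matrix.of_apply, (hq.isFund_transport z).zero]
      fin_cases i <;> fin_cases j <;> simp
    · have h1 := (hasDerivAt_matrix.1 ((hq.isFund_transport z).deriv x) i j).star
      refine h1.congr_deriv ?_
      simp only [Matrix.mul_apply, Fin.sum_univ_two, timeCoeff, modTime_eq, Matrix.of_apply]
      fin_cases i <;> simp
  have := congrFun ((hq.isFund_transport _).unique h) τ
  rw [← this]
  rfl

/-- The monodromy matrices at different times are conjugate. -/
theorem IsPeriodicNLSSolution.modMonodromy_mul_transport
    (hq : IsPeriodicNLSSolution L (uIcc 0 t) q) (hL : 0 ≤ L) (hτ : τ ∈ uIcc 0 t) (z : ℂ) :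
    modMonodromy L (slice q τ) z * transport q t z τ =
      transport q t z τ * modMonodromy L (slice q 0) z := by
  have hT := hq.isFund_transport z
  -- The conjugate `T⁻¹ M T` is constant: the derivatives of `T⁻¹` and `T` cancel the commutator in
  -- the evolution of `M`.
  have hd : ∀ s ∈ uIcc 0 t, HasDerivWithinAt (fun s => (transport q t z s).adjugate *
      modMonodromy L (slice q s) z * transport q t z s) 0 (uIcc 0 t) s := by
    intro s hs
    refine ((((hT.pair.deriv_inv s).hasDerivWithinAt).mul
      (hq.hasDerivWithinAt_modMonodromy ordConnected_uIcc isCompact_uIcc hL hs z)).mul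
      (hT.deriv s).hasDerivWithinAt).congr_deriv ?_
    have : timeCoeff q t z s = modTime q z 0 s := by rw [timeCoeff, clampTime_of_mem hs]
    rw [this]
    simp only [Pi.mul_apply]
    noncomm_ring
  have hconst := (convex_uIcc 0 t).norm_image_sub_le_of_norm_hasDerivWithin_le (C := 0) hd
    (fun s _ => by simp) (left_mem_uIcc) hτ
  rw [zero_mul, norm_le_zero_iff, sub_eq_zero, hT.zero] at hconst
  have h2 : (transport q t z τ).adjugate * modMonodromy L (slice q τ) z * transport q t z τ =
      modMonodromy L (slice q 0) z := by
    rw [hconst]; simp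
  rw [← h2, ← mul_assoc, ← mul_assoc, hT.mul_adjugate, one_mul]

theorem IsPeriodicNLSSolution.discriminant_eq_zero (hq : IsPeriodicNLSSolution L (uIcc 0 t) q)
    (hL : 0 ≤ L) (hτ : τ ∈ uIcc 0 t) (z : ℂ) :
    discriminant L (slice q τ) z = discriminant L (slice q 0) z := by
  have h := hq.modMonodromy_mul_transport hL hτ z
  have h2 : modMonodromy L (slice q τ) z = transport q t z τ * modMonodromy L (slice q 0) z *
      (transport q t z τ).adjugate := by
    rw [← h, mul_assoc, (hq.isFund_transport z).mul_adjugate, mul_one]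
  rw [discriminant_eq, discriminant_eq, ← Matrix.trace_fin_two, ← Matrix.trace_fin_two, h2,
    Matrix.trace_mul_comm, ← mul_assoc, (hq.isFund_transport z).adjugate_mul, one_mul]

theorem IsPeriodicNLSSolution.laxSpectrum_eq (hq : IsPeriodicNLSSolution L (uIcc 0 t) q)
    (hL : 0 < L) (hτ : τ ∈ uIcc 0 t) : laxSpectrum (slice q τ) = spec q := by
  ext z
  rw [spec, mem_laxSpectrum_iff_discriminant (hq.continuous_slice hτ) (hq.slice_add hτ) hL,
    mem_laxSpectrum_iff_discriminant (hq.continuous_slice left_mem_uIcc)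
      (hq.slice_add left_mem_uIcc) hL, hq.discriminant_eq_zero hL.le hτ]

theorem IsPeriodicNLSSolution.floquetMultiplier_eq (hq : IsPeriodicNLSSolution L (uIcc 0 t) q)
    (hL : 0 ≤ L) (hτ : τ ∈ uIcc 0 t) (z : ℂ) :
    floquetMultiplier L (slice q τ) z = floquetMultiplier L (slice q 0) z := by
  unfold floquetMultiplier
  rw [hq.discriminant_eq_zero hL hτ]

end

section

open scoped Matrix.Norms.Operator

/-! ### Bloch-Floquet solutions and the time factor -/

variable {q : ℝ → ℝ → ℂ} {p : ℝ → ℂ} {z : ℂ} {L : ℝ} {S : Set ℝ} {t τ x : ℝ} {ε : ℤˣ}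

/-- The Floquet multiplier of `ψ^ε`. -/
def multiplier (L : ℝ) (p : ℝ → ℂ) (ε : ℤˣ) (z : ℂ) : ℂ := floquetMultiplier L p z ^ (ε : ℤ)

theorem multiplier_one : multiplier L p 1 z = floquetMultiplier L p z := by simp [multiplier]

theorem multiplier_neg (ε : ℤˣ) : multiplier L p (-ε) z = (multiplier L p ε z)⁻¹ := by
  simp [multiplier]

theorem floquetMultiplier_ne_zero (hp : Continuous p) (hper : ∀ x, p (x + L) = p x) (hL : 0 < L)
    (hz : z ∉ laxSpectrum p) : floquetMultiplier L p z ≠ 0 := by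
  intro h
  have := (floquetMultiplier_spec hp hper hL hz).1
  simp [h] at this

theorem multiplier_spec (hp : Continuous p) (hper : ∀ x, p (x + L) = p x) (hL : 0 < L)
    (hz : z ∉ laxSpectrum p) (ε : ℤˣ) :
    multiplier L p ε z ^ 2 - 2 * discriminant L p z * multiplier L p ε z + 1 = 0 := by
  have h0 := floquetMultiplier_ne_zero hp hper hL hz
  have h1 := (floquetMultiplier_spec hp hper hL hz).1
  rcases Int.units_eq_one_or ε with rfl | rfl
  · rwa [multiplier_one]
  · rw [multiplier_neg, multiplier_one]
    field_simp
    linear_combination h1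

theorem multiplier_ne_zero (hp : Continuous p) (hper : ∀ x, p (x + L) = p x) (hL : 0 < L)
    (hz : z ∉ laxSpectrum p) (ε : ℤˣ) : multiplier L p ε z ≠ 0 :=
  zpow_ne_zero _ (floquetMultiplier_ne_zero hp hper hL hz)

theorem norm_multiplier_one_lt (hp : Continuous p) (hper : ∀ x, p (x + L) = p x) (hL : 0 < L)
    (hz : z ∉ laxSpectrum p) : ‖multiplier L p 1 z‖ < 1 := by
  rw [multiplier_one]
  exact (floquetMultiplier_spec hp hper hL hz).2

theorem one_lt_norm_multiplier (hp : Continuous p) (hper : ∀ x, p (x + L) = p x) (hL : 0 < L)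
    (hz : z ∉ laxSpectrum p) : 1 < ‖multiplier L p (-1) z‖ := by
  rw [multiplier_neg, multiplier_one, norm_inv]
  exact one_lt_inv₀ (norm_pos_iff.2 (floquetMultiplier_ne_zero hp hper hL hz)) |>.2
    (floquetMultiplier_spec hp hper hL hz).2

theorem norm_multiplier_ne_one (hp : Continuous p) (hper : ∀ x, p (x + L) = p x) (hL : 0 < L)
    (hz : z ∉ laxSpectrum p) (ε : ℤˣ) : ‖multiplier L p ε z‖ ≠ 1 := by
  rcases Int.units_eq_one_or ε with rfl | rfl
  · exact (norm_multiplier_one_lt hp hper hL hz).ne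
  · exact (one_lt_norm_multiplier hp hper hL hz).ne'

/-- The value at `0` of the Bloch-Floquet solution with multiplier `μ`. -/
def blochVec (M : M2) (μ : ℂ) : Fin 2 → ℂ := ![1, (μ - M 0 0) / M 0 1]

theorem mulVec_blochVec {M : M2} (hM : M 0 0 * M 1 1 - M 0 1 * M 1 0 = 1) {μ : ℂ}
    (hμ : μ ^ 2 - (M 0 0 + M 1 1) * μ + 1 = 0) (h : M 0 1 ≠ 0) :
    M.mulVec (blochVec M μ) = μ • blochVec M μ := by
  ext i
  fin_cases i <;> simp [blochVec, Matrix.mulVec, dotProduct]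
  · field_simp; ring
  · field_simp; linear_combination -hM - hμ

theorem multiplier_quadratic (hp : Continuous p) (hper : ∀ x, p (x + L) = p x) (hL : 0 < L)
    (hz : z ∉ laxSpectrum p) (ε : ℤˣ) : multiplier L p ε z ^ 2 -
      (modMonodromy L p z 0 0 + modMonodromy L p z 1 1) * multiplier L p ε z + 1 = 0 := by
  have := multiplier_spec hp hper hL hz ε
  rw [discriminant_eq] at this
  linear_combination this

/-- If `M₀₁ ≠ 0`, an eigenvector has a nonzero first component, so the normalization is possible,
and the first row of the eigenvector equation then fixes the second component. Thus the value at `0`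
does not depend on the choice made in the definition of `ψ^ε`. -/
theorem blochFloquet_zero (hp : Continuous p) (hper : ∀ x, p (x + L) = p x) (hL : 0 < L)
    (hz : z ∉ laxSpectrum p) (h : modMonodromy L p z 0 1 ≠ 0) :
    blochFloquet L p ε z 0 = blochVec (modMonodromy L p z) (multiplier L p ε z) := by
  set M := modMonodromy L p z with hM
  set μ := multiplier L p ε z with hμ
  have hMc : M.mulVec (blochVec M μ) = μ • blochVec M μ :=
    mulVec_blochVec (det_modMonodromy hp) (multiplier_quadratic hp hper hL hz ε) h
  have hex : ∃ v, IsBlochFloquet L p ε z v := by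
    refine ⟨fun x => (modSol p z x).mulVec (blochVec M μ), (modFund hp z).hasDerivAt_mulVec _,
      fun x => ?_, ?_⟩
    · beta_reduce
      rw [modSol_add hp hper, ← Matrix.mulVec_mulVec, ← hM, hMc, Matrix.mulVec_smul]
      rfl
    · beta_reduce
      rw [(modFund hp z).zero, Matrix.one_mulVec]
      rfl
  obtain ⟨h1, h2, h3⟩ := Classical.epsilon_spec (p := IsBlochFloquet L p ε z) hex
  change IsModZSSolution p z (blochFloquet L p ε z) at h1
  change ∀ x, blochFloquet L p ε z (x + L) = _ • blochFloquet L p ε z x at h2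
  change blochFloquet L p ε z 0 0 = 1 at h3
  have h4 := h2 0
  rw [zero_add, (modFund hp z).eq_mulVec h1 L] at h4
  have h5 := congrFun h4 0
  simp only [Matrix.mulVec, dotProduct, Fin.sum_univ_two, h3, Pi.smul_apply, smul_eq_mul,
    mul_one] at h5
  change M 0 0 + M 0 1 * _ = μ at h5
  ext i
  fin_cases i
  · simp [h3, blochVec]
  · simp only [blochVec, Fin.mk_one, Matrix.cons_val_one, Matrix.cons_val_fin_one]
    field_simp
    linear_combination h5

theorem constant_of_hasDerivWithinAt_zero {E : Type*} [NormedAddCommGroup E] [NormedSpace ℝ E]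
    {f : ℝ → E} (h : ∀ s ∈ uIcc 0 t, HasDerivWithinAt f 0 (uIcc 0 t) s) : f t = f 0 := by
  have := (convex_uIcc 0 t).norm_image_sub_le_of_norm_hasDerivWithin_le (C := 0) h
    (fun s _ => by simp) left_mem_uIcc right_mem_uIcc
  rwa [zero_mul, norm_le_zero_iff, sub_eq_zero] at this

theorem eq_mul_exp_integral {u a : ℝ → ℂ} (ha : ContinuousOn a (uIcc 0 t))
    (hu : ∀ τ ∈ uIcc 0 t, HasDerivAt u (a τ * u τ) τ) :
    u t = u 0 * Complex.exp (∫ τ in (0 : ℝ)..t, a τ) := by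
  have hc : Continuous fun τ => a (clampTime t τ) :=
    continuousOn_univ.1 (ha.comp (continuous_clampTime t).continuousOn
      fun τ _ => clampTime_mem t τ)
  have hint : ∫ τ in (0 : ℝ)..t, a τ = ∫ τ in (0 : ℝ)..t, a (clampTime t τ) :=
    intervalIntegral.integral_congr fun τ hτ => by simp only [clampTime_of_mem hτ]
  have hI : ∀ s, HasDerivAt (fun s => ∫ τ in (0 : ℝ)..s, a (clampTime t τ)) (a (clampTime t s)) s :=
    fun s => intervalIntegral.integral_hasDerivAt_right (hc.intervalIntegrable _ _)
      (hc.stronglyMeasurableAtFilter _ _) hc.continuousAt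
  have := constant_of_hasDerivWithinAt_zero (t := t)
    (f := fun s => u s * Complex.exp (-∫ τ in (0 : ℝ)..s, a (clampTime t τ))) fun s hs => by
      refine ((hu s hs).mul (hI s).neg.cexp).hasDerivWithinAt.congr_deriv ?_
      rw [clampTime_of_mem hs]
      ring
  simp only [intervalIntegral.integral_same, neg_zero, Complex.exp_zero, mul_one] at this
  rw [hint, ← this, mul_assoc, ← Complex.exp_add, neg_add_cancel, Complex.exp_zero, mul_one]

/-- The meromorphic continuation of the time factor, as a function on the complement of the
spectrum. -/
def preFactor (L : ℝ) (q : ℝ → ℝ → ℂ) (ε : ℤˣ) (t : ℝ) (z : ℂ) : ℂ :=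
  transport q t z t 0 0 + transport q t z t 0 1 *
    ((multiplier L (slice q 0) ε z - modMonodromy L (slice q 0) z 0 0) /
      modMonodromy L (slice q 0) z 0 1)

theorem IsPeriodicNLSSolution.mulVec_transport
    (hq : IsPeriodicNLSSolution L (uIcc 0 t) q) (hL : 0 ≤ L) (hτ : τ ∈ uIcc 0 t)
    {c : Fin 2 → ℂ} {μ : ℂ} (h : (modMonodromy L (slice q 0) z).mulVec c = μ • c) :
    (modMonodromy L (slice q τ) z).mulVec ((transport q t z τ).mulVec c) =
      μ • (transport q t z τ).mulVec c := by
  rw [Matrix.mulVec_mulVec, hq.modMonodromy_mul_transport hL hτ, ← Matrix.mulVec_mulVec, h,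
    Matrix.mulVec_smul]

theorem IsPeriodicNLSSolution.transport_mulVec_ne_zero
    (hq : IsPeriodicNLSSolution L (uIcc 0 t) q) {c : Fin 2 → ℂ} (hc : c ≠ 0) :
    (transport q t z τ).mulVec c ≠ 0 := by
  intro h
  apply hc
  have h2 := congrArg ((transport q t z τ).adjugate.mulVec) h
  rwa [Matrix.mulVec_mulVec, (hq.isFund_transport z).adjugate_mul, Matrix.one_mulVec,
    Matrix.mulVec_zero] at h2

theorem blochVec_ne_zero (M : M2) (μ : ℂ) : blochVec M μ ≠ 0 := fun h => by
  simpa [blochVec] using congrFun h 0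

theorem first_ne_zero {M : M2} (h : M 0 1 ≠ 0) {c : Fin 2 → ℂ} {μ : ℂ}
    (hc : M.mulVec c = μ • c) (hc0 : c ≠ 0) : c 0 ≠ 0 := by
  intro h0
  have := congrFun hc 0
  simp only [Matrix.mulVec, dotProduct, Fin.sum_univ_two, h0, Pi.smul_apply, smul_eq_mul,
    mul_zero, zero_add, mul_eq_zero, h, false_or] at this
  apply hc0
  ext i
  fin_cases i
  · exact h0
  · exact this

theorem eq_smul_blochVec {M : M2} (h : M 0 1 ≠ 0) {c : Fin 2 → ℂ} {μ : ℂ}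
    (hc : M.mulVec c = μ • c) : c = c 0 • blochVec M μ := by
  have := congrFun hc 0
  simp only [Matrix.mulVec, dotProduct, Fin.sum_univ_two, Pi.smul_apply, smul_eq_mul] at this
  ext i
  fin_cases i
  · simp [blochVec]
  · simp [blochVec]
    field_simp
    linear_combination this

theorem preFactor_eq :
    preFactor L q ε t z = (transport q t z t).mulVec
      (blochVec (modMonodromy L (slice q 0) z) (multiplier L (slice q 0) ε z)) 0 := by
  simp [preFactor, blochVec, Matrix.mulVec, dotProduct]

/-- Transport carries the eigenvector at time `0` to an eigenvector of the monodromy matrix at time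
`τ` with the same multiplier, that is, to `u₀(τ) ψ^ε(0, τ, z)`. Hence the first component `u₀`
satisfies `u₀' = α u₀` with `u₀(0) = 1`. Absence of Dirichlet eigenvalues at all intermediate times
keeps `u₀` away from zero and makes `α` continuous. -/
theorem IsPeriodicNLSSolution.timeFactor_eq (hq : IsPeriodicNLSSolution L (uIcc 0 t) q)
    (hL : 0 < L) (hz : z ∉ spec q)
    (h : ∀ τ ∈ uIcc 0 t, modMonodromy L (slice q τ) z 0 1 ≠ 0) :
    timeFactor L q ε t z = preFactor L q ε t z := by
  set μ := multiplier L (slice q 0) ε z with hμ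
  set c := blochVec (modMonodromy L (slice q 0) z) μ with hc
  set u : ℝ → Fin 2 → ℂ := fun τ => (transport q t z τ).mulVec c with hu
  have hμτ : ∀ τ ∈ uIcc 0 t, multiplier L (slice q τ) ε z = μ := fun τ hτ => by
    rw [multiplier, hq.floquetMultiplier_eq hL.le hτ, hμ, multiplier]
  have hzτ : ∀ τ ∈ uIcc 0 t, z ∉ laxSpectrum (slice q τ) := fun τ hτ => by
    rwa [hq.laxSpectrum_eq hL hτ]
  have h0 : (0 : ℝ) ∈ uIcc 0 t := left_mem_uIcc
  have heig : ∀ τ ∈ uIcc 0 t, (modMonodromy L (slice q τ) z).mulVec (u τ) = μ • u τ := fun τ hτ =>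
    hq.mulVec_transport hL.le hτ (mulVec_blochVec (det_modMonodromy (hq.continuous_slice h0))
      (multiplier_quadratic (hq.continuous_slice h0) (hq.slice_add h0) hL (hzτ 0 h0) ε) (h 0 h0))
  have hne : ∀ τ ∈ uIcc 0 t, u τ 0 ≠ 0 := fun τ hτ => first_ne_zero (h τ hτ) (heig τ hτ)
    (hq.transport_mulVec_ne_zero (blochVec_ne_zero _ _))
  have hder : ∀ τ, HasDerivAt u ((timeCoeff q t z τ).mulVec (u τ)) τ :=
    (hq.isFund_transport z).hasDerivAt_mulVec c
  have hα : ∀ τ ∈ uIcc 0 t,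
      alpha L q ε τ z = (timeCoeff q t z τ).mulVec (u τ) 0 / u τ 0 := by
    intro τ hτ
    rw [alpha, blochFloquet_zero (hq.continuous_slice hτ) (hq.slice_add hτ) hL (hzτ τ hτ) (h τ hτ),
      hμτ τ hτ, eq_div_iff (hne τ hτ), timeCoeff, clampTime_of_mem hτ]
    conv_rhs => rw [eq_smul_blochVec (h τ hτ) (heig τ hτ), Matrix.mulVec_smul]
    rw [Pi.smul_apply, smul_eq_mul, mul_comm]
    rfl
  have hcu : Continuous u := continuous_iff_continuousAt.2 fun τ => (hder τ).continuousAt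
  have hcu0 : Continuous fun τ => u τ 0 := (continuous_apply 0).comp hcu
  have hcV : Continuous fun τ => (timeCoeff q t z τ).mulVec (u τ) 0 :=
    (continuous_apply 0).comp ((hq.continuous_timeCoeff z).matrix_mulVec hcu)
  have hcont : ContinuousOn (fun τ => alpha L q ε τ z) (uIcc 0 t) :=
    (hcV.continuousOn.div hcu0.continuousOn hne).congr hα
  have := eq_mul_exp_integral (u := fun τ => u τ 0) hcont fun τ hτ => by
    refine (hasDerivAt_pi.1 (hder τ) 0).congr_deriv ?_
    rw [hα τ hτ, div_mul_cancel₀ _ (hne τ hτ)]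
  have hu0 : u 0 0 = 1 := by
    simp only [hu, (hq.isFund_transport z).zero, Matrix.one_mulVec]
    rfl
  rw [timeFactor, preFactor_eq]
  rw [hu0, one_mul] at this
  exact this.symm

/-- Monodromy and transport commute with conjugation, and conjugation preserves the unit disc, hence
the choice of `ρ`. This symmetry carries the asymptotics from one half plane to the other. -/
theorem IsPeriodicNLSSolution.preFactor_conj (hq : IsPeriodicNLSSolution L (uIcc 0 t) q)
    (hL : 0 < L) (hz : z ∉ spec q) :
    preFactor L q ε t (starRingEnd ℂ z) = starRingEnd ℂ (preFactor L q ε t z) := by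
  have h0 : (0 : ℝ) ∈ uIcc 0 t := left_mem_uIcc
  have hp := hq.continuous_slice h0
  have hper := hq.slice_add h0
  have hz' : starRingEnd ℂ z ∉ spec q := by
    intro h
    apply hz
    have := im_eq_zero_of_mem_laxSpectrum hp hper hL h
    rw [Complex.conj_im, neg_eq_zero, ← Complex.conj_eq_iff_im] at this
    rwa [this] at h
  have hρ : floquetMultiplier L (slice q 0) (starRingEnd ℂ z) =
      starRingEnd ℂ (floquetMultiplier L (slice q 0) z) := by
    obtain ⟨h1, h2⟩ := floquetMultiplier_spec hp hper hL hz
    refine (floquetMultiplier_unique hp hper hL hz' ?_ ?_).symm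
    · rw [discriminant_conj hp]
      have := congrArg (starRingEnd ℂ) h1
      simpa [Complex.conj_ofNat] using this
    · rwa [RCLike.norm_conj]
  simp [preFactor, multiplier, hq.transport_conj, modMonodromy_conj hp, hρ]

end

section

/-! ### Local complex analysis -/

theorem exists_analytic_factor {f : ℂ → ℂ} {c : ℂ} (hf : AnalyticAt ℂ f c) (h0 : f c = 0) :
    ∃ g, AnalyticAt ℂ g c ∧ g c = deriv f c ∧ ∀ z, f z = (z - c) * g z := by
  obtain ⟨p, hp⟩ := hf
  refine ⟨dslope f c, ⟨_, hp.has_fpower_series_dslope_fslope⟩, dslope_same f c, fun z => ?_⟩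
  have := sub_smul_dslope f c z
  rw [h0, sub_zero, smul_eq_mul] at this
  exact this.symm

/-- Division by `f c` brings the argument of the root close to `1`, where the principal branch is
analytic. -/
theorem exists_analytic_sqrt {f : ℂ → ℂ} {c : ℂ} (hf : AnalyticAt ℂ f c) (h0 : f c ≠ 0) :
    ∃ w, AnalyticAt ℂ w c ∧ ∀ z, w z ^ 2 = f z := by
  obtain ⟨a, ha⟩ := IsAlgClosed.exists_pow_nat_eq (f c) two_pos
  refine ⟨fun z => a * (f z / f c) ^ ((2 : ℕ) : ℂ)⁻¹, ?_, fun z => ?_⟩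
  · refine analyticAt_const.mul ((hf.div analyticAt_const h0).cpow analyticAt_const ?_)
    change f c / f c ∈ _
    rw [div_self h0]
    exact Complex.one_mem_slitPlane
  · rw [mul_pow, ha, Complex.cpow_nat_inv_pow _ two_ne_zero]
    field_simp

theorem exists_analytic_quotient {f g : ℂ → ℂ} {c : ℂ} (hf : AnalyticAt ℂ f c)
    (hg : AnalyticAt ℂ g c) (hf0 : f c = 0) (hg0 : g c = 0) (hg' : deriv g c ≠ 0) :
    ∃ k, AnalyticAt ℂ k c ∧ ∀ᶠ z in 𝓝[≠] c, f z / g z = k z := by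
  obtain ⟨F, hF, _, hfF⟩ := exists_analytic_factor hf hf0
  obtain ⟨G, hG, hG0, hgG⟩ := exists_analytic_factor hg hg0
  refine ⟨fun z => F z / G z, hF.div hG (by rwa [hG0]), ?_⟩
  filter_upwards [self_mem_nhdsWithin] with z hz
  rw [hfF, hgG, mul_div_mul_left _ _ (sub_ne_zero.2 hz)]

theorem tendsto_ofReal_right : Tendsto (fun x : ℝ => (x : ℂ)) (𝓝[>] 0) (𝓝[≠] 0) := by
  refine tendsto_nhdsWithin_iff.2 ⟨?_, ?_⟩
  · exact tendsto_nhdsWithin_of_tendsto_nhds (Complex.continuous_ofReal.tendsto 0)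
  · filter_upwards [self_mem_nhdsWithin] with x hx
    exact Complex.ofReal_ne_zero.2 (ne_of_gt hx)

theorem im_eq_zero_of_nhds_real {g : ℂ → ℂ} (hg : ContinuousAt g 0)
    (h : ∀ᶠ z in 𝓝[≠] (0 : ℂ), z.im = 0 → (g z).im = 0) : (g 0).im = 0 := by
  have h1 : Tendsto (fun x : ℝ => (g x).im) (𝓝[>] 0) (𝓝 (g 0).im) :=
    (Complex.continuous_im.tendsto _).comp
      (hg.tendsto.comp (tendsto_ofReal_right.mono_right nhdsWithin_le_nhds))
  have h2 : Tendsto (fun x : ℝ => (g x).im) (𝓝[>] 0) (𝓝 0) := by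
    refine tendsto_const_nhds.congr' ?_
    filter_upwards [tendsto_ofReal_right.eventually h] with x hx
    rw [hx (Complex.ofReal_im x)]
  exact tendsto_nhds_unique h1 h2

theorem cpow_im_eq_zero {w : ℂ} (hw : w.im = 0) (hw0 : 0 ≤ w.re) (n : ℕ) :
    (w ^ ((n : ℂ)⁻¹)).im = 0 := by
  have h1 : w = (w.re : ℂ) := Complex.ext rfl (by simpa using hw)
  rw [h1, show ((n : ℂ)⁻¹) = (((n : ℝ)⁻¹ : ℝ) : ℂ) by push_cast; rfl, ← Complex.ofReal_cpow hw0]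
  exact Complex.ofReal_im _

/-- A zero at `0` of a function that is real on the real line, positive on the right of `0`, and
does not take small negative values off the real line, is simple. -/
theorem exists_simple_factor {f : ℂ → ℂ} (hf : AnalyticAt ℂ f 0) (h0 : f 0 = 0)
    (hreal : ∀ᶠ z in 𝓝 (0 : ℂ), z.im = 0 → (f z).im = 0)
    (hpos : ∃ᶠ x : ℝ in 𝓝[>] 0, 0 < (f x).re)
    (hneg : ∀ᶠ z in 𝓝 (0 : ℂ), (f z).im = 0 → (f z).re ∈ Ioo (-1 : ℝ) 0 → z.im = 0) :
    ∃ g, AnalyticAt ℂ g 0 ∧ (g 0).im = 0 ∧ 0 < (g 0).re ∧ ∀ᶠ z in 𝓝 (0 : ℂ), f z = z * g z := by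
  have hne : ¬∀ᶠ z in 𝓝 (0 : ℂ), f z = 0 := by
    intro h
    have h1 : ∀ᶠ x : ℝ in 𝓝[>] 0, f x = 0 :=
      (tendsto_ofReal_right.mono_right nhdsWithin_le_nhds).eventually h
    obtain ⟨x, hx, hx'⟩ := (hpos.and_eventually h1).exists
    simp [hx'] at hx
  obtain ⟨n, g, hg, hg0, hfg⟩ := hf.exists_eventuallyEq_pow_smul_nonzero_iff.2 hne
  simp only [sub_zero, smul_eq_mul] at hfg
  have hn0 : n ≠ 0 := by
    rintro rfl
    have := hfg.self_of_nhds
    rw [h0] at this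
    simp at this
    exact hg0 this.symm
  have hgreal : ∀ᶠ z in 𝓝[≠] (0 : ℂ), z.im = 0 → (g z).im = 0 := by
    filter_upwards [nhdsWithin_le_nhds hfg, nhdsWithin_le_nhds hreal, self_mem_nhdsWithin]
      with z h1 h2 h3 hz
    have h4 : z = (z.re : ℂ) := Complex.ext rfl (by simpa using hz)
    have h5 : g z = f z / z ^ n := by rw [h1]; field_simp [pow_ne_zero n h3]
    have h6 : f z = ((f z).re : ℂ) := Complex.ext rfl (by simpa using h2 hz)
    rw [h5, h6, h4, ← Complex.ofReal_pow, ← Complex.ofReal_div]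
    exact Complex.ofReal_im _
  have hgim : (g 0).im = 0 := im_eq_zero_of_nhds_real hg.continuousAt hgreal
  have hgre : 0 < (g 0).re := by
    have hge : 0 ≤ (g 0).re := by
      have h1 : Tendsto (fun x : ℝ => (g x).re) (𝓝[>] 0) (𝓝 (g 0).re) :=
        (Complex.continuous_re.tendsto _).comp
          (hg.continuousAt.tendsto.comp (tendsto_ofReal_right.mono_right nhdsWithin_le_nhds))
      refine ge_of_tendsto_of_frequently h1 ?_
      have h2 := (tendsto_ofReal_right.mono_right nhdsWithin_le_nhds).eventually hfg
      refine (hpos.and_eventually (h2.and self_mem_nhdsWithin)).mono ?_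
      rintro x ⟨h3, h4, h5⟩
      rw [h4, ← Complex.ofReal_pow, Complex.re_ofReal_mul] at h3
      exact (pos_of_mul_pos_right h3 (pow_pos (show (0 : ℝ) < x from h5) n).le).le
    refine lt_of_le_of_ne hge fun h => hg0 (Complex.ext h.symm hgim)
  refine ⟨g, hg, hgim, hgre, ?_⟩
  -- If `n ≥ 2`, then `f = F ^ n` with the local biholomorphism `F = z g^{1/n}`. Along the ray of
  -- values of `F` with argument `π / n`, `f` is small and negative, so the corresponding `z` are
  -- real by `hneg`. But `F` is real on the real line, and the ray is not.
  have hn1 : n = 1 := by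
    by_contra hn1
    have hn2 : 2 ≤ n := by omega
    have hslit : g 0 ∈ Complex.slitPlane := Or.inl hgre
    set h : ℂ → ℂ := fun z => g z ^ ((n : ℂ)⁻¹) with hh
    have han : AnalyticAt ℂ h 0 := hg.cpow analyticAt_const hslit
    have hpow : ∀ z, h z ^ n = g z := fun z => Complex.cpow_nat_inv_pow _ hn0
    have hh0 : h 0 ≠ 0 := by
      intro h1
      have := hpow 0
      rw [h1, zero_pow hn0] at this
      exact hg0 this.symm
    set F : ℂ → ℂ := fun z => z * h z with hF
    have hF0 : F 0 = 0 := by simp [hF]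
    have hFan : AnalyticAt ℂ F 0 := analyticAt_id.mul han
    have hder : deriv F 0 = h 0 := by
      have : HasDerivAt F _ 0 := (hasDerivAt_id (0 : ℂ)).mul han.differentiableAt.hasDerivAt
      rw [this.deriv]
      simp
    have hmap := hFan.hasStrictDerivAt.map_nhds_eq (by rwa [hder])
    rw [hF0] at hmap
    have hgood : ∀ᶠ z in 𝓝 (0 : ℂ), f z = z ^ n * g z ∧
        ((f z).im = 0 → (f z).re ∈ Ioo (-1 : ℝ) 0 → z.im = 0) ∧ 0 < (g z).re ∧
        (z ≠ 0 → z.im = 0 → (g z).im = 0) := by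
      have h1 : ∀ᶠ z in 𝓝 (0 : ℂ), 0 < (g z).re :=
        (Complex.continuous_re.continuousAt.comp hg.continuousAt).eventually (lt_mem_nhds hgre)
      filter_upwards [hfg, hneg, h1, eventually_nhdsWithin_iff.1 hgreal] with z a b c d
      exact ⟨a, b, c, d⟩
    have himg : ∀ᶠ w in 𝓝 (0 : ℂ), ∃ z, F z = w ∧ (f z = z ^ n * g z ∧
        ((f z).im = 0 → (f z).re ∈ Ioo (-1 : ℝ) 0 → z.im = 0) ∧ 0 < (g z).re ∧
        (z ≠ 0 → z.im = 0 → (g z).im = 0)) := by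
      rw [← hmap, eventually_map]
      filter_upwards [hgood] with z hz using ⟨z, rfl, hz⟩
    set ω : ℂ := Complex.exp ((Real.pi / n : ℝ) * Complex.I) with hω
    have hωn : ω ^ n = -1 := by
      rw [hω, ← Complex.exp_nat_mul]
      have : (n : ℂ) * (((Real.pi / n : ℝ) : ℂ) * Complex.I) = Real.pi * Complex.I := by
        push_cast
        field_simp
      rw [this, Complex.exp_pi_mul_I]
    have hωim : 0 < ω.im := by
      rw [hω, Complex.exp_ofReal_mul_I_im]
      refine Real.sin_pos_of_pos_of_lt_pi (by positivity) ?_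
      have : (2 : ℝ) ≤ n := by exact_mod_cast hn2
      exact div_lt_self Real.pi_pos (by linarith)
    have hray : Tendsto (fun x : ℝ => (x : ℂ) * ω) (𝓝[>] 0) (𝓝 0) := by
      have := (tendsto_ofReal_right.mono_right nhdsWithin_le_nhds).mul_const ω
      rwa [zero_mul] at this
    have hsmall : ∀ᶠ x : ℝ in 𝓝[>] 0, x < 1 := nhdsWithin_le_nhds (gt_mem_nhds zero_lt_one)
    obtain ⟨x, ⟨z, hz, h1, h2, h3, h4⟩, hx1, hx0⟩ :=
      ((hray.eventually himg).and (hsmall.and self_mem_nhdsWithin)).exists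
    have hx0' : 0 < x := hx0
    have hfz : f z = ((-(x ^ n) : ℝ) : ℂ) := by
      rw [h1, ← hpow, ← mul_pow]
      change F z ^ n = _
      rw [hz, mul_pow, hωn]
      push_cast
      ring
    have hzim : z.im = 0 := by
      refine h2 (by rw [hfz]; exact Complex.ofReal_im _) ?_
      rw [hfz, Complex.ofReal_re]
      have : x ^ n < 1 := pow_lt_one₀ hx0'.le hx1 hn0
      exact ⟨by linarith, by linarith [pow_pos hx0' n]⟩
    have hz0 : z ≠ 0 := by
      rintro rfl
      rw [hF0] at hz
      have : (0 : ℂ).im = x * ω.im := by rw [hz]; simp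
      rw [Complex.zero_im] at this
      nlinarith [mul_pos hx0' hωim]
    have h5 : (F z).im = 0 := by
      have := cpow_im_eq_zero (h4 hz0 hzim) h3.le n
      rw [hF]
      simp only [Complex.mul_im, hzim, zero_mul, add_zero]
      rw [hh]
      simp only [this, mul_zero]
    rw [hz] at h5
    simp at h5
    rcases h5 with h5 | h5
    · exact hx0'.ne' h5
    · exact hωim.ne' h5
  filter_upwards [hfg] with z hz
  rw [hz, hn1, pow_one]

/-- A function that is real and nonpositive on the real line is minus a square. -/
theorem exists_neg_square {f : ℂ → ℂ} (hf : AnalyticAt ℂ f 0)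
    (hne : ¬∀ᶠ z in 𝓝 (0 : ℂ), f z = 0)
    (hreal : ∀ᶠ z in 𝓝 (0 : ℂ), z.im = 0 → (f z).im = 0 ∧ (f z).re ≤ 0) :
    ∃ w, AnalyticAt ℂ w 0 ∧ (∀ᶠ z in 𝓝 (0 : ℂ), f z = -w z ^ 2) ∧
      ∀ᶠ z in 𝓝 (0 : ℂ), z.im = 0 → (w z).im = 0 := by
  obtain ⟨n, g, hg, hg0, hfg⟩ := hf.exists_eventuallyEq_pow_smul_nonzero_iff.2 hne
  simp only [sub_zero, smul_eq_mul] at hfg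
  have hgz : ∀ᶠ z in 𝓝[≠] (0 : ℂ), z.im = 0 → (g z).im = 0 ∧ z.re ^ n * (g z).re ≤ 0 := by
    filter_upwards [nhdsWithin_le_nhds hfg, nhdsWithin_le_nhds hreal, self_mem_nhdsWithin]
      with z h1 h2 h3 hz
    have h4 : z = (z.re : ℂ) := Complex.ext rfl (by simpa using hz)
    have h5 : g z = f z / z ^ n := by rw [h1]; field_simp [pow_ne_zero n h3]
    have h6 : f z = ((f z).re : ℂ) := Complex.ext rfl (by simpa using (h2 hz).1)
    constructor
    · rw [h5, h6, h4, ← Complex.ofReal_pow, ← Complex.ofReal_div]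
      exact Complex.ofReal_im _
    · have h7 := (h2 hz).2
      have h8 : z ^ n = ((z.re ^ n : ℝ) : ℂ) := by
        rw [Complex.ofReal_pow, ← h4]
      rw [h1, h8, Complex.re_ofReal_mul] at h7
      exact h7
  have hgim : (g 0).im = 0 := im_eq_zero_of_nhds_real hg.continuousAt (hgz.mono fun z h hz => (h hz).1)
  have hlim : Tendsto (fun x : ℝ => (g x).re) (𝓝[>] 0) (𝓝 (g 0).re) :=
    (Complex.continuous_re.tendsto _).comp
      (hg.continuousAt.tendsto.comp (tendsto_ofReal_right.mono_right nhdsWithin_le_nhds))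
  have hright : (g 0).re ≤ 0 := by
    refine le_of_tendsto hlim ?_
    filter_upwards [tendsto_ofReal_right.eventually hgz, self_mem_nhdsWithin] with x h1 hx
    have := (h1 (Complex.ofReal_im x)).2
    rw [Complex.ofReal_re] at this
    by_contra! hcon
    exact absurd this (not_le.2 (mul_pos (pow_pos hx n) hcon))
  have hre : (g 0).re < 0 := lt_of_le_of_ne hright fun h => hg0 (Complex.ext h hgim)
  -- Near `0` the factor `g` is negative on the real line, so `x ^ n` has to be nonnegative on both
  -- sides of `0`. The root of `-g` used below is then real on the real line.
  have hev : Even n := by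
    by_contra hodd
    rw [Nat.not_even_iff_odd] at hodd
    have hneg : Tendsto (fun x : ℝ => ((-x : ℝ) : ℂ)) (𝓝[>] 0) (𝓝[≠] 0) := by
      refine tendsto_nhdsWithin_iff.2 ⟨?_, ?_⟩
      · refine tendsto_nhdsWithin_of_tendsto_nhds ?_
        have : Continuous fun x : ℝ => ((-x : ℝ) : ℂ) := by fun_prop
        simpa using this.tendsto 0
      · filter_upwards [self_mem_nhdsWithin] with x hx
        exact Complex.ofReal_ne_zero.2 (neg_ne_zero.2 (ne_of_gt hx))
    have hl2 : Tendsto (fun x : ℝ => (g ((-x : ℝ) : ℂ)).re) (𝓝[>] 0) (𝓝 (g 0).re) :=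
      (Complex.continuous_re.tendsto _).comp
        (hg.continuousAt.tendsto.comp (hneg.mono_right nhdsWithin_le_nhds))
    have : 0 ≤ (g 0).re := by
      refine ge_of_tendsto hl2 ?_
      filter_upwards [hneg.eventually hgz, self_mem_nhdsWithin] with x h1 hx
      have h2 := (h1 (Complex.ofReal_im _)).2
      rw [Complex.ofReal_re, hodd.neg_pow] at h2
      by_contra! hcon
      exact absurd h2 (not_le.2 (mul_pos_of_neg_of_neg (neg_neg_of_pos (pow_pos hx n)) hcon))
    linarith
  obtain ⟨m, hm⟩ := hev
  have hslit : -g 0 ∈ Complex.slitPlane := Or.inl (by simpa using hre)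
  refine ⟨fun z => z ^ m * (-g z) ^ (((2 : ℕ) : ℂ)⁻¹),
    (analyticAt_id.pow m).mul (hg.neg.cpow analyticAt_const hslit), ?_, ?_⟩
  · filter_upwards [hfg] with z hz
    rw [mul_pow, Complex.cpow_nat_inv_pow _ two_ne_zero, hz, hm]
    ring
  · have h1 : ∀ᶠ z in 𝓝 (0 : ℂ), (g z).re < 0 :=
      (Complex.continuous_re.continuousAt.comp hg.continuousAt).eventually (gt_mem_nhds hre)
    filter_upwards [h1, eventually_nhdsWithin_iff.1 hgz] with z h2 h3 hz
    have h4 : z = (z.re : ℂ) := Complex.ext rfl (by simpa using hz)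
    have h5 : (g z).im = 0 := by
      by_cases hz0 : z = 0
      · rw [hz0]; exact hgim
      · exact (h3 hz0 hz).1
    have h6 := cpow_im_eq_zero (w := -g z) (by simpa using h5) (by simpa using h2.le) 2
    rw [h4, ← Complex.ofReal_pow, Complex.im_ofReal_mul, ← h4, h6, mul_zero]

/-- A function of modulus one on the real line satisfies the reflection principle. -/
theorem reflection {r : ℂ → ℂ} (hr : AnalyticAt ℂ r 0)
    (h1 : ∀ᶠ z in 𝓝 (0 : ℂ), z.im = 0 → ‖r z‖ = 1) :
    ∀ᶠ z in 𝓝 (0 : ℂ), starRingEnd ℂ (r (starRingEnd ℂ z)) * r z = 1 := by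
  have hconj : Tendsto (starRingEnd ℂ) (𝓝 0) (𝓝 0) := by
    simpa using (Complex.continuous_conj.tendsto 0)
  have han : AnalyticAt ℂ (fun z => starRingEnd ℂ (r (starRingEnd ℂ z))) 0 := by
    rw [Complex.analyticAt_iff_eventually_differentiableAt] at hr ⊢
    filter_upwards [hconj.eventually hr] with z hz
    have := hz.conj_conj
    rwa [Complex.conj_conj] at this
  have hD : AnalyticAt ℂ (fun z => starRingEnd ℂ (r (starRingEnd ℂ z)) * r z - 1) 0 :=
    (han.mul hr).sub analyticAt_const
  have := hD.frequently_zero_iff_eventually_zero.1 ?_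
  · exact this.mono fun z hz => sub_eq_zero.1 hz
  · have h2 : ∀ᶠ x : ℝ in 𝓝[>] 0, starRingEnd ℂ (r (starRingEnd ℂ (x : ℂ))) * r x - 1 = 0 := by
      filter_upwards [(tendsto_ofReal_right.mono_right nhdsWithin_le_nhds).eventually h1] with x hx
      have := hx (Complex.ofReal_im x)
      rw [Complex.conj_ofReal, Complex.conj_mul', this]
      simp
    exact tendsto_ofReal_right.frequently h2.frequently

/-- Off the spectrum no multiplier has modulus one. On a connected piece this decides once and for
all which of two analytic branches lies in the unit disc. -/
theorem lt_one_or_one_lt {U : Set ℂ} (hU : IsPreconnected U) {f : ℂ → ℝ} (hf : ContinuousOn f U)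
    (h : ∀ z ∈ U, f z ≠ 1) : (∀ z ∈ U, f z < 1) ∨ ∀ z ∈ U, 1 < f z := by
  by_contra! hcon
  obtain ⟨⟨a, ha, ha1⟩, b, hb, hb1⟩ := hcon
  obtain ⟨c, hc, hc1⟩ := hU.intermediate_value hb ha hf ⟨hb1, ha1⟩
  exact h c hc hc1

end

section

open scoped Matrix.Norms.Operator

/-! ### Local frames of Bloch-Floquet eigenvectors -/

/-- Near `s₀`, the eigenvector `(M₀₁, r - M₀₀)` of `M` for the eigenvalue `r` is the product of a
power of `s - s₀` and an analytic vector that does not vanish at `s₀`, whose first component has a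
zero of order `n`. -/
def BlochFrame (M : ℂ → M2) (r : ℂ → ℂ) (s₀ : ℂ) (n : ℕ) : Prop :=
  ∃ (j : ℕ) (g k : ℂ → ℂ), AnalyticAt ℂ g s₀ ∧ AnalyticAt ℂ k s₀ ∧ g s₀ ≠ 0 ∧ (n = 0 ∨ k s₀ ≠ 0) ∧
    ∀ᶠ s in 𝓝 s₀, M s 0 1 = (s - s₀) ^ (n + j) * g s ∧ r s - M s 0 0 = (s - s₀) ^ j * k s

/-- `r` is an eigenvalue of the unimodular matrix `M`. -/
def IsMultiplier (M : M2) (r : ℂ) : Prop :=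
  M 0 0 * M 1 1 - M 0 1 * M 1 0 = 1 ∧ r ^ 2 - (M 0 0 + M 1 1) * r + 1 = 0

theorem isMultiplier_eigen {M : M2} {r a : ℂ} (h : IsMultiplier M r) (ha : a ≠ 0)
    {c : Fin 2 → ℂ} (h0 : M 0 1 = a * c 0) (h1 : r - M 0 0 = a * c 1) : M.mulVec c = r • c := by
  obtain ⟨hdet, hr⟩ := h
  ext i
  refine mul_left_cancel₀ ha ?_
  have key : ∀ i, M.mulVec c i = M i 0 * c 0 + M i 1 * c 1 := fun i => by
    simp only [Matrix.mulVec, dotProduct, Fin.sum_univ_two]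
  rw [key, Pi.smul_apply, smul_eq_mul]
  fin_cases i <;> simp only [Fin.zero_eta, Fin.mk_one]
  · linear_combination (r - M 0 0) * h0 - M 0 1 * h1
  · linear_combination -hdet - hr + (r - M 1 1) * h1 - M 1 0 * h0

/-- Two independent eigenvectors for `r` would make `M` equal to `r` times the identity, and then
`det M = r ^ 2`. -/
theorem eigen_parallel {M : M2} {r : ℂ} (h : IsMultiplier M r) (hr : r ^ 2 ≠ 1)
    {b c : Fin 2 → ℂ} (hb : M.mulVec b = r • b) (hc : M.mulVec c = r • c) :
    b 0 * c 1 - b 1 * c 0 = 0 := by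
  obtain ⟨hdet, -⟩ := h
  by_contra hD
  have hb0 := congrFun hb 0
  have hb1 := congrFun hb 1
  have hc0 := congrFun hc 0
  have hc1 := congrFun hc 1
  simp only [Matrix.mulVec, dotProduct, Fin.sum_univ_two, Pi.smul_apply, smul_eq_mul]
    at hb0 hb1 hc0 hc1
  have e0 : M 0 0 - r = 0 := mul_left_cancel₀ hD (by
    linear_combination c 1 * hb0 - b 1 * hc0)
  have e1 : M 0 1 = 0 := mul_left_cancel₀ hD (by linear_combination b 0 * hc0 - c 0 * hb0)
  have e2 : M 1 1 - r = 0 := mul_left_cancel₀ hD (by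
    linear_combination b 0 * hc1 - c 0 * hb1)
  apply hr
  rw [e1, sub_eq_zero.1 e0, sub_eq_zero.1 e2] at hdet
  linear_combination hdet

/-- Let `φ` and `b` be the reduced frames of `M₀` and `M₁`. By `hlax`, `a = T φ` lies in the
eigenline of `M₁` spanned by `b`, so `a = h b`. Since `T s₀` is invertible and neither frame
vanishes at `s₀`, `h` is analytic and nonzero there. The quantity in question is `a₀ / φ₀ = h b₀ /
φ₀`, and the orders of `b₀` and `φ₀` are `n₁` and `n₀`. -/
theorem BlochFrame.exists_order {M₀ M₁ T : ℂ → M2} {r : ℂ → ℂ} {s₀ : ℂ} {n₀ n₁ : ℕ}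
    (h0 : BlochFrame M₀ r s₀ n₀) (h1 : BlochFrame M₁ r s₀ n₁)
    (hT : ∀ i j, AnalyticAt ℂ (fun s => T s i j) s₀) (hdetT : (T s₀).det ≠ 0)
    (hlax : ∀ s, M₁ s * T s = T s * M₀ s)
    (hm₀ : ∀ᶠ s in 𝓝[≠] s₀, IsMultiplier (M₀ s) (r s))
    (hm₁ : ∀ᶠ s in 𝓝[≠] s₀, IsMultiplier (M₁ s) (r s))
    (hr1 : ∀ᶠ s in 𝓝[≠] s₀, r s ^ 2 ≠ 1) :
    ∃ h, AnalyticAt ℂ h s₀ ∧ h s₀ ≠ 0 ∧ ∀ᶠ s in 𝓝[≠] s₀,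
      T s 0 0 + T s 0 1 * ((r s - M₀ s 0 0) / M₀ s 0 1) = (s - s₀) ^ ((n₁ : ℤ) - n₀) * h s := by
  obtain ⟨j₀, g₀, k₀, hg₀, hk₀, hg₀0, hnk₀, hf₀⟩ := h0
  obtain ⟨j₁, g₁, k₁, hg₁, hk₁, hg₁0, hnk₁, hf₁⟩ := h1
  set δ : ℂ → ℂ := fun s => s - s₀ with hδ
  have hδa : AnalyticAt ℂ δ s₀ := analyticAt_id.sub analyticAt_const
  have hδ0 : δ s₀ = 0 := sub_self _
  set φ : ℂ → Fin 2 → ℂ := fun s => ![δ s ^ n₀ * g₀ s, k₀ s] with hφ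
  set b : ℂ → Fin 2 → ℂ := fun s => ![δ s ^ n₁ * g₁ s, k₁ s] with hb
  set a : ℂ → Fin 2 → ℂ := fun s => (T s).mulVec (φ s) with ha
  have hφ0a : AnalyticAt ℂ (fun s => δ s ^ n₀ * g₀ s) s₀ := (hδa.pow n₀).mul hg₀
  have hb0a : AnalyticAt ℂ (fun s => δ s ^ n₁ * g₁ s) s₀ := (hδa.pow n₁).mul hg₁
  have haa : ∀ i, AnalyticAt ℂ (fun s => a s i) s₀ := fun i => by
    have : (fun s => a s i) = fun s => T s i 0 * (δ s ^ n₀ * g₀ s) + T s i 1 * k₀ s := by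
      funext s; simp only [ha, Matrix.mulVec, dotProduct, Fin.sum_univ_two]; rfl
    rw [this]
    exact ((hT i 0).mul hφ0a).add ((hT i 1).mul hk₀)
  have hba : ∀ i, AnalyticAt ℂ (fun s => b s i) s₀ := fun i => by
    fin_cases i
    · exact hb0a
    · exact hk₁
  have hpar : ∀ᶠ s in 𝓝[≠] s₀, a s 0 * b s 1 - a s 1 * b s 0 = 0 := by
    filter_upwards [hm₀, hm₁, hr1, nhdsWithin_le_nhds hf₀, nhdsWithin_le_nhds hf₁,
      self_mem_nhdsWithin] with s q0 q1 q2 q3 q4 q5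
    have hs : δ s ≠ 0 := sub_ne_zero.2 q5
    have e0 : (M₀ s).mulVec (φ s) = r s • φ s := isMultiplier_eigen q0 (pow_ne_zero j₀ hs)
      (by rw [q3.1, pow_add]; simp [hφ, hδ]; ring) q3.2
    have e1 : (M₁ s).mulVec (b s) = r s • b s := isMultiplier_eigen q1 (pow_ne_zero j₁ hs)
      (by rw [q4.1, pow_add]; simp [hb, hδ]; ring) q4.2
    refine eigen_parallel q1 q2 ?_ e1
    rw [ha, Matrix.mulVec_mulVec, hlax, ← Matrix.mulVec_mulVec, e0, Matrix.mulVec_smul]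
  -- Continuity is needed at `s₀`: at an endpoint of a gap the two multipliers coincide, and the
  -- eigenspace need not be one-dimensional.
  have hpar0 : a s₀ 0 * b s₀ 1 - a s₀ 1 * b s₀ 0 = 0 := by
    have hc : ContinuousAt (fun s => a s 0 * b s 1 - a s 1 * b s 0) s₀ :=
      (((haa 0).mul (hba 1)).sub ((haa 1).mul (hba 0))).continuousAt
    refine tendsto_nhds_unique (hc.tendsto.mono_left nhdsWithin_le_nhds : Tendsto _ (𝓝[≠] s₀) _) ?_
    exact tendsto_const_nhds.congr' (hpar.mono fun s hs => hs.symm)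
  have ha0 : a s₀ ≠ 0 := by
    intro h
    have h2 : φ s₀ = 0 := by
      by_contra hne
      exact hdetT (Matrix.exists_mulVec_eq_zero_iff.1 ⟨φ s₀, hne, h⟩)
    rcases hnk₀ with hn | hk
    · have := congrFun h2 0
      simp [hφ, hn] at this
      exact hg₀0 this
    · exact hk (congrFun h2 1)
  have hb0 : b s₀ 0 ≠ 0 ∨ b s₀ 1 ≠ 0 := by
    rcases hnk₁ with hn | hk
    · left; simpa [hb, hn] using hg₁0
    · right; exact hk
  -- The factor is the ratio of `a` and `b` in a component where `b` does not vanish. If it vanished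
  -- at `s₀`, parallelism would force `a s₀ = 0`.
  obtain ⟨h, hh, hh0, hah⟩ : ∃ h : ℂ → ℂ, AnalyticAt ℂ h s₀ ∧ h s₀ ≠ 0 ∧
      ∀ᶠ s in 𝓝[≠] s₀, a s 0 = h s * b s 0 := by
    rcases hb0 with hb0 | hb1
    · refine ⟨fun s => a s 0 / b s 0, (haa 0).div (hba 0) hb0, ?_, ?_⟩
      · refine div_ne_zero (fun h => ha0 ?_) hb0
        rw [h, zero_mul, zero_sub, neg_eq_zero, mul_eq_zero] at hpar0
        ext i
        fin_cases i
        · exact h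
        · exact hpar0.resolve_right hb0
      · filter_upwards [nhdsWithin_le_nhds ((hba 0).continuousAt.eventually_ne hb0)] with s hs
        field_simp
    · refine ⟨fun s => a s 1 / b s 1, (haa 1).div (hba 1) hb1, ?_, ?_⟩
      · refine div_ne_zero (fun h => ha0 ?_) hb1
        rw [h, zero_mul, sub_zero, mul_eq_zero] at hpar0
        ext i
        fin_cases i
        · exact hpar0.resolve_right hb1
        · exact h
      · filter_upwards [nhdsWithin_le_nhds ((hba 1).continuousAt.eventually_ne hb1), hpar]
          with s hs hps
        field_simp
        linear_combination hps
  refine ⟨fun s => h s * (g₁ s / g₀ s), hh.mul (hg₁.div hg₀ hg₀0),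
    mul_ne_zero hh0 (div_ne_zero hg₁0 hg₀0), ?_⟩
  filter_upwards [hah, nhdsWithin_le_nhds hf₀, nhdsWithin_le_nhds (hg₀.continuousAt.eventually_ne hg₀0),
    self_mem_nhdsWithin] with s e1 e2 e3 e4
  have hs : s - s₀ ≠ 0 := sub_ne_zero.2 e4
  have e5 : a s 0 = T s 0 0 * ((s - s₀) ^ n₀ * g₀ s) + T s 0 1 * k₀ s := by
    simp [ha, hφ, hδ]
  have e6 : b s 0 = (s - s₀) ^ n₁ * g₁ s := rfl
  rw [e5, e6] at e1
  rw [e2.1, e2.2, pow_add, zpow_sub₀ hs, zpow_natCast, zpow_natCast]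
  have h3 := pow_ne_zero n₀ hs
  have h4 := pow_ne_zero j₀ hs
  field_simp
  linear_combination e1

/-! ### Local structure of the Floquet multiplier -/

variable {p : ℝ → ℂ} {z : ℂ} {L : ℝ}

theorem analyticAt_modMonodromy (hp : Continuous p) (hL : 0 ≤ L) (z : ℂ) (i j : Fin 2) :
    AnalyticAt ℂ (fun z => modMonodromy L p z i j) z :=
  (differentiable_modMonodromy hp hL i j).analyticAt z

theorem analyticAt_discriminant (hp : Continuous p) (hL : 0 ≤ L) (z : ℂ) :
    AnalyticAt ℂ (discriminant L p) z :=
  (differentiable_discriminant hp hL).analyticAt z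

theorem isMultiplier_iff (hp : Continuous p) {r : ℂ} :
    IsMultiplier (modMonodromy L p z) r ↔ r ^ 2 - 2 * discriminant L p z * r + 1 = 0 := by
  rw [IsMultiplier, discriminant_eq]
  constructor
  · rintro ⟨-, h⟩
    linear_combination h
  · intro h
    exact ⟨det_modMonodromy hp, by linear_combination h⟩

theorem discriminant_sq_ne_one (hp : Continuous p) (hper : ∀ x, p (x + L) = p x) (hL : 0 < L)
    (hz : z ∉ laxSpectrum p) : discriminant L p z ^ 2 - 1 ≠ 0 := by
  intro h
  have h1 : (discriminant L p z - 1) * (discriminant L p z + 1) = 0 := by linear_combination h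
  apply hz
  rw [mem_laxSpectrum_iff_discriminant hp hper hL]
  rcases mul_eq_zero.1 h1 with h2 | h2
  · exact ⟨1, by norm_num, by rw [sub_eq_zero.1 h2]; simp⟩
  · exact ⟨-1, by norm_num, by rw [eq_neg_of_add_eq_zero_left h2]; simp⟩

/-- Off the spectrum `Δ² ≠ 1`, so `Δ² - 1` has an analytic root. With its sign chosen to match `ρ`
at `z`, the branch remains in the unit disc nearby and hence remains `ρ`. -/
theorem analyticAt_floquetMultiplier (hp : Continuous p) (hper : ∀ x, p (x + L) = p x)
    (hL : 0 < L) (hz : z ∉ laxSpectrum p) : AnalyticAt ℂ (floquetMultiplier L p) z := by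
  have hD := analyticAt_discriminant (L := L) hp hL.le z
  obtain ⟨w, hw, hw2⟩ := exists_analytic_sqrt ((hD.pow 2).sub analyticAt_const)
    (discriminant_sq_ne_one hp hper hL hz)
  simp only [Pi.sub_apply, Pi.pow_apply] at hw2
  obtain ⟨w, hw, hw2, hw3⟩ : ∃ w : ℂ → ℂ, AnalyticAt ℂ w z ∧
      (∀ z, w z ^ 2 = discriminant L p z ^ 2 - 1) ∧
      floquetMultiplier L p z = discriminant L p z + w z := by
    have h1 := (floquetMultiplier_spec hp hper hL hz).1
    have h2 : (floquetMultiplier L p z - discriminant L p z - w z) *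
        (floquetMultiplier L p z - discriminant L p z + w z) = 0 := by
      linear_combination h1 - hw2 z
    rcases mul_eq_zero.1 h2 with h | h
    · exact ⟨w, hw, hw2, by linear_combination h⟩
    · exact ⟨fun z => -w z, hw.neg, fun z => by rw [neg_sq]; exact hw2 z,
        by linear_combination h⟩
  have hr : AnalyticAt ℂ (fun z => discriminant L p z + w z) z := hD.add hw
  refine hr.congr ?_
  have h1 : ∀ᶠ y in 𝓝 z, ‖discriminant L p y + w y‖ < 1 :=
    hr.continuousAt.norm.eventually (gt_mem_nhds (by
      beta_reduce; rw [← hw3]; exact (floquetMultiplier_spec hp hper hL hz).2))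
  filter_upwards [h1, (isClosed_laxSpectrum hp hper hL).isOpen_compl.mem_nhds hz] with y hy1 hy2
  exact floquetMultiplier_unique hp hper hL hy2 (by linear_combination hw2 y) hy1

theorem analyticAt_multiplier (hp : Continuous p) (hper : ∀ x, p (x + L) = p x)
    (hL : 0 < L) (hz : z ∉ laxSpectrum p) (ε : ℤˣ) : AnalyticAt ℂ (multiplier L p ε) z := by
  have h1 := analyticAt_floquetMultiplier hp hper hL hz
  rcases Int.units_eq_one_or ε with rfl | rfl
  · have : multiplier L p 1 = floquetMultiplier L p := funext fun z => multiplier_one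
    rwa [this]
  · have : multiplier L p (-1) = (floquetMultiplier L p)⁻¹ := funext fun z => by
      rw [multiplier_neg, multiplier_one]; rfl
    rw [this]
    exact h1.inv (floquetMultiplier_ne_zero hp hper hL hz)

theorem dirichletSign_of_multiplier (hp : Continuous p) (hper : ∀ x, p (x + L) = p x)
    (hL : 0 < L) (hz : z ∉ laxSpectrum p) {ε : ℤˣ}
    (h : modMonodromy L p z 1 1 = multiplier L p ε z) : dirichletSign L p z = ε := by
  have h0 := norm_pos_iff.2 (multiplier_ne_zero hp hper hL hz ε)
  rw [dirichletSign, h]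
  rcases Int.units_eq_one_or ε with rfl | rfl
  · rw [sign_neg (Real.log_neg h0 (norm_multiplier_one_lt hp hper hL hz))]
    simp
  · rw [sign_pos (Real.log_pos (one_lt_norm_multiplier hp hper hL hz))]
    simp

/-- The order of the Bloch-Floquet frame off the spectrum. -/
theorem exists_blochFrame (hp : Continuous p) (hper : ∀ x, p (x + L) = p x)
    (hL : 0 < L) (hz : z ∉ laxSpectrum p) (ε : ℤˣ) :
    ∃ n : ℕ, BlochFrame (fun z => modMonodromy L p z) (multiplier L p ε) z n ∧
      (n = 1 ∧ z ∈ dirichletSpectrum L p ∧ dirichletSign L p z = ε ∨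
        n = 0 ∧ ¬(z ∈ dirichletSpectrum L p ∧ dirichletSign L p z = ε)) := by
  have hm := analyticAt_modMonodromy (L := L) hp hL.le z
  have hr := analyticAt_multiplier hp hper hL hz ε
  by_cases hD : modMonodromy L p z 0 1 = 0
  · have hDir : z ∈ dirichletSpectrum L p := (mem_dirichletSpectrum_iff hp).2 hD
    have him := im_eq_zero_of_mem_dirichletSpectrum hp hL hDir
    obtain ⟨g, hg, hg0, hfg⟩ := exists_analytic_factor (hm 0 1) hD
    have hg0' : g z ≠ 0 := by rw [hg0]; exact deriv_modMonodromy_ne_zero hp hL him hD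
    have hdet := det_modMonodromy (L := L) (z := z) hp
    rw [hD, zero_mul, sub_zero] at hdet
    -- At a Dirichlet eigenvalue the monodromy matrix is triangular and its diagonal carries the two
    -- multipliers. If `ρ^ε` is the upper entry, numerator and denominator share a zero and the
    -- reduced frame has a nonzero first component. If it is the lower entry, which is the one that
    -- defines the sign, the zero of `M₀₁` remains.
    by_cases hM : multiplier L p ε z = modMonodromy L p z 0 0
    · obtain ⟨k, hk, -, hfk⟩ := exists_analytic_factor (hr.sub (hm 0 0)) (by
        simp only [Pi.sub_apply, hM, sub_self])
      refine ⟨0, ⟨1, g, k, hg, hk, hg0', Or.inl rfl, Eventually.of_forall fun s => ⟨?_, ?_⟩⟩,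
        Or.inr ⟨rfl, fun h => ?_⟩⟩
      · beta_reduce; rw [hfg]; ring
      · have := hfk s
        simp only [Pi.sub_apply] at this
        rw [this]; ring
      · have h2 : modMonodromy L p z 1 1 = multiplier L p (-ε) z := by
          rw [multiplier_neg, hM, eq_inv_of_mul_eq_one_right hdet]
        have h3 := dirichletSign_of_multiplier hp hper hL hz h2
        rw [h.2] at h3
        rcases Int.units_eq_one_or ε with rfl | rfl <;> simp at h3
    · have h1 := multiplier_quadratic hp hper hL hz ε
      have h2 : (multiplier L p ε z - modMonodromy L p z 0 0) *
          (multiplier L p ε z - modMonodromy L p z 1 1) = 0 := by linear_combination h1 + hdet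
      have h3 := sub_eq_zero.1 ((mul_eq_zero.1 h2).resolve_left (sub_ne_zero.2 hM))
      refine ⟨1, ⟨0, g, fun z => multiplier L p ε z - modMonodromy L p z 0 0, hg,
        hr.sub (hm 0 0), hg0', Or.inr (sub_ne_zero.2 hM), Eventually.of_forall fun s => ⟨?_, ?_⟩⟩,
        Or.inl ⟨rfl, hDir, dirichletSign_of_multiplier hp hper hL hz h3.symm⟩⟩
      · beta_reduce; rw [hfg]; ring
      · simp
  · refine ⟨0, ⟨0, fun z => modMonodromy L p z 0 1,
      fun z => multiplier L p ε z - modMonodromy L p z 0 0, hm 0 1, hr.sub (hm 0 0), hD,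
      Or.inl rfl, Eventually.of_forall fun s => ⟨by simp, by simp⟩⟩,
      Or.inr ⟨rfl, fun h => hD ((mem_dirichletSpectrum_iff hp).1 h.1)⟩⟩

/-- The order of the Bloch-Floquet frame at an endpoint `E` of a gap, in the local parameter `s`
with `z = E + d s²`. -/
theorem exists_blochFrame_endpoint (hp : Continuous p) (hL : 0 < L) {E d : ℝ} (hd : d ≠ 0)
    {r : ℂ → ℂ} (hr : AnalyticAt ℂ r 0) (hr0 : r 0 ^ 2 = 1) (hr' : deriv r 0 ≠ 0)
    (hE : discriminant L p E = r 0) :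
    ∃ n : ℕ, BlochFrame (fun s => modMonodromy L p (E + d * s ^ 2)) r 0 n ∧
      (n = 1 ∧ (E : ℂ) ∈ dirichletSpectrum L p ∧ dirichletSign L p E = 0 ∨
        n = 0 ∧ (E : ℂ) ∉ dirichletSpectrum L p) := by
  have hsub : ∀ s : ℂ, AnalyticAt ℂ (fun s : ℂ => (E : ℂ) + d * s ^ 2) s := fun s => by fun_prop
  have hm : ∀ i j, AnalyticAt ℂ (fun s => modMonodromy L p (E + d * s ^ 2) i j) 0 := fun i j =>
    (analyticAt_modMonodromy (L := L) hp hL.le _ i j).comp (hsub 0)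
  by_cases hD : modMonodromy L p E 0 1 = 0
  · have hdet := det_modMonodromy (L := L) (z := (E : ℂ)) hp
    rw [hD, zero_mul, sub_zero] at hdet
    rw [discriminant_eq] at hE
    -- The diagonal entries have product one and sum `2 r(0)` with `r(0)² = 1`, so both equal
    -- `r(0)`.
    have h00 : modMonodromy L p E 0 0 = r 0 := by
      have : (modMonodromy L p E 0 0 - r 0) ^ 2 = 0 := by
        linear_combination 2 * modMonodromy L p E 0 0 * hE - hdet + hr0
      exact sub_eq_zero.1 (pow_eq_zero_iff two_ne_zero |>.1 this)
    have h11 : modMonodromy L p E 1 1 = r 0 := by linear_combination 2 * hE - h00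
    obtain ⟨g, hg, hg0, hfg⟩ :=
      exists_analytic_factor (analyticAt_modMonodromy (L := L) hp hL.le (E : ℂ) 0 1) hD
    have hg0' : g E ≠ 0 := by
      rw [hg0]; exact deriv_modMonodromy_ne_zero hp hL (Complex.ofReal_im _) hD
    have hk0 : r 0 - modMonodromy L p (E + d * (0 : ℂ) ^ 2) 0 0 = 0 := by
      rw [← h00]; simp
    obtain ⟨k, hk, hk', hfk⟩ := exists_analytic_factor (hr.sub (hm 0 0)) hk0
    -- The monodromy matrix depends on `s` only through `s²`, so its derivative vanishes at `0`, and
    -- the numerator has a simple zero in `s`.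
    have hder : deriv (r - fun s => modMonodromy L p (E + d * s ^ 2) 0 0) 0 = deriv r 0 := by
      have h1 : HasDerivAt (fun s : ℂ => (E : ℂ) + d * s ^ 2) 0 0 := by
        have := ((hasDerivAt_pow 2 (0 : ℂ)).const_mul (d : ℂ)).const_add (E : ℂ)
        simpa using this
      have h2 : HasDerivAt (fun z => modMonodromy L p z 0 0)
          (deriv (fun z => modMonodromy L p z 0 0) ((E : ℂ) + d * (0 : ℂ) ^ 2))
          ((E : ℂ) + d * (0 : ℂ) ^ 2) :=
        (differentiable_modMonodromy hp hL.le 0 0 _).hasDerivAt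
      have h3 := h2.comp (0 : ℂ) h1
      rw [mul_zero] at h3
      have h4 := hr.differentiableAt.hasDerivAt.sub h3
      rw [sub_zero] at h4
      exact h4.deriv
    -- The simple zero of `M₀₁` in `z` is double in `s`. One factor `s` cancels against the
    -- numerator, the other gives the square root behaviour.
    refine ⟨1, ⟨1, fun s => d * g (E + d * s ^ 2), k, ?_, hk, ?_, Or.inr (by rw [hk', hder]; exact hr'),
      Eventually.of_forall fun s => ⟨?_, ?_⟩⟩, Or.inl ⟨rfl, (mem_dirichletSpectrum_iff hp).2 hD, ?_⟩⟩
    · refine analyticAt_const.mul (AnalyticAt.comp (g := g) ?_ (hsub 0))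
      simpa using hg
    · simpa [hd] using hg0'
    · beta_reduce; rw [hfg]; ring
    · have := hfk s
      simp only [Pi.sub_apply] at this
      rw [this]; ring
    · have : ‖r 0‖ = 1 := by
        have := congrArg norm hr0
        rw [norm_pow, norm_one] at this
        exact (pow_eq_one_iff_of_nonneg (norm_nonneg _) two_ne_zero).1 this
      rw [dirichletSign, h11, this]
      simp
  · refine ⟨0, ⟨0, fun s => modMonodromy L p (E + d * s ^ 2) 0 1,
      fun s => r s - modMonodromy L p (E + d * s ^ 2) 0 0, hm 0 1, hr.sub (hm 0 0), by simpa using hD,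
      Or.inl rfl, Eventually.of_forall fun s => ⟨by simp, by simp⟩⟩,
      Or.inr ⟨rfl, fun h => hD ((mem_dirichletSpectrum_iff hp).1 h)⟩⟩

end

section

open scoped Matrix.Norms.Operator

/-! ### Floquet multipliers near the spectrum -/

variable {p : ℝ → ℂ} {z : ℂ} {L : ℝ}

theorem discriminant_eq_re (hp : Continuous p) (hz : z.im = 0) :
    discriminant L p z = ((discriminant L p z).re : ℂ) :=
  Complex.ext rfl (by simpa using discriminant_real hp hz)

theorem mem_laxSpectrum_of_real (hp : Continuous p) (hper : ∀ x, p (x + L) = p x) (hL : 0 < L)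
    (hz : z.im = 0) : z ∈ laxSpectrum p ↔ |(discriminant L p z).re| ≤ 1 := by
  rw [mem_laxSpectrum_iff_discriminant hp hper hL, abs_le]
  constructor
  · rintro ⟨c, hc, h⟩
    rw [h, Complex.ofReal_re]
    exact hc
  · intro h
    exact ⟨_, h, discriminant_eq_re hp hz⟩

theorem norm_ne_one_of_root (hp : Continuous p) (hper : ∀ x, p (x + L) = p x) (hL : 0 < L)
    (hz : z ∉ laxSpectrum p) {r : ℂ} (hr : r ^ 2 - 2 * discriminant L p z * r + 1 = 0) :
    ‖r‖ ≠ 1 := fun h => hz ((mem_laxSpectrum_iff hp hper hL).2 ⟨r, h, hr⟩)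

theorem analyticAt_discriminant_comp (hp : Continuous p) (hL : 0 < L) (E d : ℝ) (y : ℂ) :
    AnalyticAt ℂ (fun y => discriminant L p (E + d * y)) y :=
  (analyticAt_discriminant (L := L) hp hL.le _).comp (by fun_prop)

theorem affine_im (E d : ℝ) (y : ℂ) : ((E : ℂ) + d * y).im = d * y.im := by simp

/-- At an endpoint `E` of a spectral gap on the side of `d`, the Floquet multiplier is an analytic
function of `s`, where `z = E + d s²`. -/
theorem exists_endpoint_multiplier (hp : Continuous p) (hper : ∀ x, p (x + L) = p x) (hL : 0 < L)
    {E d : ℝ} (hd : d ≠ 0) (hE : (E : ℂ) ∈ laxSpectrum p)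
    (hgap : ∃ᶠ x : ℝ in 𝓝[>] 0, (E + d * x : ℂ) ∉ laxSpectrum p) :
    ∃ r : ℂ → ℂ, AnalyticAt ℂ r 0 ∧ r 0 ^ 2 = 1 ∧ deriv r 0 ≠ 0 ∧ discriminant L p E = r 0 ∧
      (∀ᶠ s in 𝓝 (0 : ℂ), r s ^ 2 - 2 * discriminant L p (E + d * s ^ 2) * r s + 1 = 0 ∧
        r s * r (-s) = 1) ∧
      (∀ᶠ s in 𝓝 (0 : ℂ), 0 < s.re → (E + d * s ^ 2 : ℂ) ∉ laxSpectrum p ∧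
        floquetMultiplier L p (E + d * s ^ 2) = r s) ∧
      ∀ᶠ y in 𝓝 (0 : ℂ), (E + d * y : ℂ) ∉ laxSpectrum p → y ∈ Complex.slitPlane := by
  have hDan := analyticAt_discriminant_comp hp hL E d
  set D : ℂ → ℂ := fun y => discriminant L p (E + d * y) with hD
  have hD0 : D 0 = discriminant L p E := by simp [hD]
  have hDcont : ContinuousAt (fun y => (D y).re) 0 :=
    Complex.continuous_re.continuousAt.comp (hDan 0).continuousAt
  have hmem : ∀ y : ℂ, y.im = 0 → ((E + d * y : ℂ) ∈ laxSpectrum p ↔ |(D y).re| ≤ 1) :=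
    fun y hy => mem_laxSpectrum_of_real hp hper hL (by rw [affine_im, hy, mul_zero])
  have hDre : ∀ y : ℂ, y.im = 0 → D y = ((D y).re : ℂ) := fun y hy =>
    discriminant_eq_re hp (by rw [affine_im, hy, mul_zero])
  obtain ⟨c, hc, hDc⟩ : ∃ c : ℝ, c ^ 2 = 1 ∧ D 0 = c := by
    refine ⟨(D 0).re, ?_, hDre 0 rfl⟩
    have h1 : |(D 0).re| ≤ 1 := (hmem 0 rfl).1 (by simpa using hE)
    by_contra hne
    have h2 : |(D 0).re| < 1 := lt_of_le_of_ne h1 fun h => hne (by rw [← sq_abs, h]; norm_num)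
    have h3 : ∀ᶠ y in 𝓝 (0 : ℂ), |(D y).re| < 1 := hDcont.abs.eventually (gt_mem_nhds h2)
    have h4 := (tendsto_ofReal_right.mono_right nhdsWithin_le_nhds).eventually h3
    obtain ⟨x, hx1, hx2⟩ := (hgap.and_eventually h4).exists
    exact hx1 ((hmem x (Complex.ofReal_im x)).2 hx2.le)
  have hcc : (c : ℂ) ^ 2 = 1 := by exact_mod_cast hc
  have habs : ∀ y : ℂ, |(D y).re| = |c * (D y).re| := fun y => by
    rw [abs_mul, show |c| = 1 by rw [← abs_one, ← sq_eq_sq_iff_abs_eq_abs, hc, one_pow], one_mul]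
  set f : ℂ → ℂ := fun y => c * D y - 1 with hf
  have hfan : AnalyticAt ℂ f 0 := (analyticAt_const.mul (hDan 0)).sub analyticAt_const
  have hf0 : f 0 = 0 := by
    rw [hf]; simp only [hDc]; linear_combination hcc
  have hfre : ∀ y, (f y).re = c * (D y).re - 1 := fun y => by simp [hf]
  have hfcont : ContinuousAt (fun y => (f y).re) 0 :=
    Complex.continuous_re.continuousAt.comp hfan.continuousAt
  have hflow : ∀ᶠ y in 𝓝 (0 : ℂ), -1 < (f y).re :=
    hfcont.eventually (lt_mem_nhds (by simp [hf0]))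
  -- The zero of `f = ±Δ - 1` is simple: small negative values of `f` mean `Δ ∈ (-1, 1)`, so they
  -- are taken only on the spectrum, which is real, and `f` is positive at nearby points of the gap.
  obtain ⟨g, hg, hgim, hgre, hfg⟩ := exists_simple_factor hfan hf0
    (Eventually.of_forall fun y hy => by
      simp only [hf]; rw [hDre y hy]; simp) (by
      refine (hgap.and_eventually
        ((tendsto_ofReal_right.mono_right nhdsWithin_le_nhds).eventually hflow)).mono ?_
      rintro x ⟨h1, h2⟩
      rw [hmem x (Complex.ofReal_im x), habs, not_le, lt_abs] at h1
      rw [hfre] at h2 ⊢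
      rcases h1 with h1 | h1 <;> linarith)
    (Eventually.of_forall fun y h1 h2 => by
      have h3 : D y = ((c * ((f y).re + 1) : ℝ) : ℂ) := by
        have h4 : f y = ((f y).re : ℂ) := Complex.ext rfl (by simpa using h1)
        push_cast
        rw [← h4, hf]
        linear_combination -(D y) * hcc
      have h4 : (E + d * y : ℂ) ∈ laxSpectrum p := by
        rw [mem_laxSpectrum_iff_discriminant hp hper hL]
        refine ⟨_, ?_, h3⟩
        rw [mem_Icc, ← abs_le, abs_mul,
          show |c| = 1 by rw [← abs_one, ← sq_eq_sq_iff_abs_eq_abs, hc, one_pow], one_mul, abs_le]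
        exact ⟨by linarith [h2.1], by linarith [h2.2]⟩
      have h5 := im_eq_zero_of_mem_laxSpectrum hp hper hL h4
      rw [affine_im] at h5
      exact (mul_eq_zero.1 h5).resolve_left hd)
  have hgpos : ∀ᶠ y in 𝓝 (0 : ℂ), 0 < (g y).re :=
    (Complex.continuous_re.continuousAt.comp hg.continuousAt).eventually (lt_mem_nhds hgre)
  have hfsign : ∀ᶠ y in 𝓝 (0 : ℂ), y.im = 0 → (f y).re = y.re * (g y).re := by
    filter_upwards [hfg] with y hy hy0
    rw [hy, Complex.mul_re, hy0, zero_mul, sub_zero]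
  set k : ℂ → ℂ := fun y => g y * (y * g y + 2) with hk
  have hkan : AnalyticAt ℂ k 0 := hg.mul ((analyticAt_id.mul hg).add analyticAt_const)
  have hk0 : k 0 ≠ 0 := by
    simp only [hk, zero_mul, zero_add]
    exact mul_ne_zero (fun h => by rw [h] at hgre; simp at hgre) two_ne_zero
  have hDk : ∀ᶠ y in 𝓝 (0 : ℂ), D y ^ 2 - 1 = y * k y := by
    filter_upwards [hfg] with y hy
    have h1 : D y ^ 2 = (f y + 1) ^ 2 := by rw [hf]; linear_combination -(D y) ^ 2 * hcc
    rw [h1, hy, hk]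
    ring
  obtain ⟨κ, hκ, hκ2⟩ := exists_analytic_sqrt hkan hk0
  have hκ0 : κ 0 ≠ 0 := fun h => hk0 (by rw [← hκ2, h]; simp)
  have hsq : Tendsto (fun s : ℂ => s ^ 2) (𝓝 0) (𝓝 0) := by
    have : Continuous fun s : ℂ => s ^ 2 := by fun_prop
    simpa using this.tendsto 0
  have hsqan : AnalyticAt ℂ (fun s : ℂ => s ^ 2) 0 := by fun_prop
  -- Near the endpoint `Δ² - 1 = y κ(y)²` with `κ(0) ≠ 0`, so with `y = s²` the roots of the
  -- characteristic equation are `Δ ± s κ(s²)`. They are exchanged by `s ↦ -s`, and the sign is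
  -- settled below by the side of the unit circle on which `r₀` lies for `Re s > 0`.
  set r₀ : ℂ → ℂ := fun s => D (s ^ 2) - s * κ (s ^ 2) with hr₀
  have hκc : AnalyticAt ℂ (fun s : ℂ => κ (s ^ 2)) 0 :=
    AnalyticAt.comp (g := κ) (by simpa using hκ) hsqan
  have hDc' : AnalyticAt ℂ (fun s : ℂ => D (s ^ 2)) 0 :=
    AnalyticAt.comp (g := D) (hDan _) hsqan
  have hr₀an : AnalyticAt ℂ r₀ 0 := hDc'.sub (analyticAt_id.mul hκc)
  have hr₀0 : r₀ 0 = D 0 := by simp [hr₀]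
  have hr₀' : HasDerivAt r₀ (-κ 0) 0 := by
    have h1 : HasDerivAt (fun s : ℂ => s ^ 2) 0 0 := by
      simpa using hasDerivAt_pow 2 (0 : ℂ)
    have h2 : HasDerivAt D (deriv D ((0 : ℂ) ^ 2)) ((0 : ℂ) ^ 2) :=
      (hDan _).differentiableAt.hasDerivAt
    have h3 := h2.comp (0 : ℂ) h1
    have h4 := (hasDerivAt_id (0 : ℂ)).mul hκc.differentiableAt.hasDerivAt
    exact (h3.sub h4).congr_deriv (by simp)
  have hq : ∀ᶠ s in 𝓝 (0 : ℂ), r₀ s ^ 2 - 2 * D (s ^ 2) * r₀ s + 1 = 0 ∧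
      r₀ s * r₀ (-s) = 1 := by
    filter_upwards [hsq.eventually hDk] with s hs
    have h2 := hκ2 (s ^ 2)
    constructor
    · simp only [hr₀]
      linear_combination s ^ 2 * h2 - hs
    · simp only [hr₀, neg_sq]
      linear_combination hs - s ^ 2 * h2
  have hhalf : ∀ᶠ s in 𝓝 (0 : ℂ), 0 < s.re → (E + d * s ^ 2 : ℂ) ∉ laxSpectrum p := by
    filter_upwards [hsq.eventually hgpos, hsq.eventually hfsign] with s h1 h2 h3 h4
    have h5 := im_eq_zero_of_mem_laxSpectrum hp hper hL h4
    rw [affine_im] at h5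
    have h6 : (s ^ 2).im = 0 := (mul_eq_zero.1 h5).resolve_left hd
    rw [hmem _ h6, habs] at h4
    have h7 := h2 h6
    rw [hfre] at h7
    have h8 : s.im = 0 := by
      rw [sq, Complex.mul_im] at h6
      have : s.re * s.im = 0 := by linarith
      exact (mul_eq_zero.1 this).resolve_left h3.ne'
    have h9 : 0 < (s ^ 2).re := by
      rw [sq, Complex.mul_re, h8]; nlinarith
    have := mul_pos h9 h1
    have := le_abs_self (c * (D (s ^ 2)).re)
    linarith
  have hslit : ∀ᶠ y in 𝓝 (0 : ℂ), (E + d * y : ℂ) ∉ laxSpectrum p → y ∈ Complex.slitPlane := by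
    filter_upwards [hgpos, hfsign, hflow] with y h1 h2 h3 h4
    by_contra hy
    rw [Complex.mem_slitPlane_iff, not_or, not_lt, not_not] at hy
    apply h4
    rw [hmem y hy.2, habs, abs_le]
    have h5 := h2 hy.2
    rw [hfre] at h5 h3
    have := mul_nonpos_of_nonpos_of_nonneg hy.1 h1.le
    constructor <;> linarith
  obtain ⟨δ, hδ, hball⟩ := Metric.eventually_nhds_iff_ball.1 ((hq.and hhalf).and
    (hr₀an.eventually_analyticAt))
  set U : Set ℂ := Metric.ball 0 δ ∩ {s | 0 < s.re} with hU
  have hUconv : Convex ℝ U := (convex_ball 0 δ).inter (convex_halfSpace_re_gt 0)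
  have hne : ∀ s ∈ U, ‖r₀ s‖ ≠ 1 := fun s hs =>
    norm_ne_one_of_root hp hper hL ((hball s hs.1).1.2 hs.2) (hball s hs.1).1.1.1
  have hcontU : ContinuousOn (fun s => ‖r₀ s‖) U := fun s hs =>
    (hball s hs.1).2.continuousAt.norm.continuousWithinAt
  have hball' : ∀ᶠ s in 𝓝 (0 : ℂ), s ∈ Metric.ball (0 : ℂ) δ := Metric.ball_mem_nhds 0 hδ
  have hr0sq : r₀ 0 ^ 2 = 1 := by rw [hr₀0, hDc, hcc]
  rcases lt_one_or_one_lt hUconv.isPreconnected hcontU hne with h | h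
  · refine ⟨r₀, hr₀an, hr0sq, by rw [hr₀'.deriv]; exact neg_ne_zero.2 hκ0,
      by rw [hr₀0, hD0], hq, ?_, hslit⟩
    filter_upwards [hball'] with s hs hre
    have h1 := (hball s hs).1.2 hre
    exact ⟨h1, (floquetMultiplier_unique hp hper hL h1 (hball s hs).1.1.1 (h s ⟨hs, hre⟩)).symm⟩
  · have hneg : Tendsto (fun s : ℂ => -s) (𝓝 0) (𝓝 0) := by
      simpa using (continuous_neg (G := ℂ)).tendsto 0
    have hder : HasDerivAt (fun s => r₀ (-s)) (κ 0) 0 := by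
      have h1 : HasDerivAt r₀ (-κ 0) (-0) := by rwa [neg_zero]
      have := h1.comp (0 : ℂ) (hasDerivAt_neg (0 : ℂ))
      exact this.congr_deriv (by simp)
    refine ⟨fun s => r₀ (-s), AnalyticAt.comp (g := r₀) (by simpa using hr₀an) (by fun_prop),
      by simpa using hr0sq, by rw [hder.deriv]; exact hκ0, by simp [hr₀0, hD0], ?_, ?_, hslit⟩
    · filter_upwards [hneg.eventually hq] with s hs
      rw [neg_sq] at hs
      exact hs
    · filter_upwards [hball', hneg.eventually hq] with s hs hq' hre
      have h1 := (hball s hs).1.2 hre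
      refine ⟨h1, (floquetMultiplier_unique hp hper hL h1 ?_ ?_).symm⟩
      · rw [neg_sq] at hq'
        exact hq'.1
      · have h2 := congrArg norm (hball s hs).1.1.2
        rw [norm_mul, norm_one] at h2
        have h3 := h s ⟨hs, hre⟩
        by_contra! hcon
        nlinarith [norm_nonneg (r₀ (-s))]

/-- At an interior point `E` of the spectrum, the Floquet multiplier in the upper half plane and
its inverse in the lower half plane are restrictions of one analytic function. -/
theorem exists_interior_multiplier (hp : Continuous p) (hper : ∀ x, p (x + L) = p x) (hL : 0 < L)
    {E : ℝ} (hE : ∀ᶠ y in 𝓝 (0 : ℂ), y.im = 0 → (E + y : ℂ) ∈ laxSpectrum p) :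
    ∃ r : ℂ → ℂ, AnalyticAt ℂ r 0 ∧ ∀ᶠ y in 𝓝 (0 : ℂ),
      r y ^ 2 - 2 * discriminant L p (E + y) * r y + 1 = 0 ∧
      (0 < y.im → floquetMultiplier L p (E + y) = r y) ∧
      (y.im < 0 → floquetMultiplier L p (E + y) = (r y)⁻¹) := by
  have hDan : ∀ y, AnalyticAt ℂ (fun y => discriminant L p (E + y)) y := fun y => by
    simpa using analyticAt_discriminant_comp hp hL E 1 y
  set D : ℂ → ℂ := fun y => discriminant L p (E + y) with hD
  have him : ∀ y : ℂ, ((E : ℂ) + y).im = y.im := fun y => by simp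
  have hnot : ∀ y : ℂ, y.im ≠ 0 → (E + y : ℂ) ∉ laxSpectrum p := fun y hy h =>
    hy (by rw [← him]; exact im_eq_zero_of_mem_laxSpectrum hp hper hL h)
  -- Off the real line there is no spectrum, so `Δ² ≠ 1` there.
  have hne : ¬∀ᶠ y in 𝓝 (0 : ℂ), D y ^ 2 - 1 = 0 := by
    intro h
    have h1 : Tendsto (fun x : ℝ => (x : ℂ) * Complex.I) (𝓝[>] 0) (𝓝 0) := by
      have := (tendsto_ofReal_right.mono_right nhdsWithin_le_nhds).mul_const Complex.I
      rwa [zero_mul] at this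
    obtain ⟨x, hx, hx0⟩ := ((h1.eventually h).and self_mem_nhdsWithin).exists
    exact discriminant_sq_ne_one hp hper hL (hnot (x * Complex.I) (by simpa using ne_of_gt hx0)) hx
  obtain ⟨w, hw, hw2, hwre⟩ := exists_neg_square (((hDan 0).pow 2).sub analyticAt_const) hne (by
    filter_upwards [hE] with y hy hy0
    have h1 := discriminant_eq_re (L := L) (z := (E : ℂ) + y) hp (by rw [him, hy0])
    have h2 := (mem_laxSpectrum_of_real hp hper hL (by rw [him, hy0])).1 (hy hy0)
    change (D y ^ 2 - 1).im = 0 ∧ (D y ^ 2 - 1).re ≤ 0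
    have h3 : D y ^ 2 - 1 = (((discriminant L p (E + y)).re ^ 2 - 1 : ℝ) : ℂ) := by
      push_cast
      rw [← h1]
    rw [h3, Complex.ofReal_im, Complex.ofReal_re]
    refine ⟨rfl, ?_⟩
    have := sq_le_one_iff_abs_le_one _ |>.2 h2
    linarith)
  simp only [Pi.sub_apply, Pi.pow_apply] at hw2
  change ∀ᶠ y in 𝓝 (0 : ℂ), D y ^ 2 - 1 = -w y ^ 2 at hw2
  -- On the real line `D` and `w` are real with `D² + w² = 1`, so `r` is unimodular there. By
  -- reflection `|r| < 1` on one side of the line means `|r| > 1` on the other, and either `r` or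
  -- `r⁻¹` is the multiplier in the upper half disc.
  set r : ℂ → ℂ := fun y => D y + Complex.I * w y with hr
  have hran : AnalyticAt ℂ r 0 := (hDan 0).add (analyticAt_const.mul hw)
  have hq : ∀ᶠ y in 𝓝 (0 : ℂ), r y ^ 2 - 2 * D y * r y + 1 = 0 := by
    filter_upwards [hw2] with y hy
    simp only [hr]
    linear_combination -hy + (w y) ^ 2 * Complex.I_sq
  have hone : ∀ᶠ y in 𝓝 (0 : ℂ), y.im = 0 → ‖r y‖ = 1 := by
    filter_upwards [hw2, hwre] with y h1 h2 h3
    have h4 : D y = ((D y).re : ℂ) := discriminant_eq_re hp (by rw [him, h3])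
    have h5 : w y = ((w y).re : ℂ) := Complex.ext rfl (by simpa using h2 h3)
    have h6 : (D y).re ^ 2 + (w y).re ^ 2 = 1 := by
      rw [h4, h5] at h1
      have : (D y).re ^ 2 - 1 = -(w y).re ^ 2 := by exact_mod_cast h1
      linarith
    have h7 : ‖r y‖ ^ 2 = 1 := by
      rw [Complex.sq_norm, Complex.normSq_apply]
      simp only [hr]
      rw [h4, h5]
      simp
      linarith
    exact (pow_eq_one_iff_of_nonneg (norm_nonneg _) two_ne_zero).1 h7
  have hrefl := reflection hran hone
  obtain ⟨δ, hδ, hball⟩ := Metric.eventually_nhds_iff_ball.1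
    ((hq.and hrefl).and hran.eventually_analyticAt)
  set U : Set ℂ := Metric.ball 0 δ ∩ {s | 0 < s.im} with hU
  have hUconv : Convex ℝ U := (convex_ball 0 δ).inter (convex_halfSpace_im_gt 0)
  have hneU : ∀ s ∈ U, ‖r s‖ ≠ 1 := fun s hs =>
    norm_ne_one_of_root hp hper hL (hnot s (ne_of_gt hs.2)) (hball s hs.1).1.1
  have hcontU : ContinuousOn (fun s => ‖r s‖) U := fun s hs =>
    (hball s hs.1).2.continuousAt.norm.continuousWithinAt
  have hball' : ∀ᶠ s in 𝓝 (0 : ℂ), s ∈ Metric.ball (0 : ℂ) δ := Metric.ball_mem_nhds 0 hδ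
  have hconj : ∀ y ∈ Metric.ball (0 : ℂ) δ, y.im < 0 → starRingEnd ℂ y ∈ U := fun y hy hy0 => by
    refine ⟨?_, by simpa using hy0⟩
    rw [mem_ball_zero_iff] at hy ⊢
    rwa [RCLike.norm_conj]
  have hnorm : ∀ y ∈ Metric.ball (0 : ℂ) δ, ‖r (starRingEnd ℂ y)‖ * ‖r y‖ = 1 := fun y hy => by
    have := congrArg norm (hball y hy).1.2
    rwa [norm_mul, RCLike.norm_conj, norm_one] at this
  have hr0 : ∀ y ∈ Metric.ball (0 : ℂ) δ, r y ≠ 0 := fun y hy h => by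
    have := hnorm y hy
    rw [h, norm_zero, mul_zero] at this
    exact zero_ne_one this
  have hinv : ∀ y ∈ Metric.ball (0 : ℂ) δ,
      (r y)⁻¹ ^ 2 - 2 * D y * (r y)⁻¹ + 1 = 0 := fun y hy => by
    have h1 := hr0 y hy
    have h2 := (hball y hy).1.1
    field_simp
    linear_combination h2
  rcases lt_one_or_one_lt hUconv.isPreconnected hcontU hneU with h | h
  · refine ⟨r, hran, ?_⟩
    filter_upwards [hball'] with y hy
    refine ⟨(hball y hy).1.1, fun h1 => ?_, fun h1 => ?_⟩
    · exact (floquetMultiplier_unique hp hper hL (hnot y h1.ne') (hball y hy).1.1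
        (h y ⟨hy, h1⟩)).symm
    · refine (floquetMultiplier_unique hp hper hL (hnot y h1.ne) (hinv y hy) ?_).symm
      have h2 := h _ (hconj y hy h1)
      rw [norm_inv, ← eq_inv_of_mul_eq_one_left (hnorm y hy)]
      exact h2
  · refine ⟨fun y => (r y)⁻¹, hran.inv (hr0 0 (Metric.mem_ball_self hδ)), ?_⟩
    filter_upwards [hball'] with y hy
    refine ⟨hinv y hy, fun h1 => ?_, fun h1 => ?_⟩
    · refine (floquetMultiplier_unique hp hper hL (hnot y h1.ne') (hinv y hy) ?_).symm
      rw [norm_inv]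
      exact inv_lt_one_of_one_lt₀ (h y ⟨hy, h1⟩)
    · rw [inv_inv]
      refine (floquetMultiplier_unique hp hper hL (hnot y h1.ne) (hball y hy).1.1 ?_).symm
      have h2 := h _ (hconj y hy h1)
      have h3 := hnorm y hy
      by_contra! hcon
      nlinarith

end

section

open scoped Matrix.Norms.Operator

/-! ### The extended time factors -/

variable {q : ℝ → ℝ → ℂ} {z : ℂ} {L : ℝ} {t τ : ℝ} {ε : ℤˣ}

/-- Every real point off the set `B` lies in a gap. -/
def GapsCover (B : Set ℂ) : Prop := ∀ x : ℝ, (x : ℂ) ∉ B → ∃ a b : ℝ, IsGap B a b ∧ x ∈ Ioo a b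

/-- The meromorphic extension of the time factor to the complement of the spectrum. -/
def extFactor (L : ℝ) (q : ℝ → ℝ → ℂ) (ε : ℤˣ) (t : ℝ) : ℂ → ℂ :=
  toMeromorphicNFOn (preFactor L q ε t) (spec q)ᶜ

theorem IsPeriodicNLSSolution.not_mem_laxSpectrum (hq : IsPeriodicNLSSolution L (uIcc 0 t) q)
    (hL : 0 < L) (hτ : τ ∈ uIcc 0 t) (hz : z ∉ spec q) : z ∉ laxSpectrum (slice q τ) := by
  rwa [hq.laxSpectrum_eq hL hτ]

theorem IsPeriodicNLSSolution.isOpen_compl_spec (hq : IsPeriodicNLSSolution L (uIcc 0 t) q)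
    (hL : 0 < L) : IsOpen (spec q)ᶜ :=
  (isClosed_laxSpectrum (hq.continuous_slice left_mem_uIcc)
    (hq.slice_add left_mem_uIcc) hL).isOpen_compl

theorem IsPeriodicNLSSolution.im_spec (hq : IsPeriodicNLSSolution L (uIcc 0 t) q)
    (hL : 0 < L) (hz : z ∈ spec q) : z.im = 0 :=
  im_eq_zero_of_mem_laxSpectrum (hq.continuous_slice left_mem_uIcc)
    (hq.slice_add left_mem_uIcc) hL hz

theorem IsPeriodicNLSSolution.meromorphicOn_preFactor
    (hq : IsPeriodicNLSSolution L (uIcc 0 t) q) (hL : 0 < L) :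
    MeromorphicOn (preFactor L q ε t) (spec q)ᶜ := by
  intro z hz
  have h0 : (0 : ℝ) ∈ uIcc 0 t := left_mem_uIcc
  have hp := hq.continuous_slice h0
  have hT := fun i j => (hq.differentiable_transport t i j).analyticAt z
  have hm := fun i j => analyticAt_modMonodromy (L := L) hp hL.le z i j
  have hr := analyticAt_multiplier hp (hq.slice_add h0) hL hz ε
  exact (hT 0 0).meromorphicAt.add ((hT 0 1).meromorphicAt.mul
    ((hr.sub (hm 0 0)).meromorphicAt.div (hm 0 1).meromorphicAt))

theorem IsPeriodicNLSSolution.analyticAt_preFactor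
    (hq : IsPeriodicNLSSolution L (uIcc 0 t) q) (hL : 0 < L) (hz : z ∉ spec q)
    (h : modMonodromy L (slice q 0) z 0 1 ≠ 0) : AnalyticAt ℂ (preFactor L q ε t) z := by
  have h0 : (0 : ℝ) ∈ uIcc 0 t := left_mem_uIcc
  have hp := hq.continuous_slice h0
  have hT := fun i j => (hq.differentiable_transport t i j).analyticAt z
  have hm := fun i j => analyticAt_modMonodromy (L := L) hp hL.le z i j
  have hr := analyticAt_multiplier hp (hq.slice_add h0) hL hz ε
  exact (hT 0 0).add ((hT 0 1).mul ((hr.sub (hm 0 0)).div (hm 0 1) h))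

/-- The normal form can differ from the explicit formula only where the latter divides by zero, at
Dirichlet eigenvalues of the initial potential. -/
theorem IsPeriodicNLSSolution.extFactor_eq
    (hq : IsPeriodicNLSSolution L (uIcc 0 t) q) (hL : 0 < L) (hz : z ∉ spec q)
    (h : modMonodromy L (slice q 0) z 0 1 ≠ 0) :
    extFactor L q ε t z = preFactor L q ε t z := by
  rw [extFactor, toMeromorphicNFOn_eq_toMeromorphicNFAt (hq.meromorphicOn_preFactor hL) hz,
    toMeromorphicNFAt_eq_self.2 (hq.analyticAt_preFactor hL hz h).meromorphicNFAt]

theorem IsPeriodicNLSSolution.modMonodromy_ne_zero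
    (hq : IsPeriodicNLSSolution L (uIcc 0 t) q) (hL : 0 < L) (hτ : τ ∈ uIcc 0 t)
    (hz : z.im ≠ 0) : modMonodromy L (slice q τ) z 0 1 ≠ 0 := fun h =>
  hz (im_eq_zero_of_mem_dirichletSpectrum (hq.continuous_slice hτ) hL
    ((mem_dirichletSpectrum_iff (hq.continuous_slice hτ)).2 h))

theorem IsPeriodicNLSSolution.extFactor_eq_of_im_ne_zero
    (hq : IsPeriodicNLSSolution L (uIcc 0 t) q) (hL : 0 < L) (hz : z.im ≠ 0) :
    extFactor L q ε t z = preFactor L q ε t z :=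
  hq.extFactor_eq hL (fun h => hz (hq.im_spec hL h)) (hq.modMonodromy_ne_zero hL left_mem_uIcc hz)

theorem IsPeriodicNLSSolution.continuousAt_extFactor
    (hq : IsPeriodicNLSSolution L (uIcc 0 t) q) (hL : 0 < L) (hz : z.im ≠ 0) :
    ContinuousAt (extFactor L q ε t) z := by
  have h1 := hq.analyticAt_preFactor (ε := ε) hL (fun h => hz (hq.im_spec hL h))
    (hq.modMonodromy_ne_zero hL left_mem_uIcc hz)
  refine h1.continuousAt.congr ?_
  filter_upwards [Complex.continuous_im.continuousAt.eventually_ne hz] with w hw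
  exact (hq.extFactor_eq_of_im_ne_zero hL hw).symm

theorem IsPeriodicNLSSolution.extFactor_eq_timeFactor
    (hq : IsPeriodicNLSSolution L (uIcc 0 t) q) (hL : 0 < L) (hz : z ∉ spec q)
    (h : z.im ≠ 0 ∨ ∀ τ ∈ uIcc 0 t, z ∉ dirichletSpectrum L (slice q τ)) :
    extFactor L q ε t z = timeFactor L q ε t z := by
  have key : ∀ τ ∈ uIcc 0 t, modMonodromy L (slice q τ) z 0 1 ≠ 0 := by
    intro τ hτ
    rcases h with h | h
    · exact hq.modMonodromy_ne_zero hL hτ h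
    · exact fun h2 => h τ hτ ((mem_dirichletSpectrum_iff (hq.continuous_slice hτ)).2 h2)
  rw [hq.extFactor_eq hL hz (key 0 left_mem_uIcc), hq.timeFactor_eq hL hz key]

theorem movableInd_eq_of_mem {s : ℤ} (h : z ∈ movableDirichlet L (slice q t) s) :
    movableInd L q t s z = 1 := by
  simp [movableInd, h]

theorem movableInd_eq_of_not_mem {s : ℤ} (h : z ∉ movableDirichlet L (slice q t) s) :
    movableInd L q t s z = 0 := by
  simp [movableInd, h]

theorem IsPeriodicNLSSolution.mem_movableDirichlet
    (hq : IsPeriodicNLSSolution L (uIcc 0 t) q) (hL : 0 < L) (hgap : GapsCover (spec q))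
    (hτ : τ ∈ uIcc 0 t) (hz : z ∉ spec q) (h1 : z ∈ dirichletSpectrum L (slice q τ)) {s : ℤ}
    (h2 : dirichletSign L (slice q τ) z = s) : z ∈ movableDirichlet L (slice q τ) s := by
  have him := im_eq_zero_of_mem_dirichletSpectrum (hq.continuous_slice hτ) hL h1
  have hre : z = (z.re : ℂ) := Complex.ext rfl (by simpa using him)
  obtain ⟨a, b, hab, hx⟩ := hgap z.re (by rwa [← hre])
  refine ⟨h1, h2, a, b, ?_, z.re, Ioo_subset_Icc_self hx, hre⟩
  rwa [hq.laxSpectrum_eq hL hτ]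

theorem IsPeriodicNLSSolution.exists_blochFrame_movable
    (hq : IsPeriodicNLSSolution L (uIcc 0 t) q) (hL : 0 < L) (hgap : GapsCover (spec q))
    (hτ : τ ∈ uIcc 0 t) (hz : z ∉ spec q) (ε : ℤˣ) : ∃ n : ℕ,
      BlochFrame (fun z => modMonodromy L (slice q τ) z) (multiplier L (slice q 0) ε) z n ∧
      (n : ℤ) = movableInd L q τ ε z := by
  obtain ⟨n, hn, h⟩ := exists_blochFrame (hq.continuous_slice hτ) (hq.slice_add hτ) hL
    (hq.not_mem_laxSpectrum hL hτ hz) ε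
  have hm : multiplier L (slice q τ) ε = multiplier L (slice q 0) ε := funext fun w => by
    rw [multiplier, hq.floquetMultiplier_eq hL.le hτ, multiplier]
  rw [hm] at hn
  refine ⟨n, hn, ?_⟩
  rcases h with ⟨rfl, h1, h2⟩ | ⟨rfl, h1⟩
  · rw [movableInd_eq_of_mem (hq.mem_movableDirichlet hL hgap hτ hz h1 h2)]; rfl
  · rw [movableInd_eq_of_not_mem fun h => h1 ⟨h.1, h.2.1⟩]; rfl

theorem sq_ne_one_of_norm {r : ℂ} (h : ‖r‖ ≠ 1) : r ^ 2 ≠ 1 := fun h2 => h (by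
  have := congrArg norm h2
  rw [norm_pow, norm_one] at this
  exact (pow_eq_one_iff_of_nonneg (norm_nonneg _) two_ne_zero).1 this)

theorem IsPeriodicNLSSolution.det_transport_ne_zero
    (hq : IsPeriodicNLSSolution L (uIcc 0 t) q) (z : ℂ) (τ : ℝ) :
    (transport q t z τ).det ≠ 0 := by
  rw [(hq.isFund_transport z).det]
  exact one_ne_zero

/-- The order of the time factors off the spectrum. -/
theorem IsPeriodicNLSSolution.meromorphicOrderAt_extFactor
    (hq : IsPeriodicNLSSolution L (uIcc 0 t) q) (hL : 0 < L) (hgap : GapsCover (spec q))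
    (hz : z ∉ spec q) (ε : ℤˣ) : meromorphicOrderAt (extFactor L q ε t) z =
      ((movableInd L q t ε z - movableInd L q 0 ε z : ℤ) : WithTop ℤ) := by
  have h0 : (0 : ℝ) ∈ uIcc 0 t := left_mem_uIcc
  have ht : t ∈ uIcc 0 t := right_mem_uIcc
  obtain ⟨n₀, hn₀, e₀⟩ := hq.exists_blochFrame_movable hL hgap h0 hz ε
  obtain ⟨n₁, hn₁, e₁⟩ := hq.exists_blochFrame_movable hL hgap ht hz ε
  rw [extFactor, meromorphicOrderAt_toMeromorphicNFOn (hq.meromorphicOn_preFactor hL) hz,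
    meromorphicOrderAt_eq_int_iff (hq.meromorphicOn_preFactor hL z hz), ← e₀, ← e₁]
  have hnear : ∀ᶠ s in 𝓝[≠] z, s ∉ spec q :=
    nhdsWithin_le_nhds ((hq.isOpen_compl_spec hL).mem_nhds hz)
  have hspec : ∀ s, s ∉ spec q → multiplier L (slice q 0) ε s ^ 2 -
      2 * discriminant L (slice q 0) s * multiplier L (slice q 0) ε s + 1 = 0 := fun s hs =>
    multiplier_spec (hq.continuous_slice h0) (hq.slice_add h0) hL hs ε
  exact hn₀.exists_order hn₁ (T := fun s => transport q t s t)
    (fun i j => (hq.differentiable_transport t i j).analyticAt z)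
    (hq.det_transport_ne_zero z t) (fun s => hq.modMonodromy_mul_transport hL.le ht s)
    (hnear.mono fun s hs => (isMultiplier_iff (hq.continuous_slice h0)).2 (hspec s hs))
    (hnear.mono fun s hs => (isMultiplier_iff (hq.continuous_slice ht)).2 (by
      rw [hq.discriminant_eq_zero hL.le ht]; exact hspec s hs))
    (hnear.mono fun s hs => sq_ne_one_of_norm
      (norm_multiplier_ne_one (hq.continuous_slice h0) (hq.slice_add h0) hL hs ε))

/-! ### Endpoints of gaps -/

theorem eventually_analytic_ne {f : ℂ → ℂ} {c : ℂ} (hf : AnalyticAt ℂ f c) (h : deriv f c ≠ 0) :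
    ∀ᶠ z in 𝓝[≠] c, f z ≠ f c := by
  obtain ⟨g, hg, hg0, hfg⟩ := exists_analytic_factor (hf.sub analyticAt_const) (sub_self (f c))
  have hd : deriv (f - fun _ => f c) c = deriv f c := by
    have := (hf.differentiableAt.hasDerivAt.sub (hasDerivAt_const c (f c)))
    rw [sub_zero] at this
    exact this.deriv
  have h1 : ∀ᶠ z in 𝓝 c, g z ≠ 0 := hg.continuousAt.eventually_ne (by rwa [hg0, hd])
  filter_upwards [nhdsWithin_le_nhds h1, self_mem_nhdsWithin] with z hz hzc h2
  have := hfg z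
  rw [Pi.sub_apply, h2, sub_self] at this
  exact mul_ne_zero (sub_ne_zero.2 hzc) hz this.symm

theorem sq_eq_one_imp {a b : ℂ} (ha : a ^ 2 = 1) (hb : b ^ 2 = 1) : a = b ∨ a = -b := by
  rw [← sq_eq_sq_iff_eq_or_eq_neg, ha, hb]

/-- Near `0` the value `-r 0` is excluded by continuity and the value `r 0` by the nonzero
derivative. So the two multipliers differ in a punctured neighbourhood of an endpoint. -/
theorem eventually_sq_ne_one {r : ℂ → ℂ} (hr : AnalyticAt ℂ r 0) (h0 : r 0 ^ 2 = 1)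
    (h' : deriv r 0 ≠ 0) : ∀ᶠ s in 𝓝[≠] (0 : ℂ), r s ^ 2 ≠ 1 := by
  have hne : r 0 ≠ 0 := fun h => by simp [h] at h0
  have h1 : r 0 ≠ -r 0 := fun h => hne (by linear_combination h / 2)
  filter_upwards [eventually_analytic_ne hr h',
    nhdsWithin_le_nhds (hr.continuousAt.eventually_ne h1)] with s h2 h3 h4
  rcases sq_eq_one_imp h4 h0 with h | h
  · exact h2 h
  · exact h3 h

theorem IsPeriodicNLSSolution.movableInd_endpoint
    (hq : IsPeriodicNLSSolution L (uIcc 0 t) q) (hL : 0 < L) (hτ : τ ∈ uIcc 0 t) {E : ℝ}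
    (hE : ∃ a b, IsGap (spec q) a b ∧ E ∈ Icc a b) {n : ℕ}
    (h : n = 1 ∧ (E : ℂ) ∈ dirichletSpectrum L (slice q τ) ∧ dirichletSign L (slice q τ) E = 0 ∨
        n = 0 ∧ (E : ℂ) ∉ dirichletSpectrum L (slice q τ)) :
    (n : ℤ) = movableInd L q τ 0 E := by
  rcases h with ⟨rfl, h1, h2⟩ | ⟨rfl, h1⟩
  · obtain ⟨a, b, hab, hEab⟩ := hE
    rw [movableInd_eq_of_mem ⟨h1, h2, a, b, by rwa [hq.laxSpectrum_eq hL hτ], E, hEab, rfl⟩]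
    rfl
  · rw [movableInd_eq_of_not_mem fun h => h1 h.1]; rfl

/-- The time factors near the endpoint `E` of a gap, in the parameter `s` with `z = E + d s²`. -/
theorem IsPeriodicNLSSolution.exists_endpoint_factor
    (hq : IsPeriodicNLSSolution L (uIcc 0 t) q) (hL : 0 < L) {E d : ℝ} (hd : d ≠ 0)
    (hE : (E : ℂ) ∈ spec q) (hgap : ∃ᶠ x : ℝ in 𝓝[>] 0, (E + d * x : ℂ) ∉ spec q)
    (hmem : ∃ a b, IsGap (spec q) a b ∧ E ∈ Icc a b) :
    ∃ H : ℂ → ℂ, AnalyticAt ℂ H 0 ∧ H 0 ≠ 0 ∧ ∀ᶠ s in 𝓝 (0 : ℂ), 0 < s.re → ∀ ε : ℤˣ,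
      extFactor L q ε t (E + d * s ^ 2) =
        ((ε : ℤ) * s) ^ (movableInd L q t 0 E - movableInd L q 0 0 E) * H ((ε : ℤ) * s) := by
  have h0 : (0 : ℝ) ∈ uIcc 0 t := left_mem_uIcc
  have ht : t ∈ uIcc 0 t := right_mem_uIcc
  have hp := hq.continuous_slice h0
  have hper := hq.slice_add h0
  obtain ⟨r, hr, hr0, hr', hDr, hrq, hrm, -⟩ := exists_endpoint_multiplier hp hper hL hd hE hgap
  obtain ⟨n₀, hn₀, e₀⟩ := exists_blochFrame_endpoint hp hL hd hr hr0 hr' hDr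
  obtain ⟨n₁, hn₁, e₁⟩ := exists_blochFrame_endpoint (hq.continuous_slice ht) hL hd hr hr0 hr'
    ((hq.discriminant_eq_zero hL.le ht _).trans hDr)
  obtain ⟨H, hH, hH0, hF⟩ := hn₀.exists_order hn₁
    (T := fun s => transport q t (E + d * s ^ 2) t)
    (fun i j => AnalyticAt.comp (g := fun z => transport q t z t i j)
      ((hq.differentiable_transport t i j).analyticAt _) (by fun_prop))
    (hq.det_transport_ne_zero _ t) (fun s => hq.modMonodromy_mul_transport hL.le ht _)
    (nhdsWithin_le_nhds (hrq.mono fun s hs => (isMultiplier_iff hp).2 hs.1))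
    (nhdsWithin_le_nhds (hrq.mono fun s hs => (isMultiplier_iff (hq.continuous_slice ht)).2 (by
      rw [hq.discriminant_eq_zero hL.le ht]; exact hs.1)))
    (eventually_sq_ne_one hr hr0 hr')
  rw [hq.movableInd_endpoint hL h0 hmem e₀, hq.movableInd_endpoint hL ht hmem e₁] at hF
  simp only [sub_zero] at hF
  refine ⟨H, hH, hH0, ?_⟩
  obtain ⟨j, g, k, hg, -, hg0, -, hgk⟩ := hn₀
  have hneg : Tendsto (fun s : ℂ => -s) (𝓝 0) (𝓝 0) := by
    simpa using (continuous_neg (G := ℂ)).tendsto 0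
  rw [eventually_nhdsWithin_iff] at hF
  filter_upwards [hrq, hrm, hF, hneg.eventually hF, hgk, hg.continuousAt.eventually_ne hg0]
    with s a1 a2 a3 a4 a5 a6 hs ε
  have hs0 : s ≠ 0 := fun h => by simp [h] at hs
  obtain ⟨b1, b2⟩ := a2 hs
  have b3 : modMonodromy L (slice q 0) (E + d * s ^ 2) 0 1 ≠ 0 := by
    rw [a5.1]
    exact mul_ne_zero (pow_ne_zero _ (by simpa using hs0)) a6
  rw [hq.extFactor_eq hL b1 b3, preFactor]
  -- The case `ε = -1` is the same identity at `-s`: this leaves `z` unchanged and inverts the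
  -- multiplier. Hence one function `H` serves both signs.
  rcases Int.units_eq_one_or ε with rfl | rfl
  · simpa [multiplier_one, b2] using a3 hs0
  · have := a4 (neg_ne_zero.2 hs0)
    rw [neg_sq] at this
    rw [multiplier_neg, multiplier_one, b2, ← eq_inv_of_mul_eq_one_right a1.2]
    simpa using this

theorem cpow_half_sq (w : ℂ) : (w ^ (1 / 2 : ℂ)) ^ 2 = w := by
  rw [one_div]
  exact_mod_cast Complex.cpow_nat_inv_pow w two_ne_zero

theorem cpow_half_re_pos {w : ℂ} (hw : w ∈ Complex.slitPlane) : 0 < (w ^ (1 / 2 : ℂ)).re := by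
  have h0 : w ≠ 0 := Complex.slitPlane_ne_zero hw
  rw [Complex.cpow_def_of_ne_zero h0, Complex.exp_re]
  refine mul_pos (Real.exp_pos _) (Real.cos_pos_of_mem_Ioo ?_)
  have h1 : (Complex.log w * (1 / 2 : ℂ)).im = w.arg / 2 := by
    rw [show (1 / 2 : ℂ) = ((1 / 2 : ℝ) : ℂ) by norm_num, Complex.im_mul_ofReal, Complex.log_im]
    ring
  rw [h1]
  have h2 := Complex.neg_pi_lt_arg w
  have h3 := lt_of_le_of_ne (Complex.arg_le_pi w) (Complex.mem_slitPlane_iff_arg.1 hw).1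
  constructor <;> linarith

theorem tendsto_cpow_half : Tendsto (fun w : ℂ => w ^ (1 / 2 : ℂ)) (𝓝 0) (𝓝 0) := by
  have : ContinuousAt (fun w : ℂ => w ^ (1 / 2 : ℂ)) 0 :=
    Complex.continuousAt_cpow_const_of_re_pos (Or.inl le_rfl) (by norm_num)
  have h2 := this.tendsto
  rwa [Complex.zero_cpow (by norm_num)] at h2

/-- The square root behaviour of the time factors at the endpoint `E` of a gap. -/
theorem IsPeriodicNLSSolution.exists_sqrtOrder
    (hq : IsPeriodicNLSSolution L (uIcc 0 t) q) (hL : 0 < L) {E d : ℝ} (hd : d * d = 1)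
    (hE : (E : ℂ) ∈ spec q) (hgap : ∃ᶠ x : ℝ in 𝓝[>] 0, (E + d * x : ℂ) ∉ spec q)
    (hmem : ∃ a b, IsGap (spec q) a b ∧ E ∈ Icc a b) :
    ∃ H : ℂ → ℂ, AnalyticAt ℂ H 0 ∧ H 0 ≠ 0 ∧ ∀ ε : ℤˣ, ∀ᶠ z in 𝓝[(spec q)ᶜ] (E : ℂ),
      extFactor L q ε t z =
        ((ε : ℤ) * (d * (z - E)) ^ (1 / 2 : ℂ)) ^ (movableInd L q t 0 E - movableInd L q 0 0 E) *
          H ((ε : ℤ) * (d * (z - E)) ^ (1 / 2 : ℂ)) := by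
  have hd0 : d ≠ 0 := fun h => by simp [h] at hd
  have hdc : (d : ℂ) * d = 1 := by exact_mod_cast hd
  have h0 : (0 : ℝ) ∈ uIcc 0 t := left_mem_uIcc
  obtain ⟨-, -, -, -, -, -, -, hslit⟩ :=
    exists_endpoint_multiplier (hq.continuous_slice h0) (hq.slice_add h0) hL hd0 hE hgap
  obtain ⟨H, hH, hH0, hF⟩ := hq.exists_endpoint_factor hL hd0 hE hgap hmem
  refine ⟨H, hH, hH0, fun ε => ?_⟩
  have hlin : Tendsto (fun z : ℂ => d * (z - E)) (𝓝 (E : ℂ)) (𝓝 0) := by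
    have : Continuous fun z : ℂ => d * (z - E) := by fun_prop
    simpa using this.tendsto (E : ℂ)
  rw [eventually_nhdsWithin_iff]
  filter_upwards [hlin.eventually hslit, (tendsto_cpow_half.comp hlin).eventually hF]
    with z h1 h2 h3
  have e1 : (E : ℂ) + d * (d * (z - E)) = z := by linear_combination (z - E) * hdc
  rw [e1] at h1
  have h4 := h2 (cpow_half_re_pos (h1 h3)) ε
  simp only [Function.comp] at h4
  rw [cpow_half_sq, e1] at h4
  exact h4

theorem analyticAt_sign_comp {H : ℂ → ℂ} (hH : AnalyticAt ℂ H 0) (ε : ℤˣ) :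
    AnalyticAt ℂ (fun s => H ((ε : ℤ) * s)) 0 :=
  AnalyticAt.comp (g := H) (by simpa using hH) (by fun_prop)

theorem IsPeriodicNLSSolution.hasSqrtOrder_extFactor
    (hq : IsPeriodicNLSSolution L (uIcc 0 t) q) (hL : 0 < L) {E d : ℝ} (hd : d * d = 1)
    (hE : (E : ℂ) ∈ spec q) (hgap : ∃ᶠ x : ℝ in 𝓝[>] 0, (E + d * x : ℂ) ∉ spec q)
    (hmem : ∃ a b, IsGap (spec q) a b ∧ E ∈ Icc a b) (ε : ℤˣ) :
    HasSqrtOrder (extFactor L q ε t) (spec q) E d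
      (movableInd L q t 0 E - movableInd L q 0 0 E) := by
  obtain ⟨H, hH, hH0, hF⟩ := hq.exists_sqrtOrder hL hd hE hgap hmem
  set n := movableInd L q t 0 E - movableInd L q 0 0 E
  refine ⟨fun s => ((ε : ℤ) : ℂ) ^ n * H ((ε : ℤ) * s),
    analyticAt_const.mul (analyticAt_sign_comp hH ε), ?_, ?_⟩
  · beta_reduce
    rw [mul_zero]
    exact mul_ne_zero (zpow_ne_zero _ (by simp)) hH0
  · filter_upwards [hF ε] with z hz
    rw [hz, mul_zpow]
    ring

theorem IsPeriodicNLSSolution.nonreal_le (hq : IsPeriodicNLSSolution L (uIcc 0 t) q)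
    (hL : 0 < L) {s : Set ℂ} (hs : ∀ w ∈ s, w.im ≠ 0) : s ⊆ (spec q)ᶜ := fun w hw h =>
  hs w hw (hq.im_spec hL h)

/-- Both factors are given by one function of `s`, evaluated at `s` and at `-s`. When the exponent
is nonnegative, both tend to its value at `s = 0`. -/
theorem IsPeriodicNLSSolution.boundary_endpoint
    (hq : IsPeriodicNLSSolution L (uIcc 0 t) q) (hL : 0 < L) {E d : ℝ} (hd : d * d = 1)
    (hE : (E : ℂ) ∈ spec q) (hgap : ∃ᶠ x : ℝ in 𝓝[>] 0, (E + d * x : ℂ) ∉ spec q)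
    (hmem : ∃ a b, IsGap (spec q) a b ∧ E ∈ Icc a b)
    (hn : 0 ≤ movableInd L q t 0 E - movableInd L q 0 0 E) :
    ∃ ℓ : ℂ, ∀ ε : ℤˣ, HasUpperValue (extFactor L q ε t) E ℓ ∧
      HasLowerValue (extFactor L q ε t) E ℓ := by
  obtain ⟨H, hH, hH0, hF⟩ := hq.exists_sqrtOrder hL hd hE hgap hmem
  obtain ⟨n, hn⟩ := Int.eq_ofNat_of_zero_le hn
  rw [hn] at hF
  have hlin : Tendsto (fun z : ℂ => d * (z - E)) (𝓝 (E : ℂ)) (𝓝 0) := by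
    have : Continuous fun z : ℂ => d * (z - E) := by fun_prop
    simpa using this.tendsto (E : ℂ)
  have hk : ∀ ε : ℤˣ, Tendsto (fun s : ℂ => ((ε : ℤ) * s) ^ n * H ((ε : ℤ) * s)) (𝓝 0)
      (𝓝 (0 ^ n * H 0)) := fun ε => by
    have h1 : AnalyticAt ℂ (fun s : ℂ => ((ε : ℤ) * s) ^ n) 0 := by fun_prop
    have h2 := (h1.fun_mul (analyticAt_sign_comp hH ε)).continuousAt.tendsto
    simpa using h2
  have key : ∀ ε : ℤˣ, Tendsto (extFactor L q ε t) (𝓝[(spec q)ᶜ] (E : ℂ))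
      (𝓝 (0 ^ n * H 0)) := fun ε => by
    refine (((hk ε).comp (tendsto_cpow_half.comp hlin)).mono_left nhdsWithin_le_nhds).congr' ?_
    filter_upwards [hF ε] with z hz
    rw [hz]
    simp
  exact ⟨_, fun ε => ⟨(key ε).mono_left (nhdsWithin_mono _
      (hq.nonreal_le hL fun w (hw : 0 < w.im) => hw.ne')),
    (key ε).mono_left (nhdsWithin_mono _ (hq.nonreal_le hL fun w (hw : w.im < 0) => hw.ne))⟩⟩

/-! ### Interior points of the spectrum -/

/-- At an interior point of the spectrum, the time factors continue analytically across it. -/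
theorem IsPeriodicNLSSolution.exists_interior_factor
    (hq : IsPeriodicNLSSolution L (uIcc 0 t) q) (hL : 0 < L) {E : ℝ}
    (hE : ∀ᶠ y in 𝓝 (0 : ℂ), y.im = 0 → (E + y : ℂ) ∈ spec q) (ε : ℤˣ) :
    ∃ k : ℂ → ℂ, AnalyticAt ℂ k E ∧ ∀ᶠ w in 𝓝 (E : ℂ),
      (0 < w.im → extFactor L q ε t w = k w) ∧ (w.im < 0 → extFactor L q (-ε) t w = k w) := by
  have h0 : (0 : ℝ) ∈ uIcc 0 t := left_mem_uIcc
  have hp := hq.continuous_slice h0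
  have hper := hq.slice_add h0
  obtain ⟨r₀, hr₀, hq₀⟩ := exists_interior_multiplier hp hper hL hE
  have hlin : Tendsto (fun z : ℂ => z - E) (𝓝 (E : ℂ)) (𝓝 0) := by
    have : Continuous fun z : ℂ => z - E := by fun_prop
    simpa using this.tendsto (E : ℂ)
  obtain ⟨r, hr, hrw⟩ : ∃ r : ℂ → ℂ, AnalyticAt ℂ r E ∧ ∀ᶠ w in 𝓝 (E : ℂ),
      r w ^ 2 - 2 * discriminant L (slice q 0) w * r w + 1 = 0 ∧
      (0 < w.im → multiplier L (slice q 0) ε w = r w) ∧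
      (w.im < 0 → multiplier L (slice q 0) (-ε) w = r w) := by
    have hc : AnalyticAt ℂ (fun w : ℂ => r₀ (w - E)) E :=
      AnalyticAt.comp (g := r₀) (by simpa using hr₀) (by fun_prop)
    have hw0 : ∀ w : ℂ, (E : ℂ) + (w - E) = w := fun w => by ring
    rcases Int.units_eq_one_or ε with rfl | rfl
    · refine ⟨fun w => r₀ (w - E), hc, ?_⟩
      filter_upwards [hlin.eventually hq₀] with w hw
      rw [hw0] at hw
      refine ⟨hw.1, fun h => ?_, fun h => ?_⟩
      · rw [multiplier_one]; exact hw.2.1 (by simpa using h)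
      · rw [multiplier_neg, multiplier_one, hw.2.2 (by simpa using h), inv_inv]
    · have hne : ∀ w, r₀ w ^ 2 - 2 * discriminant L (slice q 0) (E + w) * r₀ w + 1 = 0 →
        r₀ w ≠ 0 := fun w h h1 => by simp [h1] at h
      refine ⟨fun w => (r₀ (w - E))⁻¹, hc.inv (by
        simpa using hne 0 (hq₀.self_of_nhds.1)), ?_⟩
      filter_upwards [hlin.eventually hq₀] with w hw
      have h1 := hne _ hw.1
      rw [hw0] at hw
      refine ⟨?_, fun h => ?_, fun h => ?_⟩
      · have h2 := hw.1
        field_simp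
        linear_combination h2
      · rw [multiplier_neg, multiplier_one, hw.2.1 (by simpa using h)]
      · rw [neg_neg, multiplier_one]; exact hw.2.2 (by simpa using h)
  have hm := fun i j => analyticAt_modMonodromy (L := L) hp hL.le (E : ℂ) i j
  have hT := fun i j => (hq.differentiable_transport t i j).analyticAt (E : ℂ)
  obtain ⟨k, hk, hkw⟩ : ∃ k : ℂ → ℂ, AnalyticAt ℂ k E ∧ ∀ᶠ w in 𝓝[≠] (E : ℂ),
      (r w - modMonodromy L (slice q 0) w 0 0) / modMonodromy L (slice q 0) w 0 1 = k w := by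
    -- At a Dirichlet eigenvalue in the spectrum the triangular monodromy matrix has real diagonal
    -- entries with product one and sum in `[-2, 2]`. They therefore coincide, both equal `r(E)`,
    -- and the zero of the numerator removes the simple pole.
    by_cases hD : modMonodromy L (slice q 0) E 0 1 = 0
    · refine exists_analytic_quotient (hr.sub (hm 0 0)) (hm 0 1) ?_ hD
        (deriv_modMonodromy_ne_zero hp hL (Complex.ofReal_im _) hD)
      have hdet := det_modMonodromy (L := L) (z := (E : ℂ)) hp
      rw [hD, zero_mul, sub_zero] at hdet
      have hEs : (E : ℂ) ∈ laxSpectrum (slice q 0) := by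
        have := hE.self_of_nhds rfl
        rwa [add_zero] at this
      have hre : ∀ i, modMonodromy L (slice q 0) E i i =
          ((modMonodromy L (slice q 0) E i i).re : ℂ) := fun i =>
        Complex.ext rfl (by simpa using modMonodromy_real hp (Complex.ofReal_im E) i i)
      rw [mem_laxSpectrum_iff_discriminant hp hper hL] at hEs
      obtain ⟨c, hc, hcD⟩ := hEs
      have hquad := hrw.self_of_nhds.1
      rw [discriminant_eq] at hcD hquad
      rw [hre 0, hre 1] at hdet hcD hquad
      change r E - modMonodromy L (slice q 0) E 0 0 = 0
      rw [hre 0]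
      set a := (modMonodromy L (slice q 0) E 0 0).re
      set b := (modMonodromy L (slice q 0) E 1 1).re
      have e1 : a * b = 1 := by exact_mod_cast hdet
      have e2 : (a + b) / 2 = c := by exact_mod_cast hcD
      have e3 : a = b := by
        have : (a - b) ^ 2 ≤ 0 := by
          have : (a - b) ^ 2 = 4 * (c ^ 2 - 1) := by rw [← e2]; linear_combination -4 * e1
          rw [this]
          nlinarith [hc.1, hc.2]
        have := pow_eq_zero_iff two_ne_zero |>.1 (le_antisymm this (sq_nonneg _))
        linarith
      rw [← e3] at hquad e1
      have e1' : (a : ℂ) * a = 1 := by exact_mod_cast e1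
      have : (r E - a) ^ 2 = 0 := by linear_combination hquad + e1'
      exact pow_eq_zero_iff two_ne_zero |>.1 this
    · exact ⟨_, (hr.sub (hm 0 0)).div (hm 0 1) hD, Eventually.of_forall fun w => rfl⟩
  refine ⟨fun w => transport q t w t 0 0 + transport q t w t 0 1 * k w,
    (hT 0 0).add ((hT 0 1).mul hk), ?_⟩
  rw [eventually_nhdsWithin_iff] at hkw
  filter_upwards [hrw, hkw] with w h1 h2
  have hne : w.im ≠ 0 → w ≠ E := fun h h3 => h (by rw [h3, Complex.ofReal_im])
  refine ⟨fun h => ?_, fun h => ?_⟩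
  · rw [hq.extFactor_eq_of_im_ne_zero hL h.ne', preFactor, h1.2.1 h, h2 (hne h.ne')]
  · rw [hq.extFactor_eq_of_im_ne_zero hL h.ne, preFactor, h1.2.2 h, h2 (hne h.ne)]

theorem IsPeriodicNLSSolution.boundary_interior
    (hq : IsPeriodicNLSSolution L (uIcc 0 t) q) (hL : 0 < L) {E : ℝ}
    (hE : ∀ᶠ y in 𝓝 (0 : ℂ), y.im = 0 → (E + y : ℂ) ∈ spec q) (ε : ℤˣ) :
    ∃ ℓ, HasUpperValue (extFactor L q ε t) E ℓ ∧ HasLowerValue (extFactor L q (-ε) t) E ℓ := by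
  obtain ⟨k, hk, hkw⟩ := hq.exists_interior_factor hL hE ε
  refine ⟨k E, ?_, ?_⟩
  · refine (hk.continuousAt.tendsto.mono_left nhdsWithin_le_nhds).congr' ?_
    filter_upwards [nhdsWithin_le_nhds hkw, self_mem_nhdsWithin] with w h1 h2
    exact (h1.1 h2).symm
  · refine (hk.continuousAt.tendsto.mono_left nhdsWithin_le_nhds).congr' ?_
    filter_upwards [nhdsWithin_le_nhds hkw, self_mem_nhdsWithin] with w h1 h2
    exact (h1.2 h2).symm

/-! ### Classification of the points of the spectrum -/

theorem IsGap.frequently_right {B : Set ℂ} {a b : ℝ} (h : IsGap B a b) :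
    ∃ᶠ x : ℝ in 𝓝[>] 0, (a + (1 : ℝ) * x : ℂ) ∉ B := by
  have : ∀ᶠ x : ℝ in 𝓝[>] 0, x ∈ Ioo 0 (b - a) := Ioo_mem_nhdsGT (sub_pos.2 h.1)
  refine (this.mono fun x hx => ?_).frequently
  have := h.2.2.2 (a + x) ⟨by linarith [hx.1], by linarith [hx.2]⟩
  simpa using this

theorem IsGap.frequently_left {B : Set ℂ} {a b : ℝ} (h : IsGap B a b) :
    ∃ᶠ x : ℝ in 𝓝[>] 0, (b + (-1 : ℝ) * x : ℂ) ∉ B := by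
  have : ∀ᶠ x : ℝ in 𝓝[>] 0, x ∈ Ioo 0 (b - a) := Ioo_mem_nhdsGT (sub_pos.2 h.1)
  refine (this.mono fun x hx => ?_).frequently
  have := h.2.2.2 (b - x) ⟨by linarith [hx.2], by linarith [hx.1]⟩
  simpa [sub_eq_add_neg] using this

/-- Points off the spectrum that merely accumulate at `E` from one side already give a whole
one-sided interval off the spectrum, by the local form of the multiplier. The gap that contains this
interval has `E` as an endpoint. -/
theorem IsPeriodicNLSSolution.isGap_endpoint
    (hq : IsPeriodicNLSSolution L (uIcc 0 t) q) (hL : 0 < L) (hcov : GapsCover (spec q))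
    {E d : ℝ} (hd : d * d = 1) (hE : (E : ℂ) ∈ spec q)
    (hgap : ∃ᶠ x : ℝ in 𝓝[>] 0, (E + d * x : ℂ) ∉ spec q) :
    ∃ a b, IsGap (spec q) a b ∧ E ∈ Icc a b := by
  have hd0 : d ≠ 0 := fun h => by simp [h] at hd
  have h0 : (0 : ℝ) ∈ uIcc 0 t := left_mem_uIcc
  obtain ⟨_, -, -, -, -, -, hhalf, -⟩ :=
    exists_endpoint_multiplier (hq.continuous_slice h0) (hq.slice_add h0) hL hd0 hE hgap
  obtain ⟨η, hη, hball⟩ := Metric.eventually_nhds_iff_ball.1 hhalf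
  have hnot : ∀ x : ℝ, 0 < x → x < η ^ 2 → ((E + d * x : ℝ) : ℂ) ∉ spec q := by
    intro x hx hxη
    have h1 : √x < η := by rw [← Real.sqrt_sq hη.le]; exact Real.sqrt_lt_sqrt hx.le hxη
    have h2 := (hball (√x : ℝ) (by
      rw [mem_ball_zero_iff, Complex.norm_real, Real.norm_of_nonneg (Real.sqrt_nonneg x)]
      exact h1) (by simpa using hx)).1
    rw [← Complex.ofReal_pow, Real.sq_sqrt hx.le] at h2
    push_cast
    exact h2
  obtain ⟨x, hx0, hxη⟩ : ∃ x, 0 < x ∧ x < η ^ 2 := exists_between (by positivity)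
  obtain ⟨a, b, hab, hxab⟩ := hcov _ (hnot x hx0 hxη)
  refine ⟨a, b, hab, ?_⟩
  have hEn : E ∉ Ioo a b := fun h => hab.2.2.2 E h hE
  rcases (mul_self_eq_one_iff.1 hd) with rfl | rfl
  · have h1 : E ≤ a := by
      by_contra! h
      exact hEn ⟨h, by linarith [hxab.2]⟩
    have h2 : a ≤ E := by
      by_contra! h
      refine hnot (a - E) (by linarith) (by linarith [hxab.1]) ?_
      have : E + 1 * (a - E) = a := by ring
      rw [this]
      exact hab.2.1
    exact ⟨h2, h1.trans hab.1.le⟩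
  · have h1 : b ≤ E := by
      by_contra! h
      exact hEn ⟨by linarith [hxab.1], h⟩
    have h2 : E ≤ b := by
      by_contra! h
      refine hnot (E - b) (by linarith) (by linarith [hxab.2]) ?_
      have : E + -1 * (E - b) = b := by ring
      rw [this]
      exact hab.2.2.1
    exact ⟨hab.1.le.trans h1, h2⟩

theorem interior_or_frequently {B : Set ℂ} {E : ℝ} (hE : (E : ℂ) ∈ B) :
    (∀ᶠ y in 𝓝 (0 : ℂ), y.im = 0 → (E + y : ℂ) ∈ B) ∨
      ∃ d : ℝ, d * d = 1 ∧ ∃ᶠ x : ℝ in 𝓝[>] 0, (E + d * x : ℂ) ∉ B := by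
  by_contra h
  obtain ⟨h1, h2⟩ := not_or.1 h
  push Not at h2
  have e1 := h2 1 (by norm_num)
  have e2 := h2 (-1) (by norm_num)
  apply h1
  obtain ⟨η₁, hη₁, b₁⟩ := mem_nhdsGT_iff_exists_Ioo_subset.1 e1
  obtain ⟨η₂, hη₂, b₂⟩ := mem_nhdsGT_iff_exists_Ioo_subset.1 e2
  filter_upwards [Metric.ball_mem_nhds (0 : ℂ) hη₁, Metric.ball_mem_nhds (0 : ℂ) hη₂]
    with y hy1 hy2 hy
  rw [mem_ball_zero_iff] at hy1 hy2
  have hyr : y = (y.re : ℂ) := Complex.ext rfl (by simpa using hy)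
  rw [hyr, Complex.norm_real, Real.norm_eq_abs] at hy1 hy2
  rcases lt_trichotomy y.re 0 with h | h | h
  · have := b₂ (show -y.re ∈ Ioo 0 η₂ from ⟨by linarith, by rwa [abs_of_neg h] at hy2⟩)
    simp only [Set.mem_ofPred_eq] at this
    rw [hyr]
    simpa using this
  · rw [hyr, h]; simpa using hE
  · have := b₁ (show y.re ∈ Ioo 0 η₁ from ⟨h, by rwa [abs_of_pos h] at hy1⟩)
    simp only [Set.mem_ofPred_eq] at this
    rw [hyr]
    simpa using this

theorem IsPeriodicNLSSolution.boundary_values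
    (hq : IsPeriodicNLSSolution L (uIcc 0 t) q) (hL : 0 < L) (hcov : GapsCover (spec q))
    (hz : z ∈ spec q) (hn : 0 ≤ movableInd L q t 0 z - movableInd L q 0 0 z) (ε : ℤˣ) :
    ∃ ℓ, HasUpperValue (extFactor L q ε t) z ℓ ∧ HasLowerValue (extFactor L q (-ε) t) z ℓ := by
  have hre : z = (z.re : ℂ) := Complex.ext rfl (by simpa using hq.im_spec hL hz)
  rw [hre] at hz hn ⊢
  rcases interior_or_frequently hz with h | ⟨d, hd, h⟩
  · exact hq.boundary_interior hL h ε
  · obtain ⟨ℓ, hℓ⟩ := hq.boundary_endpoint hL hd hz h (hq.isGap_endpoint hL hcov hd hz h) hn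
    exact ⟨ℓ, (hℓ ε).1, (hℓ (-ε)).2⟩

end

section

open scoped Matrix.Norms.Operator

/-! ### Oscillatory integrals over a period -/

variable {z : ℂ} {L κ : ℝ}

/-- The integral of `g` against the periodic Green's function `e^{2izy} / (e^{2izL} - 1)`. -/
def oscInt (z : ℂ) (L : ℝ) (g : ℝ → ℂ) : ℂ :=
  (∫ y in (0 : ℝ)..L, Complex.exp (2 * Complex.I * z * y) * g y) /
    (Complex.exp (2 * Complex.I * z * L) - 1)

/-- The Green's function is bounded by `κ`. -/
def Nonresonant (κ : ℝ) (z : ℂ) (L : ℝ) : Prop :=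
  Complex.exp (2 * Complex.I * z * L) ≠ 1 ∧ ∀ y ∈ Icc 0 L,
    ‖Complex.exp (2 * Complex.I * z * y)‖ ≤ κ * ‖Complex.exp (2 * Complex.I * z * L) - 1‖

theorem hasDerivAt_expPhase (z : ℂ) (y : ℝ) :
    HasDerivAt (fun y : ℝ => Complex.exp (2 * Complex.I * z * y))
      (Complex.exp (2 * Complex.I * z * y) * (2 * Complex.I * z)) y := by
  have h : HasDerivAt (fun y : ℝ => 2 * Complex.I * z * (y : ℂ)) (2 * Complex.I * z * 1) y :=
    (Complex.ofRealCLM.hasDerivAt (x := y)).const_mul _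
  rw [mul_one] at h
  exact h.cexp

theorem continuous_expPhase (z : ℂ) :
    Continuous fun y : ℝ => Complex.exp (2 * Complex.I * z * y) := by fun_prop

theorem norm_oscInt_le (hL : 0 ≤ L) (h : Nonresonant κ z L) {g : ℝ → ℂ} {G : ℝ}
    (hg : ∀ y ∈ Icc 0 L, ‖g y‖ ≤ G) : ‖oscInt z L g‖ ≤ κ * L * G := by
  have h0 : 0 < ‖Complex.exp (2 * Complex.I * z * L) - 1‖ := norm_pos_iff.2 (sub_ne_zero.2 h.1)
  rw [oscInt, norm_div, div_le_iff₀ h0]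
  have : ‖∫ y in (0 : ℝ)..L, Complex.exp (2 * Complex.I * z * y) * g y‖ ≤
      κ * ‖Complex.exp (2 * Complex.I * z * L) - 1‖ * G * |L - 0| := by
    refine intervalIntegral.norm_integral_le_of_norm_le_const fun y hy => ?_
    rw [uIoc_of_le hL] at hy
    have hy' := Ioc_subset_Icc_self hy
    rw [norm_mul]
    exact mul_le_mul (h.2 y hy') (hg y hy') (norm_nonneg _) ((norm_nonneg _).trans (h.2 y hy'))
  rw [sub_zero, abs_of_nonneg hL] at this
  linarith

theorem oscInt_add_const_mul {f g : ℝ → ℂ} (hf : Continuous f) (hg : Continuous g) (c : ℂ) :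
    oscInt z L (fun y => f y + c * g y) = oscInt z L f + c * oscInt z L g := by
  have hc := continuous_expPhase z
  simp only [oscInt]
  rw [← mul_div_assoc, ← add_div, ← intervalIntegral.integral_const_mul,
    ← intervalIntegral.integral_add ((by fun_prop : Continuous _).intervalIntegrable _ _)
      ((by fun_prop : Continuous _).intervalIntegrable _ _)]
  congr 2
  funext y
  ring

/-- `oscInt` evaluates at `0` the periodic solution of `g' + 2izg = f`: multiplied by the phase, the
left side is an exact derivative. -/
theorem oscInt_deriv (h : Complex.exp (2 * Complex.I * z * L) ≠ 1) {g g' : ℝ → ℂ}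
    (hg : ∀ y, HasDerivAt g (g' y) y) (hg' : Continuous g') (hgL : g L = g 0) :
    oscInt z L (fun y => g' y + 2 * Complex.I * z * g y) = g 0 := by
  have hgc : Continuous g := continuous_iff_continuousAt.2 fun y => (hg y).continuousAt
  have hd : ∀ y : ℝ, HasDerivAt (fun y : ℝ => Complex.exp (2 * Complex.I * z * y) * g y)
      (Complex.exp (2 * Complex.I * z * y) * (g' y + 2 * Complex.I * z * g y)) y := fun y =>
    ((hasDerivAt_expPhase z y).mul (hg y)).congr_deriv (by ring)
  rw [oscInt, intervalIntegral.integral_eq_sub_of_hasDerivAt (fun y _ => hd y)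
    (((continuous_expPhase z).mul (hg'.add (continuous_const.mul hgc))).intervalIntegrable _ _),
    hgL, div_eq_iff (sub_ne_zero.2 h)]
  simp
  ring

/-! ### The Riccati equation for the quotient of the components -/

/-- `p` is an `L`-periodic potential with derivatives `p'`, `p''`, all bounded by `B`. -/
structure BoundedPotential (L B : ℝ) (p p' p'' : ℝ → ℂ) : Prop where
  deriv : ∀ x, HasDerivAt p (p' x) x
  deriv' : ∀ x, HasDerivAt p' (p'' x) x
  continuous'' : Continuous p''
  periodic : ∀ x, p (x + L) = p x
  periodic' : ∀ x, p' (x + L) = p' x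
  bound : ∀ x, ‖p x‖ ≤ B
  bound' : ∀ x, ‖p' x‖ ≤ B
  bound'' : ∀ x, ‖p'' x‖ ≤ B

namespace BoundedPotential

variable {B : ℝ} {p p' p'' : ℝ → ℂ}

theorem shift (h : BoundedPotential L B p p' p'') (y : ℝ) :
    BoundedPotential L B (fun x => p (x + y)) (fun x => p' (x + y)) (fun x => p'' (x + y)) where
  deriv x := HasDerivAt.comp_add_const x y (h.deriv (x + y))
  deriv' x := HasDerivAt.comp_add_const x y (h.deriv' (x + y))
  continuous'' := h.continuous''.comp (by fun_prop)
  periodic x := by rw [add_right_comm, h.periodic]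
  periodic' x := by rw [add_right_comm, h.periodic']
  bound x := h.bound _
  bound' x := h.bound' _
  bound'' x := h.bound'' _

theorem continuous (h : BoundedPotential L B p p' p'') : Continuous p :=
  continuous_iff_continuousAt.2 fun x => (h.deriv x).continuousAt

theorem continuous' (h : BoundedPotential L B p p' p'') : Continuous p' :=
  continuous_iff_continuousAt.2 fun x => (h.deriv' x).continuousAt

theorem nonneg (h : BoundedPotential L B p p' p'') : 0 ≤ B := (norm_nonneg _).trans (h.bound 0)

end BoundedPotential

theorem two_I_mul_ne_zero (hz : z ≠ 0) : 2 * Complex.I * z ≠ 0 :=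
  mul_ne_zero (mul_ne_zero two_ne_zero Complex.I_ne_zero) hz

theorem norm_two_I_mul (z : ℂ) : ‖2 * Complex.I * z‖ = 2 * ‖z‖ := by simp

/-- One integration by parts in `∫ e^{2izy} p`. -/
theorem norm_oscInt_le_div (hL : 0 ≤ L) (h : Nonresonant κ z L) (hz : z ≠ 0) {B : ℝ} {g g' : ℝ → ℂ}
    (hg : ∀ y, HasDerivAt g (g' y) y) (hg' : Continuous g') (hgL : g L = g 0)
    (hb : ∀ x, ‖g x‖ ≤ B) (hb' : ∀ x, ‖g' x‖ ≤ B) :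
    oscInt z L g = (g 0 - oscInt z L g') / (2 * Complex.I * z) ∧
      ‖oscInt z L g‖ ≤ B * (1 + κ * L) / (2 * ‖z‖) := by
  have hgc : Continuous g := continuous_iff_continuousAt.2 fun y => (hg y).continuousAt
  have h1 := oscInt_deriv h.1 hg hg' hgL
  rw [oscInt_add_const_mul hg' hgc] at h1
  have h2 : oscInt z L g = (g 0 - oscInt z L g') / (2 * Complex.I * z) := by
    rw [eq_div_iff (two_I_mul_ne_zero hz)]
    linear_combination h1
  refine ⟨h2, ?_⟩
  rw [h2, norm_div, norm_two_I_mul]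
  gcongr
  refine (norm_sub_le _ _).trans ?_
  have := norm_oscInt_le hL h (g := g') (G := B) fun y _ => hb' y
  linarith [hb 0]

/-- The solution of the Riccati equation at `0`, to first order in `1 / z`. -/
theorem riccati_estimate (hL : 0 ≤ L) (h : Nonresonant κ z L) (hz : z ≠ 0) {B X : ℝ}
    {p p' p'' χ : ℝ → ℂ} (hp : BoundedPotential L B p p' p'')
    (hχ : ∀ x, HasDerivAt χ (-(2 * Complex.I * z) * χ x + (p x - star (p x) * χ x ^ 2)) x)
    (hχL : χ L = χ 0) (hχ1 : ∀ x, ‖χ x‖ ≤ 1) (hχX : ∀ x, ‖χ x‖ ≤ X) :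
    ‖χ 0 - oscInt z L p‖ ≤ (B + κ * L * (B + 4 * B ^ 2)) * X / (2 * ‖z‖) := by
  have hB := hp.nonneg
  have hX : 0 ≤ X := (norm_nonneg _).trans (hχX 0)
  have hχc : Continuous χ := continuous_iff_continuousAt.2 fun y => (hχ y).continuousAt
  have hpc := hp.continuous
  have hpc' := hp.continuous'
  set F : ℝ → ℂ := fun x => p x - star (p x) * χ x ^ 2 with hF
  set G : ℝ → ℂ := fun x => star (p x) * χ x ^ 2 with hG
  have hFc : Continuous F := by fun_prop
  have hGc : Continuous G := by fun_prop
  have hpL : p L = p 0 := by simpa using hp.periodic 0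
  have e1 : χ 0 = oscInt z L p - oscInt z L G := by
    have h1 := oscInt_deriv h.1 hχ (by fun_prop) hχL
    have h2 : (fun y => -(2 * Complex.I * z) * χ y + (p y - star (p y) * χ y ^ 2) +
        2 * Complex.I * z * χ y) = fun y => p y + (-1) * G y := by
      funext y; simp only [hG]; ring
    rw [h2, oscInt_add_const_mul hpc hGc] at h1
    rw [← h1]; ring
  set W : ℝ → ℂ := fun x => star (p' x) * χ x ^ 2 + 2 * star (p x) * χ x * F x with hW
  have hWc : Continuous W := by fun_prop
  -- Differentiating `χ²` produces `-4iz`, and together with the `2iz` of the phase this leaves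
  -- `-2iz`. The integral of `G` can thus be solved for, with a gain of `1 / z`.
  have e2 : oscInt z L W - 2 * Complex.I * z * oscInt z L G = G 0 := by
    have h1 := oscInt_deriv (g := G)
      (g' := fun x => W x + (-(4 * Complex.I * z)) * G x) h.1 (fun x => by
        refine ((hp.deriv x).star.mul ((hχ x).pow 2)).congr_deriv ?_
        simp only [hW, hG, hF, Pi.pow_apply]
        push_cast
        ring) (by fun_prop) (by simp only [hG, hpL, hχL])
    have h2 : (fun y => W y + -(4 * Complex.I * z) * G y + 2 * Complex.I * z * G y) =
        fun y => W y + (-(2 * Complex.I * z)) * G y := by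
      funext y; ring
    rw [h2, oscInt_add_const_mul hWc hGc] at h1
    rw [← h1]; ring
  have hsq : ∀ x, ‖χ x‖ ^ 2 ≤ X := fun x => by
    have := hχ1 x
    have := hχX x
    have := norm_nonneg (χ x)
    nlinarith
  have hG0 : ‖G 0‖ ≤ B * X := by
    simp only [hG, norm_mul, norm_star, norm_pow]
    exact mul_le_mul (hp.bound 0) (hsq 0) (by positivity) hB
  have hFb : ∀ x, ‖F x‖ ≤ 2 * B := fun x => by
    refine (norm_sub_le _ _).trans ?_
    rw [norm_mul, norm_star, norm_pow]
    have h1 : ‖χ x‖ ^ 2 ≤ 1 := pow_le_one₀ (norm_nonneg _) (hχ1 x)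
    have := mul_le_mul (hp.bound x) h1 (by positivity) hB
    linarith [hp.bound x]
  have hWb : ∀ x, ‖W x‖ ≤ (B + 4 * B ^ 2) * X := fun x => by
    refine (norm_add_le _ _).trans ?_
    rw [norm_mul, norm_mul, norm_mul, norm_mul, norm_star, norm_star, norm_pow, Complex.norm_ofNat]
    have h1 := mul_le_mul (hp.bound' x) (hsq x) (by positivity) hB
    have h2 := mul_le_mul (hp.bound x) (hχX x) (norm_nonneg _) hB
    have h3 := mul_le_mul h2 (hFb x) (norm_nonneg _) (by positivity)
    linarith
  have e3 : χ 0 - oscInt z L p = (G 0 - oscInt z L W) / (2 * Complex.I * z) := by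
    rw [eq_div_iff (two_I_mul_ne_zero hz), e1]
    linear_combination e2
  rw [e3, norm_div, norm_two_I_mul]
  gcongr
  refine (norm_sub_le _ _).trans ?_
  have := norm_oscInt_le hL h (g := W) fun y _ => hWb y
  linarith

/-- A bound for the coefficient of `1 / z` in the quotient of the components. -/
def quotBound (L B κ : ℝ) : ℝ := B * (1 + κ * L) + (B + κ * L * (B + 4 * B ^ 2))

theorem quotBound_nonneg {B : ℝ} (hL : 0 ≤ L) (hB : 0 ≤ B) (hκ : 0 ≤ κ) :
    0 ≤ quotBound L B κ := by
  unfold quotBound; positivity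

section Floquet

variable {B : ℝ} {p p' p'' : ℝ → ℂ} {v : ℝ → Fin 2 → ℂ} {μ : ℂ}

theorem IsZSSolution.norm_le_at (hp : Continuous p) (hper : ∀ x, p (x + L) = p x)
    (hv : IsZSSolution p z v) (hv0 : v ≠ 0) (hL : 0 < L) (hvL : v L = μ • v 0)
    (hz : 0 ≤ z.im ∧ ‖μ‖ < 1 ∨ z.im ≤ 0 ∧ 1 < ‖μ‖) (x : ℝ) : ‖v x 0‖ ≤ ‖v x 1‖ := by
  have h1 : IsZSSolution (fun y => p (y + x)) z (fun y => v (y + x)) := fun y =>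
    HasDerivAt.comp_add_const y x (hv (y + x))
  have h2 : (fun y => v (y + x)) ≠ 0 := fun h => hv0 (funext fun y => by
    have := congrFun h (y - x)
    simpa using this)
  have := (h1.norm_le (hp.comp (by fun_prop)) h2 hL (μ := μ) (by
    rw [add_comm, hv.floquet hp hper hvL, zero_add]) hz).1
  simpa using this

theorem IsZSSolution.second_ne_zero (hp : Continuous p) (hper : ∀ x, p (x + L) = p x)
    (hv : IsZSSolution p z v) (hv0 : v ≠ 0) (hL : 0 < L) (hvL : v L = μ • v 0)
    (hz : 0 ≤ z.im ∧ ‖μ‖ < 1 ∨ z.im ≤ 0 ∧ 1 < ‖μ‖) (x : ℝ) : v x 1 ≠ 0 := by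
  intro h
  have h1 := hv.norm_le_at hp hper hv0 hL hvL hz x
  rw [h, norm_zero, norm_le_zero_iff] at h1
  refine hv.ne_zero hp hv0 x ?_
  ext i
  fin_cases i
  · exact h1
  · exact h

theorem IsZSSolution.hasDerivAt_quot (hv : IsZSSolution p z v) {x : ℝ} (hx : v x 1 ≠ 0) :
    HasDerivAt (fun x => v x 0 / v x 1)
      (-(2 * Complex.I * z) * (v x 0 / v x 1) + (p x - star (p x) * (v x 0 / v x 1) ^ 2)) x := by
  have h := hasDerivAt_pi.1 (hv x)
  refine ((h 0).div (h 1) hx).congr_deriv ?_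
  simp only [zsMatrix_eq, Matrix.mulVec, dotProduct, Fin.sum_univ_two, Matrix.of_apply,
    Matrix.cons_val', Matrix.cons_val_zero, Matrix.cons_val_one, Matrix.cons_val_fin_one]
  field_simp
  ring

/-- The quotient of the components of a decaying Floquet solution, away from resonances. -/
theorem IsZSSolution.quot_estimate (hp : BoundedPotential L B p p' p'')
    (h : Nonresonant κ z L) (hz0 : z ≠ 0)
    (hv : IsZSSolution p z v) (hv0 : v ≠ 0) (hL : 0 < L) (hvL : v L = μ • v 0)
    (hz : 0 ≤ z.im ∧ ‖μ‖ < 1 ∨ z.im ≤ 0 ∧ 1 < ‖μ‖) :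
    v 0 1 ≠ 0 ∧ ‖v 0 0 / v 0 1‖ ≤ quotBound L B κ / (2 * ‖z‖) ∧
      ‖v 0 0 / v 0 1 - p 0 / (2 * Complex.I * z)‖ ≤
        (B * (1 + κ * L) + (B + κ * L * (B + 4 * B ^ 2)) * quotBound L B κ) / (2 * ‖z‖) ^ 2 := by
  have hB := hp.nonneg
  have hne := hv.second_ne_zero hp.continuous hp.periodic hv0 hL hvL hz
  have hfl := hv.floquet hp.continuous hp.periodic hvL
  set χ : ℝ → ℂ := fun x => v x 0 / v x 1 with hχdef
  have hχ := fun x => hv.hasDerivAt_quot (hne x)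
  have hμ : μ ≠ 0 := fun h0 => by
    have := hne L
    rw [hvL, h0] at this
    simp at this
  have hχper : ∀ x, χ (x + L) = χ x := fun x => by
    simp only [hχdef, hfl, Pi.smul_apply, smul_eq_mul]
    rw [mul_div_mul_left _ _ hμ]
  have hχ1 : ∀ x, ‖χ x‖ ≤ 1 := fun x => by
    rw [hχdef, norm_div]
    exact div_le_one_of_le₀ (hv.norm_le_at hp.continuous hp.periodic hv0 hL hvL hz x)
      (norm_nonneg _)
  -- A bootstrap: the a priori bound `|χ| ≤ 1`, used at every base point by translation, gives `χ =
  -- O(1/z)`; this bound then serves as `X` in a second application and improves the error to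
  -- `O(1/z²)`.
  have key : ∀ x : ℝ, ‖χ x‖ ≤ quotBound L B κ / (2 * ‖z‖) := fun x => by
    have hps := hp.shift x
    have h1 := riccati_estimate hL.le h hz0 hps (χ := fun y => χ (y + x)) (X := 1)
      (fun y => HasDerivAt.comp_add_const y x (hχ (y + x)))
      (by simp only [zero_add]; rw [add_comm, hχper]) (fun y => hχ1 _) (fun y => hχ1 _)
    have h2 := (norm_oscInt_le_div hL.le h hz0 hps.deriv hps.continuous'
      (by simpa using hps.periodic 0) hps.bound hps.bound').2
    simp only [zero_add, mul_one] at h1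
    have h3 := norm_le_norm_add_norm_sub' (χ x) (oscInt z L fun y => p (y + x))
    rw [quotBound, add_div]
    linarith
  refine ⟨hne 0, key 0, ?_⟩
  have hpL : p L = p 0 := by simpa using hp.periodic 0
  have hpL' : p' L = p' 0 := by simpa using hp.periodic' 0
  have h1 := riccati_estimate hL.le h hz0 hp hχ (by simpa using hχper 0) hχ1 key
  -- Two integrations by parts: one extracts the leading term `p(0) / (2iz)`, the other bounds the
  -- remaining integral of `p'` and uses the second derivative of the potential.
  have h2 := (norm_oscInt_le_div hL.le h hz0 hp.deriv hp.continuous' hpL hp.bound hp.bound').1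
  have h3 := (norm_oscInt_le_div hL.le h hz0 hp.deriv' hp.continuous'' hpL' hp.bound' hp.bound'').2
  have e : χ 0 - p 0 / (2 * Complex.I * z) =
      (χ 0 - oscInt z L p) - oscInt z L p' / (2 * Complex.I * z) := by
    rw [h2]; ring
  change ‖χ 0 - p 0 / (2 * Complex.I * z)‖ ≤ _
  rw [e]
  refine (norm_sub_le _ _).trans ?_
  rw [norm_div, norm_two_I_mul]
  have hzp : 0 < 2 * ‖z‖ := by positivity
  have h4 : ‖oscInt z L p'‖ / (2 * ‖z‖) ≤ B * (1 + κ * L) / (2 * ‖z‖) / (2 * ‖z‖) := by gcongr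
  refine (add_le_add h1 h4).trans (le_of_eq ?_)
  field_simp
  ring

end Floquet

/-! ### Points away from the lattice -/

/-- For `|Re w| > 1` the modulus of `e^w` stays away from one. For `|Re w| ≤ 1`, periodicity reduces
to a rectangle of height `2π`, where `0` is the only zero of `e^w - 1`, and compactness applies
outside the `δ`-disc. -/
theorem exists_exp_sub_one_bound {δ : ℝ} (hδ : 0 < δ) : ∃ c : ℝ, 0 < c ∧ ∀ w : ℂ,
    (∀ n : ℤ, δ ≤ ‖w - n * (2 * Real.pi * Complex.I)‖) →
      max 1 ‖Complex.exp w‖ ≤ c * ‖Complex.exp w - 1‖ := by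
  set K : Set ℂ := (Icc (-1 : ℝ) 1 ×ℂ Icc (-Real.pi) Real.pi) ∩ {w | δ ≤ ‖w‖} with hK
  have hKc : IsCompact K := (isCompact_Icc.reProdIm isCompact_Icc).inter_right
    (isClosed_le continuous_const continuous_norm)
  have hKne : ∀ w ∈ K, ‖Complex.exp w - 1‖ ≠ 0 := by
    rintro w ⟨⟨-, h2⟩, h3⟩ h
    obtain ⟨n, hn⟩ := Complex.exp_eq_one_iff.1 (sub_eq_zero.1 (norm_eq_zero.1 h))
    have h4 : w.im = n * (2 * Real.pi) := by rw [hn]; simp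
    have h5 : w.im ∈ Icc (-Real.pi) Real.pi := h2
    rw [h4] at h5
    have hπ := Real.pi_pos
    have h6 : (n : ℝ) < 1 := by nlinarith [h5.2]
    have h7 : (-1 : ℝ) < n := by nlinarith [h5.1]
    have h8 : n = 0 := by
      have : n < 1 := by exact_mod_cast h6
      have : -1 < n := by exact_mod_cast h7
      omega
    rw [hn, h8] at h3
    simp at h3
    linarith
  obtain ⟨C, hC⟩ := hKc.exists_bound_of_continuousOn
    (f := fun w => ‖Complex.exp w - 1‖⁻¹)
    (ContinuousOn.inv₀ (by fun_prop) hKne)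
  refine ⟨max (3 * |C|) 3, by positivity, fun w hw => ?_⟩
  by_cases h1 : |w.re| ≤ 1
  · set n : ℤ := round (w.im / (2 * Real.pi)) with hn
    set w' : ℂ := w - n * (2 * Real.pi * Complex.I) with hw'
    have hexp : Complex.exp w' = Complex.exp w := Complex.exp_periodic.sub_int_mul_eq n
    have him : w'.im = w.im - n * (2 * Real.pi) := by simp [hw']
    have hre : w'.re = w.re := by simp [hw']
    have hπ := Real.pi_pos
    have hmem : w' ∈ K := by
      refine ⟨⟨?_, ?_⟩, hw n⟩
      · change w'.re ∈ Icc (-1 : ℝ) 1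
        rw [hre]; exact abs_le.1 h1
      · change w'.im ∈ Icc (-Real.pi) Real.pi
        rw [him]
        have h2 := abs_sub_round (w.im / (2 * Real.pi))
        rw [← hn] at h2
        have h3 : w.im - n * (2 * Real.pi) = (w.im / (2 * Real.pi) - n) * (2 * Real.pi) := by
          field_simp
        rw [h3, mem_Icc, ← abs_le, abs_mul, abs_of_pos (by positivity : 0 < 2 * Real.pi)]
        nlinarith
    have h2 := hC w' hmem
    have h3 : 0 < ‖Complex.exp w - 1‖ := by
      rw [← hexp]; exact lt_of_le_of_ne (norm_nonneg _) (hKne w' hmem).symm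
    rw [hexp, norm_inv, norm_norm] at h2
    have h4 : 1 ≤ |C| * ‖Complex.exp w - 1‖ := by
      rw [inv_le_iff_one_le_mul₀ h3] at h2
      exact h2.trans (mul_le_mul_of_nonneg_right (le_abs_self C) h3.le)
    have h5 : ‖Complex.exp w‖ ≤ 3 := by
      rw [Complex.norm_exp]
      exact (Real.exp_le_exp.2 (abs_le.1 h1).2).trans (by linarith [Real.exp_one_lt_d9])
    have h6 : max 1 ‖Complex.exp w‖ ≤ 3 := max_le (by norm_num) h5
    have h7 : 3 * |C| * ‖Complex.exp w - 1‖ ≤ max (3 * |C|) 3 * ‖Complex.exp w - 1‖ := by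
      gcongr; exact le_max_left _ _
    linarith
  · have h7 : 3 * ‖Complex.exp w - 1‖ ≤ max (3 * |C|) 3 * ‖Complex.exp w - 1‖ := by
      gcongr; exact le_max_right _ _
    refine le_trans ?_ h7
    have hn := Complex.norm_exp w
    rw [not_le, lt_abs] at h1
    have h8 := abs_norm_sub_norm_le (Complex.exp w) 1
    rw [norm_one] at h8
    rcases h1 with h1 | h1
    · have h9 : 2 ≤ ‖Complex.exp w‖ := by
        rw [hn]
        linarith [Real.add_one_le_exp w.re]
      have := le_abs_self (‖Complex.exp w‖ - 1)
      exact max_le (by linarith) (by linarith)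
    · have h9 : ‖Complex.exp w‖ ≤ 1 / 2 := by
        rw [hn, ← neg_neg w.re, Real.exp_neg, one_div]
        exact inv_anti₀ two_pos (by linarith [Real.add_one_le_exp (-w.re)])
      have := neg_abs_le (‖Complex.exp w‖ - 1)
      exact max_le (by linarith) (by linarith)

/-- The modulus of `e^{2izy}` is monotone in `y`, so on `[0, L]` it is at most the larger of its
values at the two ends. The lattice `(π / L) ℤ` consists of the zeros of `e^{2izL} - 1`. -/
theorem exists_nonresonant (hL : 0 < L) {δ : ℝ} (hδ : 0 < δ) : ∃ κ : ℝ, 0 ≤ κ ∧ ∀ z : ℂ,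
    (∀ n : ℤ, δ ≤ ‖z - ((n * (Real.pi / L) : ℝ) : ℂ)‖) → Nonresonant κ z L := by
  obtain ⟨c, hc, h⟩ := exists_exp_sub_one_bound (δ := 2 * L * δ) (by positivity)
  refine ⟨c, hc.le, fun z hz => ?_⟩
  have h1 := h (2 * Complex.I * z * L) fun n => by
    have hL' : (L : ℂ) ≠ 0 := by exact_mod_cast hL.ne'
    have : 2 * Complex.I * z * L - n * (2 * Real.pi * Complex.I) =
        2 * Complex.I * L * (z - ((n * (Real.pi / L) : ℝ) : ℂ)) := by
      push_cast
      field_simp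
    rw [this, norm_mul]
    have h2 : ‖2 * Complex.I * (L : ℂ)‖ = 2 * L := by simp [abs_of_pos hL]
    rw [h2]
    have := hz n
    gcongr
  refine ⟨fun he => ?_, fun y hy => ?_⟩
  · rw [he] at h1
    simp at h1
    linarith
  · refine le_trans ?_ h1
    have e : ∀ y : ℝ, ‖Complex.exp (2 * Complex.I * z * y)‖ = Real.exp (-(2 * z.im) * y) :=
      fun y => by rw [Complex.norm_exp]; simp
    rw [e, e, le_max_iff]
    rcases le_total 0 z.im with h0 | h0
    · left
      rw [Real.exp_le_one_iff]
      have := mul_nonneg h0 hy.1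
      linarith
    · right
      refine Real.exp_le_exp.2 ?_
      exact mul_le_mul_of_nonneg_left hy.2 (by linarith)

end

section

open scoped Matrix.Norms.Operator

/-! ### Asymptotics of the time factors away from the lattice -/

variable {q : ℝ → ℝ → ℂ} {z : ℂ} {L κ B : ℝ} {t τ : ℝ} {ε : ℤˣ}

theorem IsPeriodicNLSSolution.exists_periodic_bound (hL : 0 < L) {S : Set ℝ} (hS : IsCompact S)
    {f : ℝ → ℝ → ℂ} (hf : ContinuousOn (fun y : ℝ × ℝ => f y.1 y.2) (univ ×ˢ S))
    (hper : ∀ τ ∈ S, ∀ x, f (x + L) τ = f x τ) : ∃ B, ∀ τ ∈ S, ∀ x, ‖f x τ‖ ≤ B := by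
  obtain ⟨B, hB⟩ := ((isCompact_Icc (a := 0) (b := 0 + L)).prod hS).exists_bound_of_continuousOn
    (hf.mono (prod_mono_left (subset_univ _)))
  refine ⟨B, fun τ hτ x => ?_⟩
  obtain ⟨y, hy, hxy⟩ := Function.Periodic.exists_mem_Ico (f := fun x => f x τ) (hper τ hτ) hL x 0
  rw [hxy]
  exact hB (y, τ) ⟨Ico_subset_Icc_self hy, hτ⟩

theorem IsPeriodicNLSSolution.exists_boundedPotential
    (hq : IsPeriodicNLSSolution L (uIcc 0 t) q) (hL : 0 < L) : ∃ B, ∀ τ ∈ uIcc 0 t,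
      BoundedPotential L B (slice q τ) (deriv (fun x => q x τ))
        (deriv (deriv (fun x => q x τ))) := by
  have hper'' : ∀ τ ∈ uIcc 0 t, ∀ x,
      deriv (deriv (fun x => q x τ)) (x + L) = deriv (deriv (fun x => q x τ)) x := fun τ hτ x => by
    rw [← deriv_comp_add_const]
    congr 1
    exact funext (hq.deriv_add hτ)
  obtain ⟨B₀, h0⟩ := exists_periodic_bound hL isCompact_uIcc hq.continuous hq.periodic
  obtain ⟨B₁, h1⟩ := exists_periodic_bound hL isCompact_uIcc
    (f := fun x τ => deriv (fun x => q x τ) x) hq.continuous_dx fun τ hτ => hq.deriv_add hτ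
  obtain ⟨B₂, h2⟩ := exists_periodic_bound hL isCompact_uIcc
    (f := fun x τ => deriv (deriv (fun x => q x τ)) x) hq.continuous_dxx hper''
  refine ⟨max B₀ (max B₁ B₂), fun τ hτ => ⟨hq.hasDerivAt hτ, hq.hasDerivAt_deriv hτ, ?_,
    hq.slice_add hτ, hq.deriv_add hτ, fun x => (h0 τ hτ x).trans (le_max_left _ _),
    fun x => (h1 τ hτ x).trans ((le_max_left _ _).trans (le_max_right _ _)),
    fun x => (h2 τ hτ x).trans ((le_max_right _ _).trans (le_max_right _ _))⟩⟩
  exact (hq.contDiff_deriv hτ).continuous_deriv le_rfl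

/-- The quotient of the components of an eigenvector of the monodromy matrix. -/
theorem quot_estimate_of_eigenvector {p p' p'' : ℝ → ℂ} (hp : BoundedPotential L B p p' p'')
    (hL : 0 < L) (h : Nonresonant κ z L) (hz0 : z ≠ 0) {μ : ℂ} {w : Fin 2 → ℂ} (hw0 : w ≠ 0)
    (hw : (modMonodromy L p z).mulVec w = μ • w)
    (hz : 0 ≤ z.im ∧ ‖μ‖ < 1 ∨ z.im ≤ 0 ∧ 1 < ‖μ‖) :
    let u := simMatrix⁻¹.mulVec w
    u 1 ≠ 0 ∧ ‖u 0 / u 1‖ ≤ quotBound L B κ / (2 * ‖z‖) ∧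
      ‖u 0 / u 1 - p 0 / (2 * Complex.I * z)‖ ≤
        (B * (1 + κ * L) + (B + κ * L * (B + 4 * B ^ 2)) * quotBound L B κ) / (2 * ‖z‖) ^ 2 := by
  intro u
  have hu0 : u ≠ 0 := fun h => hw0 (by
    have h2 := congrArg simMatrix.mulVec h
    rwa [Matrix.mulVec_mulVec, simMatrix_mul_inv, Matrix.one_mulVec, Matrix.mulVec_zero] at h2)
  have hv := isZSSolution_principal (z := z) hp.continuous u
  have hv0 : (principalSolution p z 0).mulVec u = u := by
    rw [(zsFund hp.continuous z).zero, Matrix.one_mulVec]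
  have hvL : (principalSolution p z L).mulVec u = μ • (principalSolution p z 0).mulVec u := by
    rw [hv0]
    have h2 := congrArg simMatrix⁻¹.mulVec hw
    rw [modMonodromy, Matrix.mulVec_smul, Matrix.mulVec_mulVec, ← mul_assoc, ← mul_assoc,
      simMatrix_inv_mul, one_mul, ← Matrix.mulVec_mulVec] at h2
    exact h2
  have := hv.quot_estimate hp h hz0 (principal_ne_zero hp.continuous hu0) hL hvL hz
  rwa [hv0] at this

theorem norm_exp_mul_div_sub_one_le {η x y : ℂ} {m : ℝ} (hη : ‖η‖ ≤ m) (hx : ‖x‖ ≤ m)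
    (hy : ‖y‖ ≤ m) (hm : m ≤ 1 / 2) :
    ‖Complex.exp η * (1 + x) / (1 + y) - 1‖ ≤ 10 * m := by
  have h1 : ‖Complex.exp η - 1‖ ≤ 2 * m :=
    (Complex.norm_exp_sub_one_le (by linarith)).trans (by linarith)
  have h2 : 1 / 2 ≤ ‖1 + y‖ := by
    have := norm_sub_norm_le (1 : ℂ) (-y)
    rw [norm_one, norm_neg, sub_neg_eq_add] at this
    linarith
  have h3 : 1 + y ≠ 0 := norm_pos_iff.1 (by linarith)
  have e : Complex.exp η * (1 + x) / (1 + y) - 1 =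
      ((Complex.exp η - 1) * (1 + x) + (x - y)) / (1 + y) := by
    field_simp
    ring
  rw [e, norm_div, div_le_iff₀ (by linarith)]
  have h4 : ‖1 + x‖ ≤ 3 / 2 := (norm_add_le _ _).trans (by rw [norm_one]; linarith)
  have h5 := norm_add_le ((Complex.exp η - 1) * (1 + x)) (x - y)
  rw [norm_mul] at h5
  have h6 := norm_sub_le x y
  have h7 := mul_le_mul h1 h4 (norm_nonneg _) (by linarith [norm_nonneg x])
  have h8 : 10 * m * (1 / 2) ≤ 10 * m * ‖1 + y‖ :=
    mul_le_mul_of_nonneg_left h2 (by linarith [norm_nonneg x])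
  linarith

theorem simMatrix_inv_conj_timeMatrix (A : M2) (w : Fin 2 → ℂ) :
    simMatrix⁻¹.mulVec ((simMatrix * A * simMatrix⁻¹).mulVec w) =
      A.mulVec (simMatrix⁻¹.mulVec w) := by
  rw [Matrix.mulVec_mulVec, Matrix.mulVec_mulVec, mul_assoc, ← mul_assoc, simMatrix_inv_mul,
    one_mul]

theorem first_of_simMatrix_inv (w : Fin 2 → ℂ) :
    simMatrix⁻¹.mulVec w 0 + simMatrix⁻¹.mulVec w 1 = w 0 := by
  rw [← simMatrix_mulVec_zero, Matrix.mulVec_mulVec, simMatrix_mul_inv, Matrix.one_mulVec]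

theorem multiplier_growth {p : ℝ → ℂ} (hp : Continuous p) (hper : ∀ x, p (x + L) = p x)
    (hL : 0 < L) (hz : 0 < (ε : ℤ) * z.im) : 0 ≤ z.im ∧ ‖multiplier L p ε z‖ < 1 ∨
      z.im ≤ 0 ∧ 1 < ‖multiplier L p ε z‖ := by
  have hz0 : z ∉ laxSpectrum p := fun h => by
    rw [im_eq_zero_of_mem_laxSpectrum hp hper hL h, mul_zero] at hz
    exact lt_irrefl _ hz
  rcases Int.units_eq_one_or ε with rfl | rfl
  · left
    exact ⟨by simpa using hz.le, norm_multiplier_one_lt hp hper hL hz0⟩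
  · right
    refine ⟨?_, one_lt_norm_multiplier hp hper hL hz0⟩
    simp only [Units.val_neg, Units.val_one, Int.reduceNeg, Int.cast_neg, Int.cast_one, neg_mul,
      one_mul, Left.neg_pos_iff] at hz
    exact hz.le

/-- The asymptotics of the time factor in the half plane where the Bloch-Floquet solution is
dominated by its second component. -/
theorem IsPeriodicNLSSolution.exists_preFactor_asymptotics
    (hq : IsPeriodicNLSSolution L (uIcc 0 t) q) (hL : 0 < L) (hκ : 0 ≤ κ) : ∃ C N : ℝ, 0 ≤ C ∧
      ∀ (ε : ℤˣ) (z : ℂ), 0 < (ε : ℤ) * z.im → Nonresonant κ z L → N ≤ ‖z‖ →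
        ‖preFactor L q ε t z * Complex.exp (-(2 * Complex.I * z ^ 2 * t)) - 1‖ ≤ C / ‖z‖ := by
  have h0 : (0 : ℝ) ∈ uIcc 0 t := left_mem_uIcc
  have ht : t ∈ uIcc 0 t := right_mem_uIcc
  obtain ⟨B, hB⟩ := hq.exists_boundedPotential hL
  have hB0 : 0 ≤ B := (hB 0 h0).nonneg
  set K₁ := quotBound L B κ / 2 with hK₁
  set K₂ := (B * (1 + κ * L) + (B + κ * L * (B + 4 * B ^ 2)) * quotBound L B κ) / 4 with hK₂
  have hqb := quotBound_nonneg hL.le hB0 hκ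
  have hK₁0 : 0 ≤ K₁ := by positivity
  have hK₂0 : 0 ≤ K₂ := by positivity
  set K₃ := 2 * B * K₂ + B * K₁ with hK₃
  have hK₃0 : 0 ≤ K₃ := by positivity
  set A := K₁ + |t| * K₃ with hA
  have hA0 : 0 ≤ A := by positivity
  -- With `m = A / ‖z‖`, the threshold `2A + 1` ensures `m ≤ 1/2`, and `norm_exp_mul_div_sub_one_le`
  -- then gives the error `10 m`. In `A`, `K₁` accounts for the quotients at the two end times and
  -- `|t| K₃` for the integrated rate.
  refine ⟨10 * A, 2 * A + 1, by positivity, fun ε z hz hres hN => ?_⟩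
  have hzp : 0 < ‖z‖ := by linarith
  have hz0 : z ≠ 0 := norm_pos_iff.1 hzp
  have him : z.im ≠ 0 := fun h => by simp [h] at hz
  have hzs : z ∉ spec q := fun h => him (hq.im_spec hL h)
  set μ := multiplier L (slice q 0) ε z with hμ
  have hgrow := multiplier_growth (hq.continuous_slice h0) (hq.slice_add h0) hL hz
  rw [← hμ] at hgrow
  set c := blochVec (modMonodromy L (slice q 0) z) μ with hc
  have hc0 : c ≠ 0 := blochVec_ne_zero _ _
  have hcM : (modMonodromy L (slice q 0) z).mulVec c = μ • c :=
    mulVec_blochVec (det_modMonodromy (hq.continuous_slice h0))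
      (multiplier_quadratic (hq.continuous_slice h0) (hq.slice_add h0) hL hzs ε)
      (hq.modMonodromy_ne_zero hL h0 him)
  set w : ℝ → Fin 2 → ℂ := fun τ => (transport q t z τ).mulVec c with hw
  set u : ℝ → Fin 2 → ℂ := fun τ => simMatrix⁻¹.mulVec (w τ) with hu
  have hest : ∀ τ ∈ uIcc 0 t, u τ 1 ≠ 0 ∧ ‖u τ 0 / u τ 1‖ ≤ K₁ / ‖z‖ ∧
      ‖u τ 0 / u τ 1 - q 0 τ / (2 * Complex.I * z)‖ ≤ K₂ / ‖z‖ ^ 2 := by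
    intro τ hτ
    obtain ⟨e1, e2, e3⟩ := quot_estimate_of_eigenvector (hB τ hτ) hL hres hz0
      (hq.transport_mulVec_ne_zero (τ := τ) hc0) (hq.mulVec_transport hL.le hτ hcM) hgrow
    refine ⟨e1, e2.trans_eq ?_, e3.trans_eq ?_⟩
    · rw [hK₁]; field_simp
    · rw [hK₂]; field_simp; norm_num
  have hwd : ∀ τ, HasDerivAt w ((timeCoeff q t z τ).mulVec (w τ)) τ :=
    (hq.isFund_transport z).hasDerivAt_mulVec c
  have hwc : Continuous w := continuous_iff_continuousAt.2 fun τ => (hwd τ).continuousAt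
  have huc : Continuous u := continuous_const.matrix_mulVec hwc
  have hud : ∀ τ ∈ uIcc 0 t, HasDerivAt u ((timeMatrix q z 0 τ).mulVec (u τ)) τ := by
    intro τ hτ
    have e1 : (timeMatrix q z 0 τ).mulVec (u τ) =
        simMatrix⁻¹.mulVec ((timeCoeff q t z τ).mulVec (w τ)) := by
      rw [timeCoeff, clampTime_of_mem hτ, modTime, simMatrix_inv_conj_timeMatrix]
    rw [e1, hasDerivAt_pi]
    intro i
    have h1 := hasDerivAt_pi.1 (hwd τ)
    simp only [hu, Matrix.mulVec, dotProduct, Fin.sum_univ_two] at h1 ⊢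
    exact ((h1 0).const_mul _).add ((h1 1).const_mul _)
  set χ : ℝ → ℂ := fun τ => u τ 0 / u τ 1 with hχ
  -- The logarithmic derivative of `u₁` is `2iz² + i|q|² + (2z q* - i q_x*) χ`. The leading term of
  -- `χ` contributes `2z q* · q / (2iz) = -i|q|²`, which cancels `i|q|²`. What is left is `2iz² + a`
  -- with `a = O(1/z)`.
  set a : ℝ → ℂ := fun τ => 2 * z * star (q 0 τ) * (χ τ - q 0 τ / (2 * Complex.I * z)) -
    Complex.I * star (deriv (fun y => q y τ) 0) * χ τ with ha
  have hχc : ContinuousOn χ (uIcc 0 t) :=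
    ((continuous_apply 0).comp huc).continuousOn.div ((continuous_apply 1).comp huc).continuousOn
      fun τ hτ => (hest τ hτ).1
  have hqc : ContinuousOn (fun τ => q 0 τ) (uIcc 0 t) :=
    hq.continuous_clamp.continuousOn.congr fun τ hτ => by
      beta_reduce; rw [clampTime_of_mem hτ]
  have hqc' : ContinuousOn (fun τ => deriv (fun y => q y τ) 0) (uIcc 0 t) :=
    hq.continuous_clamp_deriv.continuousOn.congr fun τ hτ => by
      beta_reduce; rw [clampTime_of_mem hτ]
  have hac : ContinuousOn a (uIcc 0 t) :=
    ((continuousOn_const.mul hqc.star).mul (hχc.sub (hqc.div_const _))).sub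
      ((continuousOn_const.mul hqc'.star).mul hχc)
  have hab : ∀ τ ∈ uIcc 0 t, ‖a τ‖ ≤ K₃ / ‖z‖ := by
    intro τ hτ
    obtain ⟨-, e2, e3⟩ := hest τ hτ
    refine (norm_sub_le _ _).trans ?_
    simp only [norm_mul, norm_star, Complex.norm_I, one_mul, Complex.norm_ofNat]
    have e4 : ‖q 0 τ‖ ≤ B := (hB τ hτ).bound 0
    have e5 : ‖deriv (fun y => q y τ) 0‖ ≤ B := (hB τ hτ).bound' 0
    have e6 : 2 * ‖z‖ * ‖q 0 τ‖ * ‖χ τ - q 0 τ / (2 * Complex.I * z)‖ ≤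
        2 * ‖z‖ * B * (K₂ / ‖z‖ ^ 2) := by gcongr
    have e7 : ‖deriv (fun y => q y τ) 0‖ * ‖χ τ‖ ≤ B * (K₁ / ‖z‖) := by gcongr
    refine (add_le_add e6 e7).trans_eq ?_
    rw [hK₃]
    field_simp
  have hmain := eq_mul_exp_integral (t := t)
    (u := fun τ => u τ 1 * Complex.exp (-(2 * Complex.I * z ^ 2 * τ))) hac fun τ hτ => by
      have h1 := hasDerivAt_pi.1 (hud τ hτ) 1
      have h2 : HasDerivAt (fun τ : ℝ => Complex.exp (-(2 * Complex.I * z ^ 2 * τ)))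
          (Complex.exp (-(2 * Complex.I * z ^ 2 * τ)) * -(2 * Complex.I * z ^ 2 * 1)) τ :=
        ((Complex.ofRealCLM.hasDerivAt (x := τ)).const_mul (2 * Complex.I * z ^ 2)).neg.cexp
      refine (h1.mul h2).congr_deriv ?_
      have h3 := (hest τ hτ).1
      have hI := Complex.I_ne_zero
      simp only [ha, hχ, timeMatrix_eq, Matrix.mulVec, dotProduct, Fin.sum_univ_two,
        Matrix.of_apply, Matrix.cons_val', Matrix.cons_val_zero, Matrix.cons_val_one,
        Matrix.cons_val_fin_one]
      have h4 : q 0 τ / (2 * Complex.I * z) * z = -(Complex.I * q 0 τ) / 2 := by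
        field_simp
        linear_combination (q 0 τ) * Complex.I_sq
      have h5 : u τ 0 = u τ 0 / u τ 1 * u τ 1 := by field_simp
      generalize q 0 τ / (2 * Complex.I * z) = D at h4 ⊢
      generalize Complex.exp (-(2 * Complex.I * z ^ 2 * τ)) = e
      generalize u τ 0 / u τ 1 = X at h5 ⊢
      rw [h5]
      linear_combination 2 * star (q 0 τ) * u τ 1 * e * h4
  set η := ∫ τ in (0 : ℝ)..t, a τ with hη
  have hηb : ‖η‖ ≤ |t| * K₃ / ‖z‖ := by
    have := intervalIntegral.norm_integral_le_of_norm_le_const (a := 0) (b := t) (f := a)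
      (C := K₃ / ‖z‖) fun τ hτ => hab τ (uIoc_subset_uIcc hτ)
    rw [sub_zero] at this
    refine this.trans_eq ?_
    ring
  have hAz : A / ‖z‖ ≤ 1 / 2 := by
    rw [div_le_iff₀ hzp]; linarith
  have hK₁z : K₁ / ‖z‖ ≤ A / ‖z‖ := by
    gcongr
    exact le_add_of_nonneg_right (by positivity)
  have hx := (hest t ht).2.1.trans hK₁z
  have hy := (hest 0 h0).2.1.trans hK₁z
  have hηA : ‖η‖ ≤ A / ‖z‖ := hηb.trans (by gcongr; exact le_add_of_nonneg_left hK₁0)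
  have hfin := norm_exp_mul_div_sub_one_le hηA hx hy hAz
  have hw1 : u 0 1 * (1 + χ 0) = 1 := by
    have h1 := first_of_simMatrix_inv (w 0)
    have h2 : w 0 0 = 1 := by
      simp only [hw, (hq.isFund_transport z).zero, Matrix.one_mulVec]; rfl
    rw [h2] at h1
    change u 0 0 + u 0 1 = 1 at h1
    have h3 := (hest 0 h0).1
    simp only [hχ]
    field_simp
    linear_combination h1
  have hwt : preFactor L q ε t z = u t 1 * (1 + χ t) := by
    rw [preFactor_eq]
    change w t 0 = _
    rw [← first_of_simMatrix_inv (w t)]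
    change u t 0 + u t 1 = _
    have h3 := (hest t ht).1
    simp only [hχ]
    field_simp
    ring
  have hne : 1 + χ 0 ≠ 0 := right_ne_zero_of_mul_eq_one hw1
  -- The first component of the modified vector is `u₀ + u₁ = u₁ (1 + χ)`, equal to `1` at time `0`
  -- and to the time factor at time `t`.
  have e : preFactor L q ε t z * Complex.exp (-(2 * Complex.I * z ^ 2 * t)) =
      Complex.exp η * (1 + χ t) / (1 + χ 0) := by
    rw [hwt, eq_div_iff hne]
    simp only [Complex.ofReal_zero, mul_zero, neg_zero, Complex.exp_zero, mul_one] at hmain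
    linear_combination (1 + χ t) * (1 + χ 0) * hmain + (1 + χ t) * Complex.exp η * hw1
  rw [e]
  exact hfin.trans_eq (by ring)

/-- `z` has distance at least `δ` from the lattice `(π / L) ℤ`. -/
def AwayFromLattice (L δ : ℝ) (z : ℂ) : Prop :=
  ∀ n : ℤ, δ ≤ ‖z - ((n * (Real.pi / L) : ℝ) : ℂ)‖

theorem AwayFromLattice.conj {δ : ℝ} (h : AwayFromLattice L δ z) :
    AwayFromLattice L δ (starRingEnd ℂ z) := fun n => by
  rw [← RCLike.norm_conj, map_sub, Complex.conj_conj, Complex.conj_ofReal]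
  exact h n

theorem AwayFromLattice.of_near {δ δ' : ℝ} (h : AwayFromLattice L δ z) {w : ℂ}
    (hw : ‖w - z‖ ≤ δ - δ') : AwayFromLattice L δ' w := fun n => by
  have h1 := h n
  have h2 := norm_sub_le_norm_sub_add_norm_sub z w ((n * (Real.pi / L) : ℝ) : ℂ)
  rw [norm_sub_rev z w] at h2
  linarith

theorem AwayFromLattice.of_single (hL : 0 < L) {δ : ℝ} {n : ℤ}
    (h1 : δ ≤ ‖z - ((n * (Real.pi / L) : ℝ) : ℂ)‖)
    (h2 : ‖z - ((n * (Real.pi / L) : ℝ) : ℂ)‖ ≤ Real.pi / L - δ) : AwayFromLattice L δ z := by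
  intro m
  by_cases hmn : m = n
  · rwa [hmn]
  have hP : 0 < Real.pi / L := by positivity
  have h3 : Real.pi / L ≤ ‖((n * (Real.pi / L) : ℝ) : ℂ) - ((m * (Real.pi / L) : ℝ) : ℂ)‖ := by
    rw [← Complex.ofReal_sub, Complex.norm_real, ← sub_mul, norm_mul, Real.norm_of_nonneg hP.le]
    have : (1 : ℝ) ≤ ‖(n : ℝ) - m‖ := by
      rw [Real.norm_eq_abs, ← Int.cast_sub, ← Int.cast_abs]
      exact_mod_cast Int.one_le_abs (sub_ne_zero.2 (Ne.symm hmn))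
    nlinarith
  have h4 := norm_sub_le_norm_sub_add_norm_sub ((n * (Real.pi / L) : ℝ) : ℂ) z
    ((m * (Real.pi / L) : ℝ) : ℂ)
  rw [norm_sub_rev _ z] at h4
  linarith

/-- The error in the asymptotics of the time factors, glued from both half planes. -/
def phaseError (L : ℝ) (q : ℝ → ℝ → ℂ) (t : ℝ) (ε ε' : ℤˣ) (z : ℂ) : ℂ :=
  extFactor L q ε t z * Complex.exp (-(2 * Complex.I * (ε' : ℤ) * z ^ 2 * t)) - 1

/-- The direct estimate covers the half plane `ε Im z > 0`; conjugation gives the other one and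
reverses the sign of the phase. Here `ε` labels the phase: the factor with index `ε` above and the
one with index `-ε` below have the same phase and are the two that match across the spectrum. -/
theorem IsPeriodicNLSSolution.exists_asymptotics
    (hq : IsPeriodicNLSSolution L (uIcc 0 t) q) (hL : 0 < L) {δ : ℝ} (hδ : 0 < δ) :
    ∃ C N : ℝ, 0 ≤ C ∧ ∀ (ε : ℤˣ) (z : ℂ), AwayFromLattice L δ z → N ≤ ‖z‖ →
      (0 < z.im → ‖phaseError L q t ε ε z‖ ≤ C / ‖z‖) ∧
      (z.im < 0 → ‖phaseError L q t (-ε) ε z‖ ≤ C / ‖z‖) := by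
  obtain ⟨κ, hκ, hres⟩ := exists_nonresonant hL hδ
  obtain ⟨C, N, hC, h⟩ := hq.exists_preFactor_asymptotics hL hκ
  have key : ∀ (ε : ℤˣ) (z : ℂ), AwayFromLattice L δ z → N ≤ ‖z‖ → z.im ≠ 0 →
      ∀ s : ℝ, (s = 1 ∨ s = -1) → 0 < s * ((ε : ℤ) * z.im) →
      ‖preFactor L q ε t z * Complex.exp (-(s * (2 * Complex.I * z ^ 2 * t))) - 1‖ ≤
        C / ‖z‖ := by
    intro ε z hz hN him s hs hpos
    rcases hs with rfl | rfl
    · rw [Complex.ofReal_one, one_mul]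
      exact h ε z (by simpa using hpos) (hres z hz) hN
    · have h1 := h ε (starRingEnd ℂ z) (by rw [Complex.conj_im]; linarith) (hres _ hz.conj)
        (by rwa [RCLike.norm_conj])
      rw [hq.preFactor_conj hL fun h => him (hq.im_spec hL h), RCLike.norm_conj] at h1
      refine le_trans (le_of_eq ?_) h1
      rw [← RCLike.norm_conj]
      congr 1
      simp only [map_sub, map_mul, map_one, ← Complex.exp_conj, map_neg, map_pow,
        Complex.conj_I, Complex.conj_ofReal, Complex.conj_ofNat]
      congr 3
      push_cast
      ring
  refine ⟨C, N, hC, fun ε z hz hN => ⟨fun him => ?_, fun him => ?_⟩⟩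
  · rw [phaseError, hq.extFactor_eq_of_im_ne_zero hL him.ne']
    have := key ε z hz hN him.ne' ((ε : ℤ) : ℝ)
      (by rcases Int.units_eq_one_or ε with rfl | rfl <;> simp)
      (by rcases Int.units_eq_one_or ε with rfl | rfl <;> simpa using him)
    convert this using 5
    push_cast
    ring
  · rw [phaseError, hq.extFactor_eq_of_im_ne_zero hL him.ne]
    have := key (-ε) z hz hN him.ne ((ε : ℤ) : ℝ)
      (by rcases Int.units_eq_one_or ε with rfl | rfl <;> simp)
      (by rcases Int.units_eq_one_or ε with rfl | rfl <;> simpa using him)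
    convert this using 5
    push_cast
    ring

/-! ### The distribution of the gaps -/

/-- Far from the origin, real points away from the lattice belong to the spectrum. -/
theorem IsPeriodicNLSSolution.exists_mem_spec_of_away
    (hq : IsPeriodicNLSSolution L (uIcc 0 t) q) (hL : 0 < L) {δ : ℝ} (hδ : 0 < δ) :
    ∃ N : ℝ, 0 < N ∧ ∀ x : ℝ, N ≤ |x| → AwayFromLattice L δ x → (x : ℂ) ∈ spec q := by
  have h0 : (0 : ℝ) ∈ uIcc 0 t := left_mem_uIcc
  obtain ⟨κ, hκ, hres⟩ := exists_nonresonant hL hδ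
  obtain ⟨B, hB⟩ := hq.exists_boundedPotential hL
  have hp := hB 0 h0
  have hqb := quotBound_nonneg hL.le hp.nonneg hκ
  refine ⟨quotBound L B κ + 1, by positivity, fun x hx hxa => ?_⟩
  by_contra hxs
  have hx0 : 0 < |x| := by linarith
  have hxc : (x : ℂ) ≠ 0 := by
    rw [Complex.ofReal_ne_zero]; exact abs_pos.1 hx0
  obtain ⟨h1, h2⟩ := floquetMultiplier_spec hp.continuous hp.periodic hL hxs
  rw [← discriminant_two] at h1
  obtain ⟨c, hc, hMc⟩ := exists_eigenvector ((zsFund hp.continuous (x : ℂ)).det L) h1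
  have hv := isZSSolution_principal (z := (x : ℂ)) hp.continuous c
  have hv0 := principal_ne_zero (z := (x : ℂ)) hp.continuous hc
  have hc0 : (principalSolution (slice q 0) x 0).mulVec c = c := by
    rw [(zsFund hp.continuous (x : ℂ)).zero, Matrix.one_mulVec]
  have hvL : (principalSolution (slice q 0) x L).mulVec c =
      floquetMultiplier L (slice q 0) x • (principalSolution (slice q 0) x 0).mulVec c := by
    rw [hc0]; exact hMc
  have hcond : 0 ≤ (x : ℂ).im ∧ ‖floquetMultiplier L (slice q 0) x‖ < 1 ∨
      (x : ℂ).im ≤ 0 ∧ 1 < ‖floquetMultiplier L (slice q 0) x‖ :=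
    Or.inl ⟨by simp, h2⟩
  -- On the real line off the spectrum the conserved form vanishes on the decaying solution, so its
  -- two components have equal modulus at `0`. For large `|x|` this contradicts the bound `O(1/|x|)`
  -- for their quotient.
  have e1 := (hv.norm_le hp.continuous hv0 hL hvL hcond).2.2 (Complex.ofReal_im x)
  obtain ⟨e2, e3, -⟩ := hv.quot_estimate hp (hres _ hxa) hxc hv0 hL hvL hcond
  rw [norm_div, e1, div_self (norm_ne_zero_iff.2 e2), Complex.norm_real, Real.norm_eq_abs,
    le_div_iff₀ (by positivity)] at e3
  linarith

/-- Far from the origin, every interval of length `π / L` meets the spectrum. -/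
theorem IsPeriodicNLSSolution.exists_mem_spec
    (hq : IsPeriodicNLSSolution L (uIcc 0 t) q) (hL : 0 < L) :
    ∃ N : ℝ, 0 < N ∧ ∀ X : ℝ, N ≤ X ∨ X + Real.pi / L ≤ -N →
      ∃ y ∈ Icc X (X + Real.pi / L), (y : ℂ) ∈ spec q := by
  have hP : 0 < Real.pi / L := by positivity
  obtain ⟨N, hN, h⟩ := hq.exists_mem_spec_of_away hL (half_pos hP)
  refine ⟨N, hN, fun X hX => ?_⟩
  set P := Real.pi / L with hPdef
  -- The chosen point `(n + 1/2) P` is midway between lattice points, at distance `P / 2` from the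
  -- lattice.
  set n := ⌈X / P - 1 / 2⌉ with hn
  have h1 : X / P - 1 / 2 ≤ n := Int.le_ceil _
  have h2 : (n : ℝ) < X / P - 1 / 2 + 1 := Int.ceil_lt_add_one _
  have h3 : X / P * P = X := by field_simp
  have h4 : X ≤ (n + 1 / 2) * P := by nlinarith
  have h5 : (n + 1 / 2) * P ≤ X + P := by nlinarith
  refine ⟨(n + 1 / 2) * P, ⟨h4, h5⟩, h _ ?_ ?_⟩
  · rcases hX with hX | hX
    · exact (hX.trans h4).trans (le_abs_self _)
    · rw [abs_of_nonpos (by linarith)]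
      linarith
  · have e : ‖(((n + 1 / 2) * P : ℝ) : ℂ) - ((n * P : ℝ) : ℂ)‖ = P / 2 := by
      rw [← Complex.ofReal_sub, Complex.norm_real, Real.norm_of_nonneg (by nlinarith)]
      ring
    refine AwayFromLattice.of_single hL (n := n) ?_ ?_
    · rw [← hPdef, e]
    · rw [← hPdef, e]; linarith

/-- The spectrum is closed and unbounded in both directions, so every real point off it has a
nearest spectral point on either side. -/
theorem IsPeriodicNLSSolution.gapsCover
    (hq : IsPeriodicNLSSolution L (uIcc 0 t) q) (hL : 0 < L) : GapsCover (spec q) := by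
  intro x hx
  obtain ⟨N, hN, h⟩ := hq.exists_mem_spec hL
  have hP : 0 < Real.pi / L := by positivity
  set S : Set ℝ := {y | (y : ℂ) ∈ spec q} with hS
  have hSc : IsClosed S :=
    (isOpen_compl_iff.1 (hq.isOpen_compl_spec hL)).preimage Complex.continuous_ofReal
  obtain ⟨y₁, hy₁, hy₁S⟩ := h (max N x) (Or.inl (le_max_left _ _))
  obtain ⟨y₂, hy₂, hy₂S⟩ := h (min (-N) x - Real.pi / L)
    (Or.inr (by rw [sub_add_cancel]; exact min_le_left _ _))
  have hb : sInf (S ∩ Ici x) ∈ S ∩ Ici x :=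
    (hSc.inter isClosed_Ici).csInf_mem ⟨y₁, hy₁S, (le_max_right _ _).trans hy₁.1⟩
      ⟨x, fun y hy => hy.2⟩
  have ha : sSup (S ∩ Iic x) ∈ S ∩ Iic x :=
    (hSc.inter isClosed_Iic).csSup_mem
      ⟨y₂, hy₂S, by
        have := hy₂.2
        rw [sub_add_cancel] at this
        exact this.trans (min_le_right _ _)⟩ ⟨x, fun y hy => hy.2⟩
  set a := sSup (S ∩ Iic x)
  set b := sInf (S ∩ Ici x)
  have hxS : x ∉ S := hx
  have hax : a < x := lt_of_le_of_ne ha.2 fun h => hxS (h ▸ ha.1)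
  have hxb : x < b := lt_of_le_of_ne hb.2 fun h => hxS (h ▸ hb.1)
  refine ⟨a, b, ⟨hax.trans hxb, ha.1, hb.1, fun y hy hyS => ?_⟩, hax, hxb⟩
  rcases le_total y x with h | h
  · exact absurd (le_csSup ⟨x, fun y hy => hy.2⟩ ⟨hyS, h⟩ : y ≤ a) (not_le.2 hy.1)
  · exact absurd (csInf_le ⟨x, fun y hy => hy.2⟩ ⟨hyS, h⟩ : b ≤ y) (not_le.2 hy.2)

/-- The supremum is meaningful only for bounded lengths: a gap longer than `2N + 2P` would contain
an interval of length `P` beyond `±N`, and such an interval meets the spectrum. -/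
theorem IsPeriodicNLSSolution.gap_le_maxGapLength
    (hq : IsPeriodicNLSSolution L (uIcc 0 t) q) (hL : 0 < L) {a b : ℝ}
    (hab : IsGap (spec q) a b) : b - a ≤ maxGapLength (spec q) := by
  obtain ⟨N, hN, h⟩ := hq.exists_mem_spec hL
  have hP : 0 < Real.pi / L := by positivity
  set P := Real.pi / L
  refine le_csSup ⟨2 * N + 2 * P, ?_⟩ ⟨a, b, hab, rfl⟩
  rintro _ ⟨a, b, hab, rfl⟩
  by_contra! hlen
  have hno : ∀ X, a < X → X + P < b → ¬(N ≤ X ∨ X + P ≤ -N) := fun X h1 h2 h3 => by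
    obtain ⟨y, hy, hyS⟩ := h X h3
    exact hab.2.2.2 y ⟨h1.trans_le hy.1, hy.2.trans_lt h2⟩ hyS
  by_cases hb : N + P < b
  · obtain ⟨X, hX1, hX2⟩ : ∃ X, max a N < X ∧ X < b - P :=
      exists_between (max_lt (by linarith) (by linarith))
    rw [max_lt_iff] at hX1
    exact hno X hX1.1 (by linarith) (Or.inl hX1.2.le)
  · obtain ⟨X, hX1, hX2⟩ : ∃ X, a < X ∧ X < min (b - P) (-N - P) :=
      exists_between (lt_min (by linarith) (by linarith))
    rw [lt_min_iff] at hX2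
    exact hno X hX1 (by linarith) (Or.inr (by linarith))

end

section

open scoped Matrix.Norms.Operator

/-! ### Estimates up to the spectrum -/

variable {q : ℝ → ℝ → ℂ} {z : ℂ} {L : ℝ} {t : ℝ} {ε : ℤˣ}

theorem neBot_upper (h : 0 ≤ z.im) : (𝓝[{w : ℂ | 0 < w.im}] z).NeBot := by
  rw [← mem_closure_iff_nhdsWithin_neBot, Complex.closure_setOfPred_lt_im]
  exact h

theorem neBot_lower (h : z.im ≤ 0) : (𝓝[{w : ℂ | w.im < 0}] z).NeBot := by
  rw [← mem_closure_iff_nhdsWithin_neBot, Complex.closure_setOfPred_im_lt]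
  exact h

theorem real_eventually_spec {B : Set ℂ} {c r x : ℝ} (h : ∀ y : ℝ, |y - c| < r → (y : ℂ) ∈ B)
    (hx : |x - c| < r) : ∀ᶠ y in 𝓝 (0 : ℂ), y.im = 0 → (x + y : ℂ) ∈ B := by
  filter_upwards [Metric.ball_mem_nhds (0 : ℂ) (sub_pos.2 hx)] with y hy hy0
  rw [mem_ball_zero_iff] at hy
  have hyr : y = (y.re : ℂ) := Complex.ext rfl (by simpa using hy0)
  rw [hyr, Complex.norm_real, Real.norm_eq_abs] at hy
  rw [hyr, ← Complex.ofReal_add]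
  refine h _ ?_
  have := abs_add_le (x - c) y.re
  rw [show x + y.re - c = x - c + y.re by ring]
  linarith

/-- The maximum principle for the glued error near a point of the spectrum. -/
theorem IsPeriodicNLSSolution.phaseError_le_of_annulus
    (hq : IsPeriodicNLSSolution L (uIcc 0 t) q) (hL : 0 < L) {c r₁ r₂ r : ℝ} (h1 : r₁ < r)
    (h2 : r < r₂) (hr : 0 < r) (hspec : ∀ x : ℝ, |x - c| < r₂ → (x : ℂ) ∈ spec q) {M : ℝ}
    (hM : ∀ w : ℂ, r₁ < ‖w - c‖ → ‖w - c‖ < r₂ →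
      (0 < w.im → ‖phaseError L q t ε ε w‖ ≤ M) ∧
      (w.im < 0 → ‖phaseError L q t (-ε) ε w‖ ≤ M)) {w : ℂ} (hw : ‖w - c‖ < r) :
    (0 < w.im → ‖phaseError L q t ε ε w‖ ≤ M) ∧
      (w.im < 0 → ‖phaseError L q t (-ε) ε w‖ ≤ M) := by
  classical
  -- On the real line the glued function takes the limit from above. Near interior points of the
  -- spectrum it agrees with the common analytic continuation of the two factors, so it is
  -- holomorphic in the whole disc of radius `r₂`.
  set F : ℂ → ℂ := fun w => if 0 < w.im then extFactor L q ε t w else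
    if w.im < 0 then extFactor L q (-ε) t w else
      limUnder (𝓝[{w : ℂ | 0 < w.im}] w) (extFactor L q ε t) with hF
  have hup : ∀ w : ℂ, 0 < w.im → F w = extFactor L q ε t w := fun w h => if_pos h
  have hlo : ∀ w : ℂ, w.im < 0 → F w = extFactor L q (-ε) t w := fun w h => by
    simp only [hF, if_neg (not_lt.2 h.le), if_pos h]
  have hdiff : ∀ w : ℂ, ‖w - c‖ < r₂ → DifferentiableAt ℂ F w := by
    intro w hw
    have han : ∀ ε' : ℤˣ, w.im ≠ 0 → AnalyticAt ℂ (preFactor L q ε' t) w := fun ε' him =>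
      hq.analyticAt_preFactor hL (fun h => him (hq.im_spec hL h))
        (hq.modMonodromy_ne_zero hL left_mem_uIcc him)
    rcases lt_trichotomy w.im 0 with h | h | h
    · refine ((han (-ε) h.ne).differentiableAt).congr_of_eventuallyEq ?_
      filter_upwards [Complex.continuous_im.continuousAt.eventually (gt_mem_nhds h)] with y hy
      rw [hlo y hy, hq.extFactor_eq_of_im_ne_zero hL hy.ne]
    · have hwr : w = (w.re : ℂ) := Complex.ext rfl (by simpa using h)
      have hx : |w.re - c| < r₂ := by
        rwa [hwr, ← Complex.ofReal_sub, Complex.norm_real, Real.norm_eq_abs] at hw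
      obtain ⟨k, hk, hkw⟩ := hq.exists_interior_factor hL (real_eventually_spec hspec hx) ε
      rw [← hwr] at hk hkw
      refine hk.differentiableAt.congr_of_eventuallyEq ?_
      filter_upwards [hkw.eventually_nhds, hk.eventually_analyticAt] with y hy hky
      rcases lt_trichotomy y.im 0 with h | h | h
      · rw [hlo y h]; exact hy.self_of_nhds.2 h
      · have : F y = limUnder (𝓝[{w : ℂ | 0 < w.im}] y) (extFactor L q ε t) := by
          simp only [hF, h, lt_irrefl, if_false]
        rw [this]
        have := neBot_upper h.ge
        refine Tendsto.limUnder_eq ?_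
        refine (hky.continuousAt.tendsto.mono_left nhdsWithin_le_nhds).congr' ?_
        filter_upwards [nhdsWithin_le_nhds hy, self_mem_nhdsWithin] with s h1 h2
        exact (h1.1 h2).symm
      · rw [hup y h]; exact hy.self_of_nhds.1 h
    · refine ((han ε h.ne').differentiableAt).congr_of_eventuallyEq ?_
      filter_upwards [Complex.continuous_im.continuousAt.eventually (lt_mem_nhds h)] with y hy
      rw [hup y hy, hq.extFactor_eq_of_im_ne_zero hL hy.ne']
  set G : ℂ → ℂ := fun w =>
    F w * Complex.exp (-(2 * Complex.I * (ε : ℤ) * w ^ 2 * t)) - 1 with hG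
  have hGd : ∀ w : ℂ, ‖w - c‖ < r₂ → DifferentiableAt ℂ G w := fun w hw =>
    ((hdiff w hw).mul (by fun_prop)).sub_const 1
  have hGup : ∀ w : ℂ, 0 < w.im → G w = phaseError L q t ε ε w := fun w h => by
    simp only [hG, hup w h, phaseError]
  have hGlo : ∀ w : ℂ, w.im < 0 → G w = phaseError L q t (-ε) ε w := fun w h => by
    simp only [hG, hlo w h, phaseError]
  -- Continuity extends the bound to the real points of the annulus; the circle of radius `r` is
  -- then available for the maximum principle.
  have hann : ∀ w : ℂ, r₁ < ‖w - c‖ → ‖w - c‖ < r₂ → ‖G w‖ ≤ M := by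
    intro w hw1 hw2
    have hcont : ContinuousAt (fun w : ℂ => ‖w - c‖) w := by fun_prop
    have : (𝓝[{w : ℂ | w.im ≠ 0}] w).NeBot := by
      rcases le_total 0 w.im with h | h
      · have := neBot_upper h
        exact NeBot.mono this (nhdsWithin_mono _ fun y (hy : 0 < y.im) => hy.ne')
      · have := neBot_lower h
        exact NeBot.mono this (nhdsWithin_mono _ fun y (hy : y.im < 0) => hy.ne)
    refine le_of_tendsto
      ((hGd w hw2).continuousAt.norm.tendsto.mono_left nhdsWithin_le_nhds :
        Tendsto _ (𝓝[{w : ℂ | w.im ≠ 0}] w) _) ?_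
    filter_upwards [nhdsWithin_le_nhds (hcont.eventually (lt_mem_nhds hw1)),
      nhdsWithin_le_nhds (hcont.eventually (gt_mem_nhds hw2)), self_mem_nhdsWithin] with y a b h
    rcases lt_or_gt_of_ne (h : y.im ≠ 0) with h | h
    · rw [hGlo y h]; exact (hM y a b).2 h
    · rw [hGup y h]; exact (hM y a b).1 h
  have hball : ‖G w‖ ≤ M := by
    refine Complex.norm_le_of_forall_mem_frontier_norm_le (U := Metric.ball (c : ℂ) r)
      Metric.isBounded_ball ?_ (fun y hy => ?_)
      (subset_closure (by rwa [mem_ball_iff_norm]))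
    · refine DifferentiableOn.diffContOnCl fun y hy => ?_
      rw [closure_ball _ hr.ne', mem_closedBall_iff_norm] at hy
      exact (hGd y (hy.trans_lt h2)).differentiableWithinAt
    · rw [frontier_ball _ hr.ne', mem_sphere_iff_norm] at hy
      exact hann y (by rwa [hy]) (by rwa [hy])
  exact ⟨fun h => hGup w h ▸ hball, fun h => hGlo w h ▸ hball⟩

theorem IsGap.midpoint_mem {B : Set ℂ} {a b : ℝ} (h : IsGap B a b) :
    (a + b) / 2 ∈ Ioo a b := ⟨by linarith [h.1], by linarith [h.1]⟩

/-- The asymptotics near all points outside the discs about the gaps, up to the spectrum. -/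
theorem IsPeriodicNLSSolution.exists_local_asymptotics
    (hq : IsPeriodicNLSSolution L (uIcc 0 t) q) (hL : 0 < L) :
    ∃ C N : ℝ, 0 ≤ C ∧ 1 ≤ N ∧ ∀ (ε : ℤˣ) (z : ℂ), z ∉ gapDiscs (spec q) → N ≤ ‖z‖ →
      ∀ᶠ w in 𝓝 z, (0 < w.im → ‖phaseError L q t ε ε w‖ ≤ C / ‖z‖) ∧
        (w.im < 0 → ‖phaseError L q t (-ε) ε w‖ ≤ C / ‖z‖) := by
  have hP : 0 < Real.pi / L := by positivity
  set P := Real.pi / L with hPdef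
  -- The bound by `P / 2` makes a `δ`-disc about a lattice point stay away from the other lattice
  -- points. The bound by `R`, when gaps exist, makes a gap disc absorb any point within `δ` of the
  -- midpoint of its gap.
  obtain ⟨δ, hδ, hδP, hδR⟩ : ∃ δ : ℝ, 0 < δ ∧ δ ≤ P / 2 ∧
      ∀ a b, IsGap (spec q) a b → δ ≤ maxGapLength (spec q) := by
    by_cases h : ∃ a b, IsGap (spec q) a b
    · obtain ⟨a, b, hab⟩ := h
      have := hq.gap_le_maxGapLength hL hab
      have hpos : 0 < maxGapLength (spec q) := by linarith [hab.1]
      exact ⟨min (P / 2) (maxGapLength (spec q)), lt_min (half_pos hP) hpos, min_le_left _ _,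
        fun _ _ _ => min_le_right _ _⟩
    · push Not at h
      exact ⟨P / 2, half_pos hP, le_rfl, fun a b hab => absurd hab (h a b)⟩
  have hδ4 : 0 < δ / 4 := by positivity
  obtain ⟨C, N₁, hC, hasy⟩ := hq.exists_asymptotics hL hδ4
  obtain ⟨N₂, hN₂, hreal⟩ := hq.exists_mem_spec_of_away hL hδ4
  -- Points `w` within `2δ` of `z` have `‖w‖ ≥ ‖z‖ / 2`, which costs the factor `2` in the constant.
  -- The threshold also keeps the real points near the closest lattice point beyond `N₂`.
  refine ⟨2 * C, max 1 (2 * (|N₁| + N₂ + 2 * δ)), by positivity, le_max_left _ _,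
    fun ε z hz hN => ?_⟩
  have hz1 : 1 ≤ ‖z‖ := (le_max_left _ _).trans hN
  have hz2 : 2 * (|N₁| + N₂ + 2 * δ) ≤ ‖z‖ := (le_max_right _ _).trans hN
  have hN₁ := le_abs_self N₁
  have hN₁' := abs_nonneg N₁
  have hfar : ∀ w : ℂ, ‖w - z‖ ≤ 2 * δ → AwayFromLattice L (δ / 4) w →
      (0 < w.im → ‖phaseError L q t ε ε w‖ ≤ 2 * C / ‖z‖) ∧
      (w.im < 0 → ‖phaseError L q t (-ε) ε w‖ ≤ 2 * C / ‖z‖) := by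
    intro w hw hwa
    have h1 := norm_sub_norm_le z w
    rw [norm_sub_rev] at h1
    have h2 : ‖z‖ / 2 ≤ ‖w‖ := by linarith
    have h3 : C / ‖w‖ ≤ 2 * C / ‖z‖ := by
      rw [div_le_div_iff₀ (by linarith) (by linarith)]
      nlinarith
    obtain ⟨h4, h5⟩ := hasy ε w hwa (by linarith)
    exact ⟨fun h => (h4 h).trans h3, fun h => (h5 h).trans h3⟩
  by_cases hnear : AwayFromLattice L (δ / 2) z
  · filter_upwards [Metric.ball_mem_nhds z hδ4] with w hw
    rw [mem_ball_iff_norm] at hw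
    exact hfar w (by linarith) (hnear.of_near (by linarith))
  · rw [AwayFromLattice] at hnear
    push Not at hnear
    obtain ⟨n, hn⟩ := hnear
    rw [← hPdef] at hn
    set c : ℝ := n * P with hc
    have hcz : ‖z‖ - δ / 2 ≤ |c| := by
      have := norm_sub_norm_le z (c : ℂ)
      rw [Complex.norm_real, Real.norm_eq_abs] at this
      linarith
    have haway : ∀ w : ℂ, δ / 4 ≤ ‖w - c‖ → ‖w - c‖ < δ → AwayFromLattice L (δ / 4) w :=
      fun w h1 h2 => AwayFromLattice.of_single hL (n := n) h1 (by
        rw [← hPdef, ← hc]; linarith)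
    -- Near the lattice point `c` the direct estimate holds only on the annulus `δ/2 < |w - c| < δ`.
    -- Without a gap close to `c`, the maximum principle extends it to the interior.
    by_cases hsp : ∀ x : ℝ, |x - c| < δ → (x : ℂ) ∈ spec q
    · filter_upwards [Metric.ball_mem_nhds z hδ4] with w hw
      rw [mem_ball_iff_norm] at hw
      refine hq.phaseError_le_of_annulus hL (r₁ := δ / 2) (r := 3 * δ / 4) (r₂ := δ) (c := c)
        (by linarith) (by linarith) (by linarith) hsp (fun y h1 h2 => ?_) ?_
      · refine hfar y ?_ (haway y (by linarith) h2)
        have := norm_sub_le_norm_sub_add_norm_sub y (c : ℂ) z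
        rw [norm_sub_rev (c : ℂ) z] at this
        linarith
      · have := norm_sub_le_norm_sub_add_norm_sub w z (c : ℂ)
        linarith
    -- A gap meeting the `δ`-neighbourhood of `c` cannot contain real points with `δ/4 ≤ |y - c| <
    -- δ`, which are spectral. Being connected, it remains within `δ/2` of `c`. As `z` is also
    -- within `δ/2` of `c`, its distance to the midpoint of the gap is less than `δ ≤ R`, so `z`
    -- would lie in a gap disc.
    · exfalso
      push Not at hsp
      obtain ⟨x, hxc, hxs⟩ := hsp
      obtain ⟨a, b, hab, hx⟩ := hq.gapsCover hL x hxs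
      have hnorm : ∀ y : ℝ, ‖(y : ℂ) - c‖ = |y - c| := fun y => by
        rw [← Complex.ofReal_sub, Complex.norm_real, Real.norm_eq_abs]
      have hgap : ∀ y ∈ Ioo a b, |y - c| < δ → |y - c| < δ / 4 := by
        intro y hy hyc
        by_contra! hcon
        refine hab.2.2.2 y hy (hreal y ?_ (haway y (by rwa [hnorm]) (by rwa [hnorm])))
        have := abs_sub_abs_le_abs_sub c y
        rw [abs_sub_comm c y] at this
        linarith
      have hx4 := hgap x hx hxc
      have hall : ∀ y ∈ Ioo a b, |y - c| < δ / 2 := by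
        intro y hy
        by_contra! hcon
        obtain ⟨s, hs, hsv⟩ := isPreconnected_Ioo.intermediate_value hx hy
          (f := fun y => |y - c|) (by fun_prop) (show δ / 3 ∈ Icc |x - c| |y - c| from
            ⟨by linarith, by linarith⟩)
        beta_reduce at hsv
        have := hgap s hs (by linarith)
        linarith
      apply hz
      refine ⟨a, b, hab, le_trans ?_ (hδR a b hab)⟩
      have h1 := hall _ hab.midpoint_mem
      have h2 := norm_sub_le_norm_sub_add_norm_sub z (c : ℂ) (((a + b) / 2 : ℝ) : ℂ)
      rw [norm_sub_rev (c : ℂ), hnorm] at h2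
      linarith

theorem norm_phase_sub_one_le {f : ℂ → ℂ} {l : Filter ℂ} [l.NeBot] (hl : l ≤ 𝓝 z) {ℓ : ℂ}
    (hf : Tendsto f l (𝓝 ℓ)) {ε : ℤˣ} {M : ℝ}
    (h : ∀ᶠ w in l, ‖f w * Complex.exp (-(2 * Complex.I * (ε : ℤ) * w ^ 2 * t)) - 1‖ ≤ M) :
    ‖ℓ * Complex.exp (-(2 * Complex.I * (ε : ℤ) * z ^ 2 * t)) - 1‖ ≤ M := by
  have h1 : Continuous fun w : ℂ => Complex.exp (-(2 * Complex.I * (ε : ℤ) * w ^ 2 * t)) := by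
    fun_prop
  exact le_of_tendsto ((hf.mul ((h1.tendsto z).mono_left hl)).sub_const 1).norm h

theorem IsPeriodicNLSSolution.boundary_asymptotics
    (hq : IsPeriodicNLSSolution L (uIcc 0 t) q) (hL : 0 < L) (ε : ℤˣ) :
    ∃ C N : ℝ, ∀ z, z ∉ gapDiscs (spec q) → N ≤ ‖z‖ → ∀ ℓ : ℂ,
      (0 ≤ z.im → HasUpperValue (extFactor L q ε t) z ℓ →
        ‖ℓ * Complex.exp (-(2 * Complex.I * (ε : ℤ) * z ^ 2 * t)) - 1‖ ≤ C / ‖z‖) ∧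
      (z.im ≤ 0 → HasLowerValue (extFactor L q ε t) z ℓ →
        ‖ℓ * Complex.exp (2 * Complex.I * (ε : ℤ) * z ^ 2 * t) - 1‖ ≤ C / ‖z‖) := by
  obtain ⟨C, N, -, -, h⟩ := hq.exists_local_asymptotics hL
  refine ⟨C, N, fun z hz hN ℓ => ⟨fun him hℓ => ?_, fun him hℓ => ?_⟩⟩
  · have := neBot_upper him
    refine norm_phase_sub_one_le nhdsWithin_le_nhds hℓ ?_
    filter_upwards [nhdsWithin_le_nhds (h ε z hz hN), self_mem_nhdsWithin] with w h1 h2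
    exact h1.1 h2
  · have := neBot_lower him
    -- In the lower half plane the factor with index `ε` has phase sign `-ε`.
    have := norm_phase_sub_one_le (ε := -ε) (t := t) (M := C / ‖z‖) nhdsWithin_le_nhds hℓ (by
      filter_upwards [nhdsWithin_le_nhds (h (-ε) z hz hN), self_mem_nhdsWithin] with w h1 h2
      have := h1.2 h2
      rwa [neg_neg] at this)
    convert this using 5
    push_cast
    ring

/-! ### The growth bound -/

theorem IsPeriodicNLSSolution.isGap_or_interior
    (hq : IsPeriodicNLSSolution L (uIcc 0 t) q) (hL : 0 < L) (x : ℝ) :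
    (∃ a b, IsGap (spec q) a b ∧ x ∈ Icc a b) ∨
      ∀ᶠ y in 𝓝 (0 : ℂ), y.im = 0 → (x + y : ℂ) ∈ spec q := by
  by_cases hx : (x : ℂ) ∈ spec q
  · rcases interior_or_frequently hx with h | ⟨d, hd, h⟩
    · exact Or.inr h
    · exact Or.inl (hq.isGap_endpoint hL (hq.gapsCover hL) hd hx h)
  · obtain ⟨a, b, hab, h⟩ := hq.gapsCover hL x hx
    exact Or.inl ⟨a, b, hab, Ioo_subset_Icc_self h⟩

/-- The singular points cause no trouble: a neighbourhood of any point of a closed gap lies in the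
gap disc, whose radius is at least the length of the gap and so exceeds half of it. All other real
points are interior to the spectrum, where each factor continues analytically from either side. -/
theorem IsPeriodicNLSSolution.locally_bounded
    (hq : IsPeriodicNLSSolution L (uIcc 0 t) q) (hL : 0 < L) (ε : ℤˣ) (z : ℂ) :
    ∃ M : ℝ, ∀ᶠ w in 𝓝 z, w.im ≠ 0 → w ∉ gapDiscs (spec q) → ‖extFactor L q ε t w‖ ≤ M := by
  by_cases him : z.im = 0
  · have hre : z = (z.re : ℂ) := Complex.ext rfl (by simpa using him)
    rcases hq.isGap_or_interior hL z.re with ⟨a, b, hab, hx⟩ | h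
    · refine ⟨0, ?_⟩
      filter_upwards [Metric.ball_mem_nhds z (half_pos (sub_pos.2 hab.1))] with w hw _ hwg
      refine absurd ⟨a, b, hab, ?_⟩ hwg
      rw [mem_ball_iff_norm] at hw
      have h1 := norm_sub_le_norm_sub_add_norm_sub w z (((a + b) / 2 : ℝ) : ℂ)
      have h2 : ‖z - (((a + b) / 2 : ℝ) : ℂ)‖ ≤ (b - a) / 2 := by
        rw [hre, ← Complex.ofReal_sub, Complex.norm_real, Real.norm_eq_abs, abs_le]
        constructor <;> linarith [hx.1, hx.2]
      have h3 := hq.gap_le_maxGapLength hL hab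
      linarith
    · obtain ⟨k, hk, hkw⟩ := hq.exists_interior_factor hL h ε
      obtain ⟨k', hk', hkw'⟩ := hq.exists_interior_factor hL h (-ε)
      rw [← hre] at hk hk' hkw hkw'
      refine ⟨max (‖k z‖ + 1) (‖k' z‖ + 1), ?_⟩
      filter_upwards [hkw, hkw',
        hk.continuousAt.norm.eventually (gt_mem_nhds (lt_add_one ‖k z‖)),
        hk'.continuousAt.norm.eventually (gt_mem_nhds (lt_add_one ‖k' z‖))] with w h1 h2 h3 h4 h5 _
      rcases lt_or_gt_of_ne h5 with h5 | h5
      · have := h2.2 h5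
        rw [neg_neg] at this
        rw [this]
        exact h4.le.trans (le_max_right _ _)
      · rw [h1.1 h5]
        exact h3.le.trans (le_max_left _ _)
  · refine ⟨‖extFactor L q ε t z‖ + 1, ?_⟩
    filter_upwards [(hq.continuousAt_extFactor (ε := ε) hL him).norm.eventually
      (gt_mem_nhds (lt_add_one _))] with w hw _ _
    exact hw.le

theorem IsPeriodicNLSSolution.exists_bound_on_compact
    (hq : IsPeriodicNLSSolution L (uIcc 0 t) q) (hL : 0 < L) (ε : ℤˣ) {K : Set ℂ}
    (hK : IsCompact K) : ∃ M : ℝ, ∀ w ∈ K, w.im ≠ 0 → w ∉ gapDiscs (spec q) →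
      ‖extFactor L q ε t w‖ ≤ M := by
  refine hK.induction_on (p := fun K => ∃ M : ℝ, ∀ w ∈ K, w.im ≠ 0 → w ∉ gapDiscs (spec q) →
    ‖extFactor L q ε t w‖ ≤ M) ⟨0, by simp⟩ ?_ ?_ ?_
  · rintro s s' hs ⟨M, hM⟩
    exact ⟨M, fun w hw => hM w (hs hw)⟩
  · rintro s s' ⟨M, hM⟩ ⟨M', hM'⟩
    refine ⟨max M M', fun w hw h1 h2 => ?_⟩
    rcases hw with hw | hw
    · exact (hM w hw h1 h2).trans (le_max_left _ _)
    · exact (hM' w hw h1 h2).trans (le_max_right _ _)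
  · intro z _
    obtain ⟨M, hM⟩ := hq.locally_bounded hL ε z
    exact ⟨_, nhdsWithin_le_nhds hM, M, fun w hw => hw⟩

theorem norm_le_of_norm_mul_exp_sub_one_le {f θ : ℂ} {M : ℝ}
    (h : ‖f * Complex.exp (-θ) - 1‖ ≤ M) : ‖f‖ ≤ (M + 1) * Real.exp ‖θ‖ := by
  have h1 : f = (f * Complex.exp (-θ) - 1 + 1) * Complex.exp θ := by
    rw [sub_add_cancel, mul_assoc, ← Complex.exp_add, neg_add_cancel, Complex.exp_zero, mul_one]
  rw [h1, norm_mul]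
  refine mul_le_mul ((norm_add_le _ _).trans ?_) ?_ (norm_nonneg _)
    (by linarith [(norm_nonneg _).trans h])
  · rw [norm_one]; linarith
  · exact Complex.norm_exp_le_exp_norm θ

theorem IsPeriodicNLSSolution.growth_bound
    (hq : IsPeriodicNLSSolution L (uIcc 0 t) q) (hL : 0 < L) :
    ∃ c M : ℝ, 0 < c ∧ 0 < M ∧ ∀ (ε : ℤˣ) (z : ℂ), z.im ≠ 0 → z ∉ gapDiscs (spec q) →
      ‖extFactor L q ε t z‖ ≤ M * Real.exp (c * ‖z‖ ^ 2) := by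
  obtain ⟨C, N, hC, hN1, h⟩ := hq.exists_local_asymptotics hL
  have hcomp : ∀ ε : ℤˣ, ∃ M : ℝ, ∀ w ∈ Metric.closedBall (0 : ℂ) N, w.im ≠ 0 →
      w ∉ gapDiscs (spec q) → ‖extFactor L q ε t w‖ ≤ M := fun ε =>
    hq.exists_bound_on_compact hL ε (isCompact_closedBall 0 N)
  choose M hM using hcomp
  have hnn : ∀ ε, M ε ≤ |M 1| + |M (-1)| := fun ε => by
    rcases Int.units_eq_one_or ε with rfl | rfl
    · linarith [le_abs_self (M 1), abs_nonneg (M (-1))]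
    · linarith [le_abs_self (M (-1)), abs_nonneg (M 1)]
  set A := |M 1| + |M (-1)| + (C + 1) with hA
  have hMA : 0 ≤ |M 1| + |M (-1)| := by positivity
  -- The phase has modulus `2|t|‖z‖²`; the summand `1` keeps the exponent positive also for `t = 0`.
  refine ⟨2 * |t| + 1, A, by positivity, by positivity, fun ε z him hz => ?_⟩
  rcases le_total ‖z‖ N with hzN | hzN
  · refine (hM ε z (by simpa using hzN) him hz).trans ((hnn ε).trans ?_)
    have h1 : 1 ≤ Real.exp ((2 * |t| + 1) * ‖z‖ ^ 2) := Real.one_le_exp (by positivity)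
    have h2 : |M 1| + |M (-1)| ≤ A := by rw [hA]; linarith
    nlinarith
  · have hz1 : 1 ≤ ‖z‖ := hN1.trans hzN
    have hCz : C / ‖z‖ ≤ C := div_le_self hC hz1
    obtain ⟨s, hs⟩ : ∃ s : ℤˣ,
        ‖extFactor L q ε t z * Complex.exp (-(2 * Complex.I * (s : ℤ) * z ^ 2 * t)) - 1‖ ≤ C := by
      rcases lt_or_gt_of_ne him with him | him
      · refine ⟨-ε, ?_⟩
        have := (h (-ε) z hz hzN).self_of_nhds.2 him
        rw [neg_neg] at this
        exact this.trans hCz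
      · exact ⟨ε, ((h ε z hz hzN).self_of_nhds.1 him).trans hCz⟩
    refine (norm_le_of_norm_mul_exp_sub_one_le hs).trans ?_
    have e : ‖2 * Complex.I * (s : ℤ) * z ^ 2 * t‖ = 2 * |t| * ‖z‖ ^ 2 := by
      have : ‖((s : ℤ) : ℂ)‖ = 1 := by rcases Int.units_eq_one_or s with rfl | rfl <;> simp
      simp only [norm_mul, norm_pow, this, Complex.norm_I, Complex.norm_ofNat, Complex.norm_real,
        Real.norm_eq_abs]
      ring
    rw [e]
    refine mul_le_mul (by rw [hA]; linarith) (Real.exp_le_exp.2 ?_) (Real.exp_pos _).le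
      (by positivity)
    have := sq_nonneg ‖z‖
    linarith

end

end DefocusingNLS

end

/-! ### The proposition on the time factors -/

open DefocusingNLS
theorem propositionp (L : ℝ) (hL : 0 < L) (S : Set ℝ) (hS : S.OrdConnected) (h0 : (0 : ℝ) ∈ S)
    (q : ℝ → ℝ → ℂ) (hq : IsPeriodicNLSSolution L S q) (t : ℝ) (ht : t ∈ S) :
    ∃ e : ℤˣ → ℂ → ℂ,
      -- the extension of the time factors, meromorphic off the spectrum
      (∀ ε z, z ∉ spec q →
        (z.im ≠ 0 ∨ ∀ τ ∈ uIcc 0 t, z ∉ dirichletSpectrum L (slice q τ)) →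
        e ε z = timeFactor L q ε t z) ∧
      (∀ ε, MeromorphicNFOn (e ε) (spec q)ᶜ) ∧
      -- simple poles and simple zeros off the spectrum
      (∀ ε : ℤˣ, ∀ z, z ∉ spec q → meromorphicOrderAt (e ε) z =
        ((movableInd L q t ε z - movableInd L q 0 ε z : ℤ) : WithTop ℤ)) ∧
      -- square root behaviour at the endpoints of the gaps
      (∀ a b, IsGap (spec q) a b → ∀ ε,
        HasSqrtOrder (e ε) (spec q) a 1 (movableInd L q t 0 a - movableInd L q 0 0 a) ∧
        HasSqrtOrder (e ε) (spec q) b (-1) (movableInd L q t 0 b - movableInd L q 0 0 b)) ∧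
      -- boundary values on the spectrum, where they are finite
      (∀ z ∈ spec q, 0 ≤ movableInd L q t 0 z - movableInd L q 0 0 z → ∀ ε, ∃ ℓ : ℂ,
        HasUpperValue (e ε) z ℓ ∧ HasLowerValue (e (-ε)) z ℓ) ∧
      -- asymptotics in the closed half planes
      (∀ ε : ℤˣ, ∃ C N : ℝ, ∀ z, z ∉ gapDiscs (spec q) → N ≤ ‖z‖ → ∀ ℓ : ℂ,
        (0 ≤ z.im → HasUpperValue (e ε) z ℓ →
          ‖ℓ * Complex.exp (-(2 * Complex.I * (ε : ℤ) * z ^ 2 * t)) - 1‖ ≤ C / ‖z‖) ∧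
        (z.im ≤ 0 → HasLowerValue (e ε) z ℓ →
          ‖ℓ * Complex.exp (2 * Complex.I * (ε : ℤ) * z ^ 2 * t) - 1‖ ≤ C / ‖z‖)) ∧
      -- growth bound
      (∃ c M : ℝ, 0 < c ∧ 0 < M ∧ ∀ ε z, z.im ≠ 0 → z ∉ gapDiscs (spec q) →
        ‖e ε z‖ ≤ M * Real.exp (c * ‖z‖ ^ 2)) := by
  -- Only times between `0` and `t` matter, and this restriction supplies the compactness used for
  -- uniform bounds.
  have hq' : IsPeriodicNLSSolution L (uIcc 0 t) q := hq.mono (hS.uIcc_subset h0 ht)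
  have hcov := hq'.gapsCover hL
  refine ⟨fun ε => extFactor L q ε t, fun ε z hz h => hq'.extFactor_eq_timeFactor hL hz h,
    fun ε => meromorphicNFOn_toMeromorphicNFOn _ _,
    fun ε z hz => hq'.meromorphicOrderAt_extFactor hL hcov hz ε, fun a b hab ε => ⟨?_, ?_⟩,
    fun z hz hn ε => hq'.boundary_values hL hcov hz hn ε,
    fun ε => hq'.boundary_asymptotics hL ε, hq'.growth_bound hL⟩
  · simpa using hq'.hasSqrtOrder_extFactor hL (by norm_num) hab.2.1 hab.frequently_right
      ⟨a, b, hab, left_mem_Icc.2 hab.1.le⟩ ε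
  · simpa using hq'.hasSqrtOrder_extFactor hL (by norm_num) hab.2.2.1 hab.frequently_left
      ⟨a, b, hab, right_mem_Icc.2 hab.1.le⟩ ε
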